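/- **Definitions.** A *generalized permutation* is an ordered pair of nonempty words (the top and the bottom line) in which every occurring symbol occurs exactly twice in total. It is *cylindrical* if the first symbol of one line is the last symbol of the other line, and the set of symbols of neither line is a proper subset of the set of symbols of the other. Let $\pi$ be a cylindrical generalized permutation and let $\alpha_0$ be a symbol that is the first symbol of one line and the last symbol of the other. Choose arbitrary positive lengths of all symbols other than $\alpha_0$ for which the total lengths of the two lines are equal; regard the corresponding vectors as positive horizontal vectors, and assign to $\alpha_0$ any vector with positive imaginary part if $\alpha_0$ is the first symbol of the top line, and with negative imaginary part if $\alpha_0$ is the first symbol of the bottom line. The two broken lines starting at $0\in\mathbb C$ whose sides are the vectors of the symbols of the top and of the bottom line bound a parallelogram. Identify the two sides with the same symbol by a parallel translation if they lie in different lines and by a central symmetry if they lie in the same line. The result is a closed Riemann surface with the quadratic differential $q$ induced by $dz^2$, called a *suspension* over $\pi$. The diagonal of the parallelogram joining the common starting point $0$ of the two broken lines to their common end is denoted by $X$, and $0$ is its left endpoint. For positive integers $d_1,\dots,d_n$ and $p\ge 0$ the *stratum* $\mathcal Q(d_1,\dots,d_n,-1^p)$ consists of the pairs (closed connected Riemann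 surface, meromorphic quadratic differential $q$) such that $q$ is not a global square of an Abelian differential and has exactly $n$ zeroes, of degrees $d_1,\dots,d_n$, and exactly $p$ poles, all simple. A cylindrical generalized permutation $\pi$ *represents* $\mathcal Q(d_1,\dots,d_n,-1^p)$ if suspensions over $\pi$ exist and every suspension over $\pi$ belongs to this stratum and has a singularity of degree $d_1$ at the left endpoint of $X$. **Proposition 3.2.** Let $d_1,\dots,d_n$ be strictly positive integers with $d_1+\dots+d_n=p\ge 2$. The pair of lines obtained by erasing the symbols $$ \underbrace{2,4,\dots,2(d_1-1)}_{d_1-1},\quad \underbrace{2(d_1+1),\dots,2(d_1+d_2-1)}_{d_2-1},\quad \dots,\quad \underbrace{2(d_1+\dots+d_{n-1}+1),\dots,2(d_1+\dots+d_n-1)}_{d_n-1} $$ (the $k$-th group being empty if $d_k=1$) in the generalized permutation $$ \begin{pmatrix} 0,1,\quad 2,3,3,\quad 4,5,5,\quad \dots,\quad 2p-2,\,2p-1,\,2p-1\\ 2,4,\dots,2p-2,\quad 1,\,2p,\,2p,\quad 0 \end{pmatrix} $$ is a cylindrical generalized permutation and represents the stratum $\mathcal Q(d_1,\dots,d_n,-1^p)$.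 (By $d_1+\dots+d_n-p=4g-4$ these are strata in genus $g=1$.) -/

import Mathlib

open scoped Manifold ContDiff Topology

/-! ## Quadratic differentials on Riemann surfaces -/

/-- A meromorphic quadratic differential on a Riemann surface `X`: in each chart `c` of the atlas it
is `(toFun c)(z) dz²` with `toFun c` meromorphic on the range of the chart, and the local
expressions are related by `q_c(z) = q_{c'}(τ(z)) τ'(z)²`, `τ = c' ∘ c⁻¹`. The local expressions are
in normal form (the correct value at every regular point, the value `0` at every pole), so that
there are no spurious values at isolated points. -/
structure QuadraticDifferential (X : Type) [TopologicalSpace X] [ChartedSpace ℂ X] where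
  toFun : OpenPartialHomeomorph X ℂ → ℂ → ℂ
  meromorphic : ∀ c ∈ atlas ℂ X, MeromorphicNFOn (toFun c) c.target
  compat : ∀ c ∈ atlas ℂ X, ∀ c' ∈ atlas ℂ X, ∀ z ∈ c.target, c.symm z ∈ c'.source →
    toFun c z = toFun c' (c' (c.symm z)) * deriv (fun w => c' (c.symm w)) z ^ 2

/-- An Abelian differential (holomorphic 1-form) on a Riemann surface `X`: `(toFun c)(z) dz` in each
chart `c`. -/
structure AbelianDifferential (X : Type) [TopologicalSpace X] [ChartedSpace ℂ X] where
  toFun : OpenPartialHomeomorph X ℂ → ℂ → ℂ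
  holomorphic : ∀ c ∈ atlas ℂ X, AnalyticOnNhd ℂ (toFun c) c.target
  compat : ∀ c ∈ atlas ℂ X, ∀ c' ∈ atlas ℂ X, ∀ z ∈ c.target, c.symm z ∈ c'.source →
    toFun c z = toFun c' (c' (c.symm z)) * deriv (fun w => c' (c.symm w)) z

namespace QuadraticDifferential

variable {X : Type} [TopologicalSpace X] [ChartedSpace ℂ X]

/-- The order of `q` at `x` (positive at a zero, negative at a pole). -/
noncomputable def orderAt (q : QuadraticDifferential X) (x : X) : WithTop ℤ :=
  meromorphicOrderAt (q.toFun (chartAt ℂ x)) (chartAt ℂ x x)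

/-- `q` is a global square of an Abelian differential. -/
def IsGlobalSquare (q : QuadraticDifferential X) : Prop :=
  ∃ η : AbelianDifferential X, ∀ c ∈ atlas ℂ X, ∀ z ∈ c.target, q.toFun c z = η.toFun c z ^ 2

end QuadraticDifferential

/-- A closed connected Riemann surface with a meromorphic quadratic differential. -/
structure QuadraticSurface where
  carrier : Type
  [topologicalSpace : TopologicalSpace carrier]
  [t2Space : T2Space carrier]
  [compactSpace : CompactSpace carrier]
  [connectedSpace : ConnectedSpace carrier]
  [chartedSpace : ChartedSpace ℂ carrier]
  [isManifold : IsManifold 𝓘(ℂ) ω carrier]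
  q : QuadraticDifferential carrier

attribute [instance] QuadraticSurface.topologicalSpace QuadraticSurface.t2Space
  QuadraticSurface.compactSpace QuadraticSurface.connectedSpace QuadraticSurface.chartedSpace
  QuadraticSurface.isManifold

/-- `S` belongs to the stratum `Q(d₁, …, dₙ, -1^p)`: its quadratic differential is not a global
square of an Abelian differential, it has exactly `n` zeroes, of degrees `d₁, …, dₙ`, and exactly
`p` poles, all of them simple. -/
def QuadraticSurface.InStratum (S : QuadraticSurface) {n : ℕ} (d : Fin n → ℕ) (p : ℕ) : Prop :=
  ¬ S.q.IsGlobalSquare ∧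
  ∃ (zero : Fin n → S.carrier) (pole : Fin p → S.carrier),
    Function.Injective (Sum.elim zero pole) ∧
    (∀ i, S.q.orderAt (zero i) = ((d i : ℤ) : WithTop ℤ)) ∧
    (∀ j, S.q.orderAt (pole j) = ((-1 : ℤ) : WithTop ℤ)) ∧
    ∀ x, x ∉ Set.range (Sum.elim zero pole) → S.q.orderAt x = 0

/-! ## Generalized permutations and their suspensions -/

/-- An ordered pair of words ("lines") in the alphabet `ℕ`. -/
structure TwoLines where
  top : List ℕ
  bottom : List ℕ

namespace TwoLines

/-- Both lines are nonempty and every symbol that is present occurs exactly twice. -/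
def IsGeneralizedPermutation (π : TwoLines) : Prop :=
  π.top ≠ [] ∧ π.bottom ≠ [] ∧ ∀ a ∈ π.top ++ π.bottom, (π.top ++ π.bottom).count a = 2

/-- A cylindrical generalized permutation: the first symbol of one of the lines is the last symbol
of the complementary line, and the set of symbols of neither line is a proper subset of the set of
symbols of the other line. -/
def IsCylindrical (π : TwoLines) : Prop :=
  π.IsGeneralizedPermutation ∧
  (π.top.head? = π.bottom.getLast? ∨ π.bottom.head? = π.top.getLast?) ∧
  ¬ π.top.toFinset ⊂ π.bottom.toFinset ∧ ¬ π.bottom.toFinset ⊂ π.top.toFinset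

/-- The pair of lines obtained by erasing the symbols of the set `E`. -/
def erase (π : TwoLines) (E : Finset ℕ) : TwoLines where
  top := π.top.filter (· ∉ E)
  bottom := π.bottom.filter (· ∉ E)

/-- The vectors `ζ a` of the sides of a parallelogram pattern of a cylindrical generalized
permutation: for a symbol `a₀` that is the first one of one line and the last one of the other
line, `ζ a₀` is transverse to the horizontal direction, all other vectors are horizontal of
arbitrary positive lengths, and the broken lines drawn from the top line and from the bottom line
have the same end. The sign of the imaginary part of `ζ a₀` is such that the broken line of the top
line is above that of the bottom line. -/
def IsSuspensionDatum (π : TwoLines) (ζ : ℕ → ℂ) : Prop :=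
  (∃ a₀, ((π.top.head? = some a₀ ∧ π.bottom.getLast? = some a₀ ∧ 0 < (ζ a₀).im) ∨
      (π.bottom.head? = some a₀ ∧ π.top.getLast? = some a₀ ∧ (ζ a₀).im < 0)) ∧
    ∀ a ∈ π.top ++ π.bottom, a ≠ a₀ → 0 < (ζ a).re ∧ (ζ a).im = 0) ∧
  (π.top.map ζ).sum = (π.bottom.map ζ).sum

/-- The `i`-th vertex of the broken line that starts at `0` and has the sides `ζ a`, `a ∈ l`. -/
noncomputable def vertex (ζ : ℕ → ℂ) (l : List ℕ) (i : ℕ) : ℂ :=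
  ((l.take i).map ζ).sum

/-- The closed parallelogram bounded by the two broken lines. The diagonal `X` joins the common
starting point `0` of the broken lines (the left endpoint of `X`) to their common end. -/
noncomputable def parallelogram (π : TwoLines) (ζ : ℕ → ℂ) : Set ℂ :=
  convexHull ℝ (Set.range (vertex ζ π.top) ∪ Set.range (vertex ζ π.bottom))

/-- Identification of the sides of the parallelogram: the two sides labelled by the same symbol are
identified by a parallel translation if they belong to different lines, and by a central symmetry
if they belong to the same line. -/
inductive Glue (π : TwoLines) (ζ : ℕ → ℂ) : ℂ → ℂ → Prop
  | translation (i j a : ℕ) (s : ℝ) (hs : s ∈ Set.Icc (0 : ℝ) 1)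
      (hi : π.top[i]? = some a) (hj : π.bottom[j]? = some a) :
      Glue π ζ (vertex ζ π.top i + s * ζ a) (vertex ζ π.bottom j + s * ζ a)
  | symmetryTop (i j a : ℕ) (s : ℝ) (hs : s ∈ Set.Icc (0 : ℝ) 1) (hij : i ≠ j)
      (hi : π.top[i]? = some a) (hj : π.top[j]? = some a) :
      Glue π ζ (vertex ζ π.top i + s * ζ a) (vertex ζ π.top j + (1 - s) * ζ a)
  | symmetryBottom (i j a : ℕ) (s : ℝ) (hs : s ∈ Set.Icc (0 : ℝ) 1) (hij : i ≠ j)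
      (hi : π.bottom[i]? = some a) (hj : π.bottom[j]? = some a) :
      Glue π ζ (vertex ζ π.bottom i + s * ζ a) (vertex ζ π.bottom j + (1 - s) * ζ a)

/-- `S`, together with the projection `f` of the parallelogram onto it, is the suspension over `π`
with side vectors `ζ`: topologically `S` is the quotient of the closed parallelogram by the
identification of its sides, and the quadratic differential of `S` is `dz²` in the coordinate `z`
of the parallelogram. (This determines `S` up to isomorphism: two such surfaces are related by a
homeomorphism that is conformal off the images of the sides, hence conformal, and that respects
the quadratic differentials.) -/
def IsSuspension (π : TwoLines) (ζ : ℕ → ℂ) (S : QuadraticSurface) (f : ℂ → S.carrier) : Prop :=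
  ContinuousOn f (π.parallelogram ζ) ∧
  f '' π.parallelogram ζ = Set.univ ∧
  (∀ z ∈ π.parallelogram ζ, ∀ w ∈ π.parallelogram ζ,
    f z = f w ↔ Relation.EqvGen (π.Glue ζ) z w) ∧
  ∀ z ∈ interior (π.parallelogram ζ), ∀ c ∈ atlas ℂ S.carrier, f z ∈ c.source →
    DifferentiableAt ℂ (fun w => c (f w)) z ∧
    S.q.toFun c (c (f z)) * deriv (fun w => c (f w)) z ^ 2 = 1

/-- The cylindrical generalized permutation `π` represents the stratum `Q(d₁, …, dₙ, -1^p)`: side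
vectors of a suspension exist, and whatever they are, the suspension belongs to the stratum and
has a singularity of degree `d₁` at the left endpoint of `X`. -/
def Represents (π : TwoLines) {n : ℕ} (d : Fin n → ℕ) (p : ℕ) : Prop :=
  π.IsCylindrical ∧
  (∃ ζ, π.IsSuspensionDatum ζ) ∧
  ∀ ζ, π.IsSuspensionDatum ζ →
    ∃ (S : QuadraticSurface) (f : ℂ → S.carrier), π.IsSuspension ζ S f ∧ S.InStratum d p ∧
      ∀ h : 0 < n, S.q.orderAt (f 0) = ((d ⟨0, h⟩ : ℤ) : WithTop ℤ)

end TwoLines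

/-! ## The generalized permutations of genus one -/

/-- The generalized permutation with top line `0, 1, 2, 3, 3, 4, 5, 5, …, 2p-2, 2p-1, 2p-1` and
bottom line `2, 4, …, 2p-2, 1, 2p, 2p, 0`. -/
def genusOnePermutation (p : ℕ) : TwoLines where
  top := [0, 1] ++ (List.range (p - 1)).flatMap fun k => [2 * k + 2, 2 * k + 3, 2 * k + 3]
  bottom := (List.range (p - 1)).map (fun k => 2 * k + 2) ++ [1, 2 * p, 2 * p, 0]

/-- The symbols to be erased: for every `k` the `d k - 1` symbols `2 (D + j)`, `1 ≤ j ≤ d k - 1`,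
where `D` is the sum of the `d i` with `i < k`. -/
def erasedSymbols {n : ℕ} (d : Fin n → ℕ) : Finset ℕ :=
  Finset.univ.biUnion fun k : Fin n =>
    (Finset.Ico 1 (d k)).image fun j => 2 * ((∑ i ∈ Finset.Iio k, d i) + j)

/-! Gluing the two transverse sides of the parallelogram produces a flat cylinder, and the
suspension arises from it by pairing the remaining sides on the two boundary circles. On the top
circle each pair of neighbouring sides with the same odd symbol `3, 5, …, 2p-1` is folded into a
hair with a free end; on the bottom circle the pair `2p, 2p` is folded in the same way. After the
folding both circles carry the side `1` and the surviving even sides in the same cyclic order, so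
they are glued to one circle. The boundary of the cylinder thus becomes a circle with `p` hairs, and
the surface is a torus.

If `k` half discs meet at a boundary point, the cone angle is `kπ` and the differential has order `k
- 2` there. At the free end of a hair `k = 1`, which gives the `p` simple poles; one simple pole
already excludes a global square. At a vertex of the circle to which `h` hairs are attached `k = h +
2`, which gives a zero of degree `h`. The surviving even sides and `1` cut the hairs into groups,
and erasing an even symbol merges two neighbouring groups; the prescribed erasures leave groups of
sizes `d₁, …, dₙ`. The origin lies in the first group, whence the degree `d₁` at the left endpoint
of `X`.

The analytic half is carried out for an arbitrary cylinder whose boundary is glued by a permutation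
with finite cycles. A cycle of length `k` gets the coordinate `w` with `w ^ k = -u ^ 2`, in which
`du²` becomes `-(k²/4) w^(k-2) dw²`. The carrying facts are that half discs are identified exactly
as sectors in this coordinate (`IsGood.sectorCoord_eq_iff`), that charts are compatible
(`transition`), and the order formula `orderAt_germ`.

The combinatorial half turns words into such a permutation, whose cycles at the vertices are those
of `vertexPerm`. `IsSpelling.isSuspension` shows that the result is the quotient of the
parallelogram. `IsGenusOne.sameCycle_iff` identifies the cycles with the vertices of the circle with
hairs, `countP_source_inl` counts the sides at each of them, and `exists_block` computes the sizes
of the groups. -/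

/-! ## The power coordinate on half discs -/

/-- The `j`-th half plane, placed in the `k`-sheeted power coordinate `u ↦ u ^ (2 / k)`. -/
noncomputable def sectorCoord (k : ℕ) (j : ℤ) (u : ℂ) : ℂ :=
  Complex.exp (-(2 * Real.pi * Complex.I * (j / k))) * (-Complex.I * u) ^ (((2 / k : ℝ) : ℝ) : ℂ)

section SectorCoord

variable {k : ℕ} {j j' : ℤ} {u u' : ℂ}

theorem sectorCoord_zero (hk : 0 < k) : sectorCoord k j 0 = 0 := by
  have : (((2 / k : ℝ) : ℝ) : ℂ) ≠ 0 := by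
    have : (k : ℝ) ≠ 0 := by positivity
    exact_mod_cast div_ne_zero two_ne_zero this
  rw [sectorCoord, mul_zero, Complex.zero_cpow this, mul_zero]

theorem norm_sectorCoord : ‖sectorCoord k j u‖ = ‖u‖ ^ (2 / k : ℝ) := by
  have h : ‖Complex.exp (-(2 * Real.pi * Complex.I * (j / k)))‖ = 1 := by
    rw [Complex.norm_exp]
    have : (-(2 * Real.pi * Complex.I * ((j : ℂ) / k))) =
      ((-(2 * Real.pi * (j / k)) : ℝ) : ℂ) * Complex.I := by push_cast; ring
    rw [this]; simp
  rw [sectorCoord, norm_mul, h, one_mul, Complex.norm_cpow_real]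
  simp

theorem sectorCoord_eq_zero (hk : 0 < k) : sectorCoord k j u = 0 ↔ u = 0 := by
  rw [← norm_eq_zero, norm_sectorCoord, Real.rpow_eq_zero (norm_nonneg _) (by positivity),
    norm_eq_zero]

theorem exp_pow_natCast_eq_one (hk : 0 < k) :
    Complex.exp (-(2 * Real.pi * Complex.I * (j / k))) ^ k = 1 := by
  rw [← Complex.exp_nat_mul]
  have hk' : (k : ℂ) ≠ 0 := by exact_mod_cast hk.ne'
  have : (k : ℂ) * -(2 * Real.pi * Complex.I * (j / k)) =
      ((-j : ℤ) : ℂ) * (2 * Real.pi * Complex.I) := by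
    push_cast; field_simp
  rw [this, Complex.exp_int_mul_two_pi_mul_I]

/-- The factor `-I` turns the closed upper half plane into the right half plane, away from the cut
of the principal power; it is the source of the minus sign. Since the `k`-th power does not depend
on `j`, points of different sectors can only coincide when their parameters agree up to sign. -/
theorem sectorCoord_pow (hk : 0 < k) : sectorCoord k j u ^ k = -u ^ 2 := by
  have hk' : (k : ℂ) ≠ 0 := by exact_mod_cast hk.ne'
  rw [sectorCoord, mul_pow, exp_pow_natCast_eq_one hk, one_mul, ← Complex.cpow_mul_nat]
  have : (((2 / k : ℝ) : ℝ) : ℂ) * k = (2 : ℕ) := by push_cast; field_simp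
  rw [this, Complex.cpow_natCast, mul_pow, neg_sq, Complex.I_sq]; ring

theorem sectorCoord_eq_mul :
    sectorCoord k j u =
      Complex.exp (2 * Real.pi * Complex.I * ((j' - j) / k)) * sectorCoord k j' u := by
  rw [sectorCoord, sectorCoord, ← mul_assoc, ← Complex.exp_add]
  congr 2; ring

theorem exp_eq_one_iff_dvd (hk : 0 < k) :
    Complex.exp (2 * Real.pi * Complex.I * ((j' - j) / k)) = 1 ↔ (k : ℤ) ∣ j' - j := by
  have hk' : (k : ℂ) ≠ 0 := by exact_mod_cast hk.ne'
  have h2 : (2 * Real.pi * Complex.I : ℂ) ≠ 0 := Complex.two_pi_I_ne_zero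
  rw [Complex.exp_eq_one_iff]
  refine exists_congr fun n => ?_
  rw [mul_comm, mul_left_inj' h2, div_eq_iff hk']
  constructor
  · intro h
    have : ((j' - j : ℤ) : ℂ) = ((n * k : ℤ) : ℂ) := by push_cast; exact h
    rw [Int.cast_inj.1 this]; ring
  · intro h
    have : ((j' - j : ℤ) : ℂ) = ((k * n : ℤ) : ℂ) := by rw [h]
    push_cast at this; rw [this]; ring

theorem sectorCoord_congr (hk : 0 < k) (h : (k : ℤ) ∣ j' - j) :
    sectorCoord k j u = sectorCoord k j' u := by
  rw [sectorCoord_eq_mul (j' := j'), (exp_eq_one_iff_dvd hk).2 h, one_mul]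

/-- Crossing the positive ray. -/
theorem sectorCoord_neg_of_pos (hu : 0 < u.re) :
    sectorCoord k (j + 1) (-u) = sectorCoord k j u := by
  have hu0 : u ≠ 0 := by rintro rfl; simp at hu
  have h1 : -Complex.I * u ≠ 0 := by simp [hu0]
  have h2 : -Complex.I * -u = -(-Complex.I * u) := by ring
  have h3 : Complex.log (-(-Complex.I * u)) = Complex.log (-Complex.I * u) + Real.pi * Complex.I := by
    apply Complex.ext
    · simp [Complex.log_re]
    · have : (-Complex.I * u).im < 0 := by simpa using hu
      rw [Complex.log_im, Complex.arg_neg_eq_arg_add_pi_of_im_neg this]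
      simp [Complex.log_im]
  rw [sectorCoord, sectorCoord, h2, Complex.cpow_def_of_ne_zero (neg_ne_zero.2 h1),
    Complex.cpow_def_of_ne_zero h1, h3, ← Complex.exp_add, ← Complex.exp_add]
  congr 1
  push_cast; ring

/-- Crossing the negative ray. -/
theorem sectorCoord_neg_of_neg (hu : u.re < 0) :
    sectorCoord k (j - 1) (-u) = sectorCoord k j u := by
  have := sectorCoord_neg_of_pos (k := k) (j := j - 1) (u := -u) (by simpa using hu)
  rw [sub_add_cancel, neg_neg] at this
  exact this.symm

/-- The `k` sectors of angle `2π / k` tile the plane and meet only at the origin and along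
consecutive boundary rays. These alternatives are the model for the gluing of half discs in
`IsGood.germ_eq_iff`. -/
theorem sectorCoord_eq_iff (hk : 0 < k) (hu : 0 ≤ u.im) (hu' : 0 ≤ u'.im) :
    sectorCoord k j u = sectorCoord k j' u' ↔ (u = 0 ∧ u' = 0) ∨ (u' = u ∧ (k : ℤ) ∣ j' - j) ∨
      (u' = -u ∧ u.im = 0 ∧ 0 < u.re ∧ (k : ℤ) ∣ j' - (j + 1)) ∨
      (u' = -u ∧ u.im = 0 ∧ u.re < 0 ∧ (k : ℤ) ∣ j' - (j - 1)) := by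
  have key : ∀ (i i' : ℤ) (v : ℂ), v ≠ 0 →
      (sectorCoord k i v = sectorCoord k i' v ↔ (k : ℤ) ∣ i' - i) := by
    intro i i' v hv
    rw [sectorCoord_eq_mul (j' := i'), mul_left_eq_self₀, exp_eq_one_iff_dvd hk]
    simp [sectorCoord_eq_zero hk, hv]
  by_cases h0 : u = 0
  · subst h0
    rw [sectorCoord_zero hk, eq_comm, sectorCoord_eq_zero hk]
    simp +contextual
  constructor
  · intro h
    have hsq : u' ^ 2 = u ^ 2 := by
      have := congrArg (· ^ k) h
      simp only [sectorCoord_pow hk] at this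
      exact (neg_injective this).symm
    rcases sq_eq_sq_iff_eq_or_eq_neg.1 hsq with rfl | rfl
    · exact Or.inr (Or.inl ⟨rfl, (key _ _ _ h0).1 h⟩)
    · have him : u.im = 0 := by simp at hu'; linarith
      have hre : u.re ≠ 0 := fun hre => h0 (Complex.ext hre him)
      rcases lt_or_gt_of_ne hre with hre | hre
      · refine Or.inr (Or.inr (Or.inr ⟨rfl, him, hre, ?_⟩))
        rw [← sectorCoord_neg_of_neg hre] at h
        exact (key _ _ _ (neg_ne_zero.2 h0)).1 h
      · refine Or.inr (Or.inr (Or.inl ⟨rfl, him, hre, ?_⟩))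
        rw [← sectorCoord_neg_of_pos hre] at h
        exact (key _ _ _ (neg_ne_zero.2 h0)).1 h
  · rintro (⟨h, -⟩ | ⟨rfl, h⟩ | ⟨rfl, -, hre, h⟩ | ⟨rfl, -, hre, h⟩)
    · exact absurd h h0
    · exact sectorCoord_congr hk h
    · rw [← sectorCoord_neg_of_pos hre]; exact sectorCoord_congr hk h
    · rw [← sectorCoord_neg_of_neg hre]; exact sectorCoord_congr hk h

/-- Solve `-u ^ 2 = w ^ k`; one of the two roots lies in the closed upper half plane. The remaining
discrepancy is a `k`-th root of unity, which the choice of the sector absorbs. -/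
theorem exists_sectorCoord_eq (hk : 0 < k) (w : ℂ) :
    ∃ j : ℤ, 0 ≤ j ∧ j < k ∧ ∃ u : ℂ, 0 ≤ u.im ∧ sectorCoord k j u = w := by
  have hk0 : (0 : ℤ) < k := by exact_mod_cast hk
  by_cases hw : w = 0
  · exact ⟨0, le_rfl, hk0, 0, by simp, by rw [sectorCoord_zero hk, hw]⟩
  obtain ⟨u, hu, hu2⟩ : ∃ u : ℂ, 0 ≤ u.im ∧ -u ^ 2 = w ^ k := by
    obtain ⟨v, hv⟩ := IsAlgClosed.exists_pow_nat_eq (-w ^ k) (n := 2) two_pos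
    rcases le_total 0 v.im with h | h
    · exact ⟨v, h, by rw [hv, neg_neg]⟩
    · exact ⟨-v, by simpa using h, by rw [neg_sq, hv, neg_neg]⟩
  have hs0 : sectorCoord k 0 u ≠ 0 := by
    rw [Ne, sectorCoord_eq_zero hk]
    rintro rfl
    exact hw (by simpa [hk.ne'] using hu2.symm)
  have hroot : (w / sectorCoord k 0 u) ^ k = 1 := by
    rw [div_pow, sectorCoord_pow hk, hu2, div_self (pow_ne_zero _ hw)]
  have : NeZero k := ⟨hk.ne'⟩
  obtain ⟨m, -, hm⟩ := (Complex.isPrimitiveRoot_exp k hk.ne').eq_pow_of_pow_eq_one hroot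
  refine ⟨(-m : ℤ) % k, Int.emod_nonneg _ hk0.ne', Int.emod_lt_of_pos _ hk0, u, hu, ?_⟩
  have hd : (k : ℤ) ∣ (-m : ℤ) - (-m : ℤ) % k := Int.dvd_self_sub_emod
  rw [sectorCoord_congr hk hd, sectorCoord_eq_mul (j' := 0),
    (div_eq_iff hs0).1 hm.symm, ← Complex.exp_nat_mul]
  congr 2
  push_cast; ring

theorem continuousAt_sectorCoord (hk : 0 < k) (hu : 0 ≤ u.im) :
    ContinuousAt (sectorCoord k j) u := by
  have h : ContinuousAt (fun z : ℂ => z ^ (((2 / k : ℝ) : ℝ) : ℂ)) (-Complex.I * u) := by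
    apply Complex.continuousAt_cpow_const_of_re_pos
    · left; simpa using hu
    · rw [Complex.ofReal_re]; positivity
  exact continuousAt_const.mul (ContinuousAt.comp (f := fun u => -Complex.I * u) h (by fun_prop))

theorem analyticAt_sectorCoord (hu : -Complex.I * u ∈ Complex.slitPlane) :
    AnalyticAt ℂ (sectorCoord k j) u := by
  unfold sectorCoord
  exact analyticAt_const.mul ((analyticAt_const.mul analyticAt_id).cpow analyticAt_const hu)

theorem hasDerivAt_sectorCoord (hu : -Complex.I * u ∈ Complex.slitPlane) :
    HasDerivAt (sectorCoord k j) (2 / k * sectorCoord k j u / u) u := by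
  have hu0 : u ≠ 0 := by rintro rfl; simp at hu
  have h := (((hasDerivAt_id u).const_mul (-Complex.I)).cpow_const
    (c := (((2 / k : ℝ) : ℝ) : ℂ)) hu).const_mul (Complex.exp (-(2 * Real.pi * Complex.I * (j / k))))
  refine HasDerivAt.congr_deriv (f := sectorCoord k j) h ?_
  simp only [sectorCoord, id]
  rw [ Complex.cpow_sub _ _ (by simp [hu0]), Complex.cpow_one]
  push_cast
  field_simp

/-- In the power coordinate `w`, the quadratic differential `du²` is `-(k² / 4) w ^ (k - 2) dw²`. -/
theorem sectorCoord_differential (hk : 0 < k) (hu : u ≠ 0) :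
    -((k : ℂ) ^ 2 / 4) * sectorCoord k j u ^ ((k : ℤ) - 2) *
      (2 / k * sectorCoord k j u / u) ^ 2 = 1 := by
  have hk' : (k : ℂ) ≠ 0 := by exact_mod_cast hk.ne'
  have hs : sectorCoord k j u ≠ 0 := by rwa [Ne, sectorCoord_eq_zero hk]
  have h : sectorCoord k j u ^ ((k : ℤ) - 2) * sectorCoord k j u ^ 2 = -u ^ 2 := by
    rw [← sectorCoord_pow (j := j) (u := u) hk, zpow_sub₀ hs, zpow_natCast]
    field_simp
  calc _ = -((k : ℂ) ^ 2 / 4) * (2 / k) ^ 2 / u ^ 2 *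
        (sectorCoord k j u ^ ((k : ℤ) - 2) * sectorCoord k j u ^ 2) := by ring
    _ = 1 := by rw [h]; field_simp; norm_num

end SectorCoord

/-! ## Gluing the boundary of a flat cylinder -/

/-- A flat cylinder of circumference `width` and height `Im τ`, together with a permutation of its
boundary points. The boundary points `(false, y)` and `(true, y)` are the points `y` and `τ - y` of
the strip `0 ≤ Im z ≤ Im τ`, taken modulo `width`. The permutation sends `b` to the boundary point
whose half disc is glued to the half disc of `b` along the positive ray. -/
structure CylinderGluing where
  width : ℝ
  τ : ℂ
  width_pos : 0 < width
  im_pos : 0 < τ.im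
  perm : Equiv.Perm (Bool × AddCircle width)
  local_gluing : ∀ b, ∃ ε > 0, ∀ t : ℝ, 0 < t → t < ε →
    perm (b.1, b.2 + (t : AddCircle width)) = ((perm b).1, (perm b).2 - (t : AddCircle width)) ∧
    perm ((perm b).1, (perm b).2 - (t : AddCircle width)) = (b.1, b.2 + (t : AddCircle width))
  finite_cycle : ∀ b, {b' | perm.SameCycle b b'}.Finite

namespace CylinderGluing

variable (G : CylinderGluing)

/-- Boundary points of the cylinder. -/
abbrev Boundary : Type := Bool × AddCircle G.width

/-- Translation along the boundary. -/
def shift (b : G.Boundary) (t : ℝ) : G.Boundary := (b.1, b.2 + (t : AddCircle G.width))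

/-- The half-plane coordinate at the bottom (`false`) or at the top (`true`). -/
def flip (s : Bool) (z : ℂ) : ℂ := if s then G.τ - z else z

/-- A complete invariant of the points of the strip under the gluing. -/
noncomputable def key (z : ℂ) :
    (AddCircle G.width × ℝ) ⊕ Quotient (Equiv.Perm.SameCycle.setoid G.perm) :=
  if z.im ≤ 0 then Sum.inr (Quotient.mk _ (false, (z.re : AddCircle G.width)))
  else if G.τ.im ≤ z.im then Sum.inr (Quotient.mk _ (true, ((G.τ - z).re : AddCircle G.width)))
  else Sum.inl ((z.re : AddCircle G.width), z.im)

/-- The glued surface. -/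
def Surface : Type := Quotient (Setoid.ker G.key)

instance : TopologicalSpace G.Surface := inferInstanceAs (TopologicalSpace (Quotient _))

/-- The projection of the plane onto the surface, constant on vertical rays outside the strip. -/
noncomputable def proj (z : ℂ) : G.Surface := Quotient.mk (Setoid.ker G.key) z

theorem proj_eq_iff {z w : ℂ} : G.proj z = G.proj w ↔ G.key z = G.key w :=
  Quotient.eq (r := Setoid.ker G.key)

theorem isQuotientMap_proj : Topology.IsQuotientMap G.proj := isQuotientMap_quotient_mk'

theorem continuous_proj : Continuous G.proj := G.isQuotientMap_proj.continuous

theorem surjective_proj : Function.Surjective G.proj := G.isQuotientMap_proj.surjective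

/-- The vertical projection of the plane onto the strip. -/
noncomputable def clamp (z : ℂ) : ℂ := ⟨z.re, max 0 (min z.im G.τ.im)⟩

theorem continuous_clamp : Continuous G.clamp := by
  have : G.clamp = fun z => ((z.re : ℝ) : ℂ) + ((max 0 (min z.im G.τ.im) : ℝ) : ℂ) * Complex.I := by
    ext z
    exact Complex.mk_eq_add_mul_I _ _
  rw [this]
  fun_prop

theorem im_clamp_mem (z : ℂ) : 0 ≤ (G.clamp z).im ∧ (G.clamp z).im ≤ G.τ.im :=
  ⟨le_max_left _ _, max_le G.im_pos.le (min_le_right _ _)⟩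

theorem proj_clamp (z : ℂ) : G.proj (G.clamp z) = G.proj z := by
  rw [proj_eq_iff]
  have h := G.im_pos
  rcases le_or_gt z.im 0 with h0 | h0
  · have h1 : (G.clamp z).im = 0 := max_eq_left ((min_le_left _ _).trans h0)
    simp only [key, h1, h0, le_refl, if_true]; rfl
  rcases le_or_gt G.τ.im z.im with h2 | h2
  · have h1 : (G.clamp z).im = G.τ.im := by
      simp only [clamp]; rw [min_eq_right h2, max_eq_right h.le]
    simp only [key, h1, h0.not_ge, h.not_ge, h2, le_refl, if_true, if_false, Complex.sub_re]; rfl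
  · have h1 : (G.clamp z).im = z.im := by
      simp only [clamp]; rw [min_eq_left h2.le, max_eq_right h0.le]
    simp only [key, h1, h0.not_ge, h2.not_ge, if_false]; rfl

/-! ### Half planes attached at boundary points -/

section Basic

variable {G}

theorem flip_flip (s : Bool) (z : ℂ) : G.flip s (G.flip s z) = z := by
  cases s <;> simp [flip]

theorem continuous_flip (s : Bool) : Continuous (G.flip s) := by
  cases s
  · exact continuous_id
  · exact continuous_const.sub continuous_id

@[simp] theorem shift_zero (b : G.Boundary) : G.shift b 0 = b := by simp [shift]

theorem shift_shift (b : G.Boundary) (t t' : ℝ) :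
    G.shift (G.shift b t) t' = G.shift b (t + t') := by
  simp [shift, add_assoc]

theorem shift_coe (s : Bool) (y t : ℝ) :
    G.shift (s, (y : AddCircle G.width)) t = (s, ((y + t : ℝ) : AddCircle G.width)) := rfl

theorem key_flip_of_im_eq_zero (s : Bool) {z : ℂ} (hz : z.im = 0) :
    G.key (G.flip s z) = Sum.inr (Quotient.mk _ (s, (z.re : AddCircle G.width))) := by
  have h := G.im_pos
  cases s
  · simp [flip, key, hz]
  · simp [flip, key, hz, h.not_ge]

theorem key_flip_of_im_pos (s : Bool) {z : ℂ} (hz : 0 < z.im) (hz' : z.im < G.τ.im) :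
    G.key (G.flip s z) = Sum.inl (((G.flip s z).re : AddCircle G.width), (G.flip s z).im) := by
  have h := G.im_pos
  cases s
  · simp [flip, key, hz.not_ge, hz'.not_ge]
  · simp [flip, key, hz.not_ge, hz'.not_ge]

theorem proj_flip_real (s : Bool) (y y' : ℝ) (s' : Bool) :
    G.proj (G.flip s y) = G.proj (G.flip s' y') ↔
      G.perm.SameCycle (s, (y : AddCircle G.width)) (s', (y' : AddCircle G.width)) := by
  rw [proj_eq_iff, key_flip_of_im_eq_zero _ (Complex.ofReal_im _),
    key_flip_of_im_eq_zero _ (Complex.ofReal_im _), Sum.inr.injEq, Quotient.eq]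
  rfl

theorem proj_eq_of_re {z w : ℂ} (him : z.im = w.im)
    (hre : (z.re : AddCircle G.width) = (w.re : AddCircle G.width)) : G.proj z = G.proj w := by
  have h2 : ((G.τ.re - z.re : ℝ) : AddCircle G.width) = ((G.τ.re - w.re : ℝ) : AddCircle G.width) := by
    rw [AddCircle.coe_sub, AddCircle.coe_sub, hre]
  rw [proj_eq_iff]
  simp only [key, him, hre, Complex.sub_re, h2]

theorem proj_flip_eq_of_re (s : Bool) {z w : ℂ} (him : z.im = w.im)
    (hre : (z.re : AddCircle G.width) = (w.re : AddCircle G.width)) :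
    G.proj (G.flip s z) = G.proj (G.flip s w) := by
  cases s
  · exact proj_eq_of_re him hre
  · apply proj_eq_of_re
    · simp [flip, him]
    · simp only [flip, if_true, Complex.sub_re]
      rw [AddCircle.coe_sub, AddCircle.coe_sub, hre]

theorem proj_add_width (z : ℂ) : G.proj (z + G.width) = G.proj z := by
  apply proj_eq_of_re <;> simp

variable (G) in
/-- A real representative of a point of the circle. -/
noncomputable def lift (x : AddCircle G.width) : ℝ := Quotient.out x

theorem coe_lift (x : AddCircle G.width) : ((G.lift x : ℝ) : AddCircle G.width) = x :=
  QuotientAddGroup.out_eq' x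

variable (G) in
/-- The half plane glued in at a boundary point. -/
noncomputable def germ (b : G.Boundary) (u : ℂ) : G.Surface := G.proj (G.flip b.1 (G.lift b.2 + u))

theorem continuous_germ (b : G.Boundary) : Continuous (G.germ b) :=
  G.continuous_proj.comp ((continuous_flip _).comp (by fun_prop))

theorem germ_coe (s : Bool) (y : ℝ) (u : ℂ) :
    G.germ (s, (y : AddCircle G.width)) u = G.proj (G.flip s (y + u)) := by
  apply proj_flip_eq_of_re
  · simp
  · simp [coe_lift]

theorem germ_shift (b : G.Boundary) (t : ℝ) (u : ℂ) :
    G.germ (G.shift b t) u = G.germ b (t + u) := by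
  obtain ⟨s, x⟩ := b
  rw [← coe_lift x, shift_coe, germ_coe, germ_coe]
  push_cast; rw [add_assoc]

theorem germ_ofReal_eq (b b' : G.Boundary) (t t' : ℝ) :
    G.germ b t = G.germ b' t' ↔ G.perm.SameCycle (G.shift b t) (G.shift b' t') := by
  obtain ⟨s, x⟩ := b
  obtain ⟨s', x'⟩ := b'
  rw [← coe_lift x, ← coe_lift x', germ_coe, germ_coe, shift_coe, shift_coe, ← proj_flip_real]
  push_cast; rfl

/-- The bound on the heights prevents a half plane at the bottom and one at the top from meeting
inside the strip. Off the boundary two half planes therefore overlap only by a shift along the same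
circle, and all other coincidences come from `perm`. -/
theorem germ_eq_iff {b b' : G.Boundary} {u u' : ℂ} (hu : 0 ≤ u.im) (hu' : 0 ≤ u'.im)
    (huu : u.im + u'.im < G.τ.im) :
    G.germ b u = G.germ b' u' ↔
      (0 < u.im ∧ u.im = u'.im ∧ G.shift b u.re = G.shift b' u'.re) ∨
      (u.im = 0 ∧ u'.im = 0 ∧ G.perm.SameCycle (G.shift b u.re) (G.shift b' u'.re)) := by
  obtain ⟨s, x⟩ := b
  obtain ⟨s', x'⟩ := b'
  rw [← coe_lift x, ← coe_lift x', germ_coe, germ_coe, shift_coe, shift_coe]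
  set y := G.lift x
  set y' := G.lift x'
  rcases hu.eq_or_lt with h0 | h0 <;> rcases hu'.eq_or_lt with h0' | h0'
  · rw [proj_eq_iff, key_flip_of_im_eq_zero _ (by simp [← h0]),
      key_flip_of_im_eq_zero _ (by simp [← h0']), Sum.inr.injEq, Quotient.eq]
    simp only [← h0, ← h0', lt_irrefl, false_and, true_and, false_or]
    simp only [Complex.add_re, Complex.ofReal_re]; rfl
  · rw [proj_eq_iff, key_flip_of_im_eq_zero _ (by simp [← h0]),
      key_flip_of_im_pos _ (by simpa using h0') (by simp; linarith)]
    simp [← h0, h0'.ne']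
  · rw [proj_eq_iff, key_flip_of_im_eq_zero s' (by simp [← h0']),
      key_flip_of_im_pos _ (by simpa using h0) (by simp; linarith)]
    simp [← h0', h0.ne']
  · rw [proj_eq_iff, key_flip_of_im_pos _ (by simpa using h0) (by simp; linarith),
      key_flip_of_im_pos _ (by simpa using h0') (by simp; linarith), Sum.inl.injEq, Prod.mk.injEq]
    simp only [h0, h0.ne', false_and, or_false, true_and]
    cases s <;> cases s' <;> simp only [flip, if_true, Complex.sub_re,
      Complex.sub_im, Complex.add_im, Complex.add_re, Complex.ofReal_im, Complex.ofReal_re,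
      Prod.mk.injEq, zero_add, and_comm, Bool.false_eq_true, if_false, true_and, false_and,
      iff_false, not_and, reduceCtorEq, AddCircle.coe_sub, sub_right_inj]
    · intro h; linarith
    · intro h; linarith

end Basic

end CylinderGluing

/-! ### Small half discs and their overlaps -/

namespace CylinderGluing

variable {G : CylinderGluing}

/-- The half discs of radius `ρ` around the points of a `perm`-invariant set `A` of boundary points
are disjoint, and are glued only to each other. -/
structure IsGood (A : Set G.Boundary) (ρ : ℝ) : Prop where
  pos : 0 < ρ
  two_mul_lt : 2 * ρ < G.τ.im
  perm_mem : ∀ b, G.perm b ∈ A ↔ b ∈ A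
  perm_shift : ∀ b ∈ A, ∀ t, 0 < t → t < ρ → G.perm (G.shift b t) = G.shift (G.perm b) (-t)
  perm_shift_neg : ∀ b ∈ A, ∀ t, 0 < t → t < ρ → G.perm (G.shift (G.perm b) (-t)) = G.shift b t
  shift_inj : ∀ b ∈ A, ∀ b' ∈ A, ∀ t t' : ℝ, |t| < ρ → |t'| < ρ → G.shift b t = G.shift b' t' →
    b = b' ∧ t = t'

theorem coe_eq_zero_of_abs_lt {t : ℝ} (h : |t| < G.width) (h0 : (t : AddCircle G.width) = 0) :
    t = 0 := by
  obtain ⟨n, hn⟩ := (AddCircle.coe_eq_zero_iff G.width).1 h0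
  rw [zsmul_eq_mul] at hn
  have hw := G.width_pos
  rw [← hn, abs_mul, abs_of_pos hw] at h
  have h1 : |(n : ℝ)| < 1 := by
    by_contra hc
    push Not at hc
    nlinarith
  have h2 : n = 0 := by
    rw [← Int.abs_lt_one_iff]; exact_mod_cast h1
  rw [← hn, h2]; simp

/-- Since `A` is finite, only finitely many requirements are made, and each of them holds for all
sufficiently small radii. -/
theorem exists_isGood {A : Set G.Boundary} (hA : A.Finite) (hperm : ∀ b, G.perm b ∈ A ↔ b ∈ A) :
    ∃ ρ, IsGood A ρ := by
  -- The bound by the width keeps a half disc from wrapping around the circle and meeting itself.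
  have ev : ∀ᶠ ρ in 𝓝[>] (0 : ℝ), 0 < ρ ∧ 2 * ρ < G.τ.im ∧ 2 * ρ < G.width := by
    have h1 := G.im_pos
    have h2 := G.width_pos
    filter_upwards [Ioo_mem_nhdsGT (show (0 : ℝ) < min (G.τ.im / 2) (G.width / 2) by positivity)]
      with ρ hρ
    have := lt_min_iff.1 hρ.2
    exact ⟨hρ.1, by linarith, by linarith⟩
  have ev1 : ∀ᶠ ρ in 𝓝[>] (0 : ℝ), ∀ b ∈ A, ∀ t, 0 < t → t < ρ →
      G.perm (G.shift b t) = G.shift (G.perm b) (-t) ∧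
      G.perm (G.shift (G.perm b) (-t)) = G.shift b t := by
    rw [Filter.eventually_all_finite hA]
    intro b _
    obtain ⟨ε, hε, h⟩ := G.local_gluing b
    filter_upwards [Ioo_mem_nhdsGT hε] with ρ hρ t ht ht'
    have := h t ht (ht'.trans hρ.2)
    simpa [shift, sub_eq_add_neg] using this
  have ev2 : ∀ᶠ ρ in 𝓝[>] (0 : ℝ), ∀ b ∈ A, ∀ b' ∈ A, b ≠ b' → ∀ t t' : ℝ, |t| < ρ → |t'| < ρ →
      G.shift b t ≠ G.shift b' t' := by
    rw [Filter.eventually_all_finite hA]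
    intro b _
    rw [Filter.eventually_all_finite hA]
    intro b' _
    by_cases hs : b.1 = b'.1
    · by_cases hb : b = b'
      · exact Filter.Eventually.of_forall fun _ h => absurd hb h
      have hx : 0 < ‖b.2 - b'.2‖ := by
        rw [norm_pos_iff, sub_ne_zero]
        exact fun h => hb (Prod.ext hs h)
      filter_upwards [Ioo_mem_nhdsGT (half_pos hx)] with ρ hρ _ t t' ht ht' h
      have h1 : b.2 - b'.2 = ((t' - t : ℝ) : AddCircle G.width) := by
        have := congrArg Prod.snd h
        simp only [shift] at this
        rw [AddCircle.coe_sub, sub_eq_sub_iff_add_eq_add, this, add_comm]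
      have h2 : ‖b.2 - b'.2‖ ≤ |t' - t| := by
        rw [h1]
        exact QuotientAddGroup.norm_mk_le_norm
      have h3 := abs_sub t' t
      have := hρ.2
      linarith
    · exact Filter.Eventually.of_forall fun _ _ t t' _ _ h => by
        have h1 := congrArg Prod.fst h
        exact hs h1
  obtain ⟨ρ, ⟨h1, h2, h3⟩, h4, h5⟩ := (ev.and (ev1.and ev2)).exists
  refine ⟨ρ, h1, h2, hperm, fun b hb t ht ht' => (h4 b hb t ht ht').1,
    fun b hb t ht ht' => (h4 b hb t ht ht').2, fun b hb b' hb' t t' ht ht' h => ?_⟩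
  by_cases hbb : b = b'
  · refine ⟨hbb, ?_⟩
    subst hbb
    have h6 : ((t - t' : ℝ) : AddCircle G.width) = 0 := by
      have := congrArg Prod.snd h
      simp only [shift, add_right_inj] at this
      rw [AddCircle.coe_sub, this, sub_self]
    have h7 := coe_eq_zero_of_abs_lt (by have := abs_sub t t'; linarith) h6
    linarith
  · exact absurd h (h5 b hb b' hb' hbb t t' ht ht')

/-- Used for boundary points near, but not at, a given one: there the gluing merely exchanges two
points. -/
theorem eq_or_eq_of_sameCycle {α : Type*} {σ : Equiv.Perm α} {x y z : α} (hx : σ x = y)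
    (hy : σ y = x) (h : σ.SameCycle x z) : z = x ∨ z = y := by
  obtain ⟨n, rfl⟩ := h
  have hx' : σ⁻¹ x = y := by rw [Equiv.Perm.inv_eq_iff_eq, hy]
  have hy' : σ⁻¹ y = x := by rw [Equiv.Perm.inv_eq_iff_eq, hx]
  induction n using Int.induction_on with
  | zero => simp
  | succ n ih =>
    rw [add_comm, zpow_add, zpow_one, Equiv.Perm.mul_apply]
    rcases ih with ih | ih <;> rw [ih] <;> simp [hx, hy]
  | pred n ih =>
    rw [sub_eq_neg_add, zpow_add, zpow_neg_one, Equiv.Perm.mul_apply]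
    rcases ih with ih | ih <;> rw [ih] <;> simp [hx', hy']

namespace IsGood

variable {A : Set G.Boundary} {ρ : ℝ} (h : IsGood A ρ)
include h

theorem inv_mem {b : G.Boundary} (hb : b ∈ A) : G.perm⁻¹ b ∈ A := by
  rw [← h.perm_mem]; simpa using hb

theorem mono_set {B : Set G.Boundary} (hB : B ⊆ A) (hperm : ∀ b, G.perm b ∈ B ↔ b ∈ B) :
    IsGood B ρ where
  pos := h.pos
  two_mul_lt := h.two_mul_lt
  perm_mem := hperm
  perm_shift b hb := h.perm_shift b (hB hb)
  perm_shift_neg b hb := h.perm_shift_neg b (hB hb)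
  shift_inj b hb b' hb' := h.shift_inj b (hB hb) b' (hB hb')

theorem sameCycle_mem {b b' : G.Boundary} (hb : b ∈ A) (hbb : G.perm.SameCycle b b') : b' ∈ A := by
  obtain ⟨n, rfl⟩ := hbb
  induction n using Int.induction_on with
  | zero => simpa
  | succ n ih => rwa [add_comm, zpow_add, zpow_one, Equiv.Perm.mul_apply, h.perm_mem]
  | pred n ih =>
    rw [sub_eq_neg_add, zpow_add, zpow_neg_one, Equiv.Perm.mul_apply]
    exact h.inv_mem ih

theorem sameCycle_shift_of_pos {b c : G.Boundary} (hb : b ∈ A) {t : ℝ} (ht : 0 < t) (htρ : t < ρ)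
    (hc : G.perm.SameCycle (G.shift b t) c) : c = G.shift b t ∨ c = G.shift (G.perm b) (-t) :=
  eq_or_eq_of_sameCycle (h.perm_shift b hb t ht htρ) (h.perm_shift_neg b hb t ht htρ) hc

theorem sameCycle_shift_of_neg {b c : G.Boundary} (hb : b ∈ A) {t : ℝ} (ht : t < 0) (htρ : -t < ρ)
    (hc : G.perm.SameCycle (G.shift b t) c) : c = G.shift b t ∨ c = G.shift (G.perm⁻¹ b) (-t) := by
  have h1 := h.perm_shift _ (h.inv_mem hb) (-t) (by linarith) htρ
  have h2 := h.perm_shift_neg _ (h.inv_mem hb) (-t) (by linarith) htρ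
  simp only [Equiv.Perm.coe_inv, Equiv.apply_symm_apply, neg_neg] at h1 h2
  exact eq_or_eq_of_sameCycle h2 h1 hc

theorem perm_shift_of_neg {b : G.Boundary} (hb : b ∈ A) {t : ℝ} (ht : t < 0) (htρ : -t < ρ) :
    G.perm (G.shift b t) = G.shift (G.perm⁻¹ b) (-t) := by
  have h2 := h.perm_shift_neg _ (h.inv_mem hb) (-t) (by linarith) htρ
  simpa using h2

theorem exists_of_sameCycle_shift {b c : G.Boundary} (hb : b ∈ A) {t : ℝ} (ht : |t| < ρ)
    (hc : G.perm.SameCycle (G.shift b t) c) : ∃ b' ∈ A, ∃ t' : ℝ, |t'| = |t| ∧ c = G.shift b' t' := by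
  rcases lt_trichotomy t 0 with h0 | rfl | h0
  · rcases h.sameCycle_shift_of_neg hb h0 (by rwa [abs_of_neg h0] at ht) hc with hc | hc
    · exact ⟨b, hb, t, rfl, hc⟩
    · exact ⟨_, h.inv_mem hb, -t, abs_neg t, hc⟩
  · rw [shift_zero] at hc
    exact ⟨c, h.sameCycle_mem hb hc, 0, rfl, by simp⟩
  · rcases h.sameCycle_shift_of_pos hb h0 (by rwa [abs_of_pos h0] at ht) hc with hc | hc
    · exact ⟨b, hb, t, rfl, hc⟩
    · exact ⟨_, (h.perm_mem b).2 hb, -t, abs_neg t, hc⟩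

/-- Within a good radius the positive ray of `b` is glued to the negative ray of `perm b`, and
nothing else is identified except the centres of a cycle. This is the same list of alternatives as
in `sectorCoord_eq_iff`. -/
theorem germ_eq_iff {b b' : G.Boundary} (hb : b ∈ A) (hb' : b' ∈ A) {u u' : ℂ} (hu : 0 ≤ u.im)
    (hu' : 0 ≤ u'.im) (huρ : ‖u‖ < ρ) (huρ' : ‖u'‖ < ρ) :
    G.germ b u = G.germ b' u' ↔ (u = 0 ∧ u' = 0 ∧ G.perm.SameCycle b b') ∨ (u' = u ∧ b' = b) ∨
      (u' = -u ∧ u.im = 0 ∧ 0 < u.re ∧ b' = G.perm b) ∨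
      (u' = -u ∧ u.im = 0 ∧ u.re < 0 ∧ b' = G.perm⁻¹ b) := by
  have hre := (Complex.abs_re_le_norm u).trans_lt huρ
  have hre' := (Complex.abs_re_le_norm u').trans_lt huρ'
  have him := (Complex.abs_im_le_norm u).trans_lt huρ
  have him' := (Complex.abs_im_le_norm u').trans_lt huρ'
  have h2 := h.two_mul_lt
  have h3 := h.pos
  rw [CylinderGluing.germ_eq_iff hu hu' (by rw [abs_of_nonneg hu] at him; rw [abs_of_nonneg hu'] at him'; linarith)]
  constructor
  · rintro (⟨-, h4, h5⟩ | ⟨h4, h5, h6⟩)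
    · obtain ⟨h6, h7⟩ := h.shift_inj b hb b' hb' _ _ hre hre' h5
      exact Or.inr (Or.inl ⟨Complex.ext h7.symm h4.symm, h6.symm⟩)
    · rcases lt_trichotomy u.re 0 with h0 | h0 | h0
      · rcases h.sameCycle_shift_of_neg hb h0 (by rwa [abs_of_neg h0] at hre) h6 with hc | hc
        · obtain ⟨h8, h9⟩ := h.shift_inj b' hb' b hb _ _ hre' hre hc
          exact Or.inr (Or.inl ⟨Complex.ext h9 (by rw [h4, h5]), h8⟩)
        · obtain ⟨h8, h9⟩ := h.shift_inj b' hb' _ (h.inv_mem hb) _ _ hre' (by rwa [abs_neg]) hc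
          exact Or.inr (Or.inr (Or.inr ⟨Complex.ext (by simpa using h9) (by simp [h4, h5]), h4, h0, h8⟩))
      · have hu0 : u = 0 := Complex.ext h0 h4
        obtain ⟨b'', hb'', t', ht', hc⟩ := h.exists_of_sameCycle_shift hb hre h6
        rw [h0, abs_zero, abs_eq_zero] at ht'
        subst ht'
        obtain ⟨h8, h9⟩ := h.shift_inj b' hb' _ hb'' _ _ hre' (by simpa) hc
        have hu0' : u' = 0 := Complex.ext h9 h5
        refine Or.inl ⟨hu0, hu0', ?_⟩
        rwa [h0, h9, shift_zero, shift_zero] at h6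
      · rcases h.sameCycle_shift_of_pos hb h0 (by rwa [abs_of_pos h0] at hre) h6 with hc | hc
        · obtain ⟨h8, h9⟩ := h.shift_inj b' hb' b hb _ _ hre' hre hc
          exact Or.inr (Or.inl ⟨Complex.ext h9 (by rw [h4, h5]), h8⟩)
        · obtain ⟨h8, h9⟩ := h.shift_inj b' hb' _ ((h.perm_mem b).2 hb) _ _ hre' (by rwa [abs_neg]) hc
          exact Or.inr (Or.inr (Or.inl ⟨Complex.ext (by simpa using h9) (by simp [h4, h5]), h4, h0, h8⟩))
  · rintro (⟨rfl, rfl, h4⟩ | ⟨rfl, rfl⟩ | ⟨rfl, h4, h5, rfl⟩ | ⟨rfl, h4, h5, rfl⟩)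
    · right; simpa using h4
    · rcases hu.eq_or_lt with h0 | h0
      · exact Or.inr ⟨h0.symm, h0.symm, Equiv.Perm.SameCycle.refl _ _⟩
      · exact Or.inl ⟨h0, rfl, rfl⟩
    · refine Or.inr ⟨h4, by simp [h4], ?_⟩
      rw [Complex.neg_re, ← h.perm_shift b hb _ h5 (by rwa [abs_of_pos h5] at hre),
        Equiv.Perm.sameCycle_apply_right]
    · refine Or.inr ⟨h4, by simp [h4], ?_⟩
      rw [Complex.neg_re, ← h.perm_shift_of_neg hb h5 (by rwa [abs_of_neg h5] at hre),
        Equiv.Perm.sameCycle_apply_right]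

/-- Invariance of `A` under `perm` makes the union of the half discs saturated: a boundary point
glued to a point at distance less than `ρ` from `A` is itself at that distance from `A`. -/
theorem isOpen_germs : IsOpen {x | ∃ b ∈ A, ∃ u : ℂ, 0 ≤ u.im ∧ ‖u‖ < ρ ∧ G.germ b u = x} := by
  have h3 := h.pos
  have h4 := h.two_mul_lt
  rw [← G.isQuotientMap_proj.isOpen_preimage]
  -- After clamping to the strip, the half discs are the traces of full discs of the plane, so the
  -- preimage is cut out by an open condition.
  have hV : IsOpen (⋃ (s : Bool) (y : ℝ) (_ : (s, (y : AddCircle G.width)) ∈ A),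
      {z : ℂ | ‖G.flip s z - y‖ < ρ}) := by
    refine isOpen_iUnion fun s => isOpen_iUnion fun y => isOpen_iUnion fun _ => ?_
    exact isOpen_lt (((continuous_flip s).sub continuous_const).norm) continuous_const
  convert hV.preimage G.continuous_clamp using 1
  ext z
  simp only [Set.mem_preimage, Set.mem_ofPred_eq, Set.mem_iUnion, exists_prop]
  rw [← G.proj_clamp z]
  obtain ⟨hz0, hz1⟩ := G.im_clamp_mem z
  set z' := G.clamp z
  constructor
  · rintro ⟨b, hb, u, hu, huρ, hz⟩
    have hre := (Complex.abs_re_le_norm u).trans_lt huρ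
    have him := (Complex.abs_im_le_norm u).trans_lt huρ
    rw [abs_of_nonneg hu] at him
    rcases hu.eq_or_lt with h0 | h0
    · have hu' : u = (u.re : ℂ) := Complex.ext rfl h0.symm
      obtain ⟨s, x, hx⟩ : ∃ (s : Bool) (x : ℝ), G.proj z' = G.germ (s, (x : AddCircle G.width)) (0 : ℝ) ∧
          z' = G.flip s x := by
        have hz2 : G.key z' = G.key (G.flip b.1 (G.lift b.2 + u)) := (proj_eq_iff G).1 hz.symm
        rw [key_flip_of_im_eq_zero _ (by simp [← h0])] at hz2
        have : z'.im = 0 ∨ z'.im = G.τ.im := by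
          by_contra hc
          push Not at hc
          have h5 : 0 < z'.im := lt_of_le_of_ne hz0 (Ne.symm hc.1)
          have h6 : z'.im < G.τ.im := lt_of_le_of_ne hz1 hc.2
          simp [key, h5.not_ge, h6.not_ge] at hz2
        rcases this with h5 | h5
        · refine ⟨false, z'.re, ?_⟩
          have : z' = G.flip false (z'.re : ℝ) := Complex.ext rfl h5
          exact ⟨by rw [germ_coe, Complex.ofReal_zero, add_zero, ← this], this⟩
        · refine ⟨true, G.τ.re - z'.re, ?_⟩
          have : z' = G.flip true ((G.τ.re - z'.re : ℝ) : ℂ) :=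
            Complex.ext (by simp [flip]) (by simp [flip, h5])
          exact ⟨by rw [germ_coe, Complex.ofReal_zero, add_zero, ← this], this⟩
      rw [hx.1, hu', germ_ofReal_eq, shift_zero] at hz
      obtain ⟨b', hb', t', ht', hc⟩ := h.exists_of_sameCycle_shift hb hre hz
      refine ⟨s, x - t', ?_, ?_⟩
      · have : ((s, ((x - t' : ℝ) : AddCircle G.width)) : G.Boundary) = b' := by
          rw [sub_eq_add_neg, ← shift_coe, hc, shift_shift]; simp
        rwa [this]
      · rw [hx.2, flip_flip]
        push_cast
        rw [sub_sub_cancel, Complex.norm_real, Real.norm_eq_abs, ht']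
        exact hre
    · have hz2 : G.key z' = G.key (G.flip b.1 (G.lift b.2 + u)) := (proj_eq_iff G).1 hz.symm
      have hv0 : 0 < (G.lift b.2 + u : ℂ).im := by simpa using h0
      have hv1 : (G.lift b.2 + u : ℂ).im < G.τ.im := by simp; linarith
      rw [key_flip_of_im_pos _ hv0 hv1] at hz2
      have h5 : 0 < z'.im := by
        by_contra hc
        push Not at hc
        simp [key, hc] at hz2
      have h6 : z'.im < G.τ.im := by
        by_contra hc
        push Not at hc
        simp [key, hc, h5.not_ge] at hz2
      simp only [key, h5.not_ge, h6.not_ge, if_false, Sum.inl.injEq, Prod.mk.injEq] at hz2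
      obtain ⟨hr, hi⟩ := hz2
      have hw : ∀ s, ∀ v : ℂ, (z'.re : AddCircle G.width) = ((G.flip s v).re : AddCircle G.width) →
          z'.im = (G.flip s v).im → ((G.flip s z').re : AddCircle G.width) = (v.re : AddCircle G.width) ∧
          (G.flip s z').im = v.im := by
        intro s v hr hi
        cases s
        · exact ⟨hr, hi⟩
        · simp only [flip, if_true, Complex.sub_re, Complex.sub_im, AddCircle.coe_sub] at hr hi ⊢
          rw [hr, hi]; simp
      obtain ⟨hr, hi⟩ := hw _ _ hr hi
      refine ⟨b.1, (G.flip b.1 z').re - u.re, ?_, ?_⟩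
      · have : ((b.1, (((G.flip b.1 z').re - u.re : ℝ) : AddCircle G.width)) : G.Boundary) = b := by
          rw [AddCircle.coe_sub, hr]
          refine Prod.ext rfl ?_
          simp [coe_lift]
        rwa [this]
      · have : G.flip b.1 z' - (((G.flip b.1 z').re - u.re : ℝ) : ℂ) = u := by
          apply Complex.ext
          · simp
          · simp [hi]
        rwa [this]
  · rintro ⟨s, y, hb, hz⟩
    rcases le_or_gt 0 (G.flip s z').im with h0 | h0
    · refine ⟨_, hb, G.flip s z' - y, by simpa using h0, hz, ?_⟩
      rw [germ_coe, add_sub_cancel, flip_flip]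
    · exfalso
      cases s
      · exact absurd hz0 (not_le.2 h0)
      · simp [flip] at h0; linarith

end IsGood

end CylinderGluing

/-- A continuous injective map of a closed disc into a Hausdorff space whose restriction to the open
disc has open image is the inverse of a chart. -/
theorem exists_openPartialHomeomorph_of_disc {S : Type*} [TopologicalSpace S] [T2Space S] {R : ℝ}
    {φ : ℂ → S} (hc : ContinuousOn φ (Metric.closedBall 0 R))
    (hi : Set.InjOn φ (Metric.closedBall 0 R)) (ho : IsOpen (φ '' Metric.ball 0 R)) :
    ∃ c : OpenPartialHomeomorph S ℂ, c.source = φ '' Metric.ball 0 R ∧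
      ∀ w ∈ Metric.ball (0 : ℂ) R, c (φ w) = w := by
  have hib : Set.InjOn φ (Metric.ball 0 R) := hi.mono Metric.ball_subset_closedBall
  -- The closed disc is compact and the target Hausdorff, so injectivity and continuity already give
  -- an embedding.
  have hemb : Topology.IsClosedEmbedding ((Metric.closedBall (0 : ℂ) R).domRestrict φ) :=
    have : CompactSpace (Metric.closedBall (0 : ℂ) R) :=
      isCompact_iff_compactSpace.1 (isCompact_closedBall 0 R)
    (continuousOn_iff_continuous_domRestrict.1 hc).isClosedEmbedding (Set.injOn_iff_injective.1 hi)
  let e := (hib.bijOn_image).toPartialEquiv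
  have hsrc : e.source = Metric.ball 0 R := rfl
  have htgt : e.target = φ '' Metric.ball 0 R := rfl
  have hg : ContinuousOn e.symm (φ '' Metric.ball 0 R) := by
    rw [continuousOn_iff_continuous_domRestrict]
    have hmem : ∀ x : φ '' Metric.ball (0 : ℂ) R, e.symm x ∈ Metric.closedBall (0 : ℂ) R := fun x =>
      Metric.ball_subset_closedBall (hsrc.le (e.map_target (htgt.ge x.2)))
    have : Continuous fun x : φ '' Metric.ball (0 : ℂ) R =>
        (⟨e.symm x, hmem x⟩ : Metric.closedBall (0 : ℂ) R) := by
      rw [hemb.isEmbedding.continuous_iff]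
      have hval : (Metric.closedBall (0 : ℂ) R).domRestrict φ ∘
          (fun x : φ '' Metric.ball (0 : ℂ) R =>
            (⟨e.symm x, hmem x⟩ : Metric.closedBall (0 : ℂ) R)) = Subtype.val :=
        funext fun x => e.right_inv (htgt.ge x.2)
      rw [hval]
      exact continuous_subtype_val
    exact continuous_subtype_val.comp this
  refine ⟨{ e.symm with
    open_source := ho
    open_target := Metric.isOpen_ball
    continuousOn_toFun := hg
    continuousOn_invFun := hc.mono Metric.ball_subset_closedBall }, rfl, fun w hw => ?_⟩
  exact e.left_inv hw

/-! ### Hausdorff property and construction of the charts -/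

namespace CylinderGluing

variable {G : CylinderGluing}

theorem proj_eq_iff_of_interior {z w : ℂ} (hz : 0 < z.im) (hz' : z.im < G.τ.im) :
    G.proj w = G.proj z ↔
      w.im = z.im ∧ (w.re : AddCircle G.width) = (z.re : AddCircle G.width) := by
  constructor
  · intro h
    rw [proj_eq_iff] at h
    have hw : 0 < w.im := by
      by_contra hc
      push Not at hc
      simp [key, hc, hz.not_ge, hz'.not_ge] at h
    have hw' : w.im < G.τ.im := by
      by_contra hc
      push Not at hc
      simp [key, hc, hw.not_ge, hz.not_ge, hz'.not_ge] at h
    simp only [key, hw.not_ge, hw'.not_ge, hz.not_ge, hz'.not_ge, if_false, Sum.inl.injEq,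
      Prod.mk.injEq] at h
    exact ⟨h.2, h.1⟩
  · rintro ⟨h1, h2⟩
    exact proj_eq_of_re h1 h2

section T2

variable (G)

/-- A function on the plane that descends to the surface, vanishes on the boundary of the strip and
separates interior points. -/
noncomputable def separator (z : ℂ) : ℝ × ℝ × ℂ :=
  let y := (G.clamp z).im
  (y * (G.τ.im - y), y * (G.τ.im - y) * y,
    ((y * (G.τ.im - y) : ℝ) : ℂ) * (AddCircle.toCircle (z.re : AddCircle G.width) : ℂ))

theorem continuous_separator : Continuous G.separator := by
  have h1 : Continuous fun z => (G.clamp z).im := Complex.continuous_im.comp G.continuous_clamp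
  have h2 : Continuous fun z : ℂ => (AddCircle.toCircle (z.re : AddCircle G.width) : ℂ) :=
    continuous_subtype_val.comp (AddCircle.continuous_toCircle.comp
      ((AddCircle.continuous_mk' G.width).comp Complex.continuous_re))
  unfold separator
  fun_prop

theorem separator_eq_of_proj_eq {z w : ℂ} (h : G.proj z = G.proj w) :
    G.separator z = G.separator w := by
  rw [← G.proj_clamp z, ← G.proj_clamp w] at h
  by_cases hz : 0 < (G.clamp z).im ∧ (G.clamp z).im < G.τ.im
  · obtain ⟨h1, h2⟩ := (proj_eq_iff_of_interior hz.1 hz.2).1 h.symm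
    have h3 : (w.re : AddCircle G.width) = (z.re : AddCircle G.width) := h2
    simp only [separator, h1, h3]
  by_cases hw : 0 < (G.clamp w).im ∧ (G.clamp w).im < G.τ.im
  · obtain ⟨h1, h2⟩ := (proj_eq_iff_of_interior hw.1 hw.2).1 h
    have h3 : (z.re : AddCircle G.width) = (w.re : AddCircle G.width) := h2
    simp only [separator, h1, h3]
  have h0 : ∀ v : ℂ, ¬ (0 < (G.clamp v).im ∧ (G.clamp v).im < G.τ.im) →
      (G.clamp v).im * (G.τ.im - (G.clamp v).im) = 0 := by
    intro v hv
    obtain ⟨h1, h2⟩ := G.im_clamp_mem v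
    rcases h1.eq_or_lt with h1 | h1
    · rw [← h1, zero_mul]
    · rw [le_antisymm h2 (not_lt.1 fun h3 => hv ⟨h1, h3⟩), sub_self, mul_zero]
  simp only [separator, h0 z hz, h0 w hw]
  simp

/-- At an interior point the first component is nonzero. Dividing by it recovers the height from the
second component and the position on the circle from the third. -/
theorem proj_eq_of_separator_eq {z w : ℂ} (hz : 0 < (G.clamp z).im) (hz' : (G.clamp z).im < G.τ.im)
    (h : G.separator z = G.separator w) : G.proj z = G.proj w := by
  simp only [separator, Prod.mk.injEq] at h
  obtain ⟨h1, h2, h3⟩ := h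
  have h4 : (G.clamp z).im * (G.τ.im - (G.clamp z).im) ≠ 0 := (mul_pos hz (sub_pos.2 hz')).ne'
  rw [← h1, mul_right_inj' (by exact_mod_cast h4)] at h3
  rw [← h1, mul_right_inj' h4] at h2
  rw [← G.proj_clamp z, ← G.proj_clamp w]
  refine proj_eq_of_re h2 ?_
  exact AddCircle.injective_toCircle G.width_pos.ne' (Subtype.ext h3)

theorem proj_eq_germ_of_not_interior {z : ℂ}
    (hz : ¬ (0 < (G.clamp z).im ∧ (G.clamp z).im < G.τ.im)) : ∃ b, G.proj z = G.germ b 0 := by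
  obtain ⟨h1, h2⟩ := G.im_clamp_mem z
  rw [← G.proj_clamp z]
  rcases h1.eq_or_lt with h1 | h1
  · refine ⟨(false, (z.re : AddCircle G.width)), ?_⟩
    rw [germ_coe, add_zero]
    congr 1
    exact Complex.ext rfl (by simp [flip, ← h1])
  · have h3 := le_antisymm h2 (not_lt.1 fun h3 => hz ⟨h1, h3⟩)
    refine ⟨(true, ((G.τ.re - z.re : ℝ) : AddCircle G.width)), ?_⟩
    rw [germ_coe, add_zero]
    congr 1
    exact Complex.ext (by simp [flip, clamp]) (by simp [flip, h3])

theorem germ_zero_eq_iff {b b' : G.Boundary} : G.germ b 0 = G.germ b' 0 ↔ G.perm.SameCycle b b' := by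
  have := germ_ofReal_eq b b' 0 0
  rwa [shift_zero, shift_zero] at this

/-- A pair containing an interior point is separated by the continuous function `separator`. Two
boundary points in different cycles have disjoint families of half discs of a radius that is good
for both cycles together. -/
instance : T2Space G.Surface := by
  refine ⟨fun x y hxy => ?_⟩
  obtain ⟨z, rfl⟩ := G.surjective_proj x
  obtain ⟨w, rfl⟩ := G.surjective_proj y
  let F : G.Surface → ℝ × ℝ × ℂ := Quotient.lift G.separator fun _ _ h =>
    G.separator_eq_of_proj_eq ((proj_eq_iff G).2 h)
  have hF : Continuous F := G.isQuotientMap_proj.continuous_iff.2 G.continuous_separator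
  by_cases hne : G.separator z = G.separator w
  · by_cases hz : 0 < (G.clamp z).im ∧ (G.clamp z).im < G.τ.im
    · exact absurd (G.proj_eq_of_separator_eq hz.1 hz.2 hne) hxy
    by_cases hw : 0 < (G.clamp w).im ∧ (G.clamp w).im < G.τ.im
    · exact absurd (G.proj_eq_of_separator_eq hw.1 hw.2 hne.symm).symm hxy
    obtain ⟨b, hb⟩ := G.proj_eq_germ_of_not_interior hz
    obtain ⟨b', hb'⟩ := G.proj_eq_germ_of_not_interior hw
    rw [hb, hb', Ne, germ_zero_eq_iff] at hxy
    rw [hb, hb']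
    let A := {c | G.perm.SameCycle b c}
    let A' := {c | G.perm.SameCycle b' c}
    have hA : ∀ c, G.perm c ∈ A ↔ c ∈ A := fun c => Equiv.Perm.sameCycle_apply_right
    have hA' : ∀ c, G.perm c ∈ A' ↔ c ∈ A' := fun c => Equiv.Perm.sameCycle_apply_right
    obtain ⟨ρ, hρ⟩ := exists_isGood ((G.finite_cycle b).union (G.finite_cycle b'))
      (fun c => or_congr (hA c) (hA' c))
    have hg := hρ.mono_set Set.subset_union_left hA
    have hg' := hρ.mono_set Set.subset_union_right hA'
    refine ⟨_, _, hg.isOpen_germs, hg'.isOpen_germs, ⟨b, Equiv.Perm.SameCycle.refl _ _, 0, by simp,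
      by simpa using hρ.pos, rfl⟩, ⟨b', Equiv.Perm.SameCycle.refl _ _, 0, by simp,
      by simpa using hρ.pos, rfl⟩, ?_⟩
    rw [Set.disjoint_left]
    rintro _ ⟨c, hc, u, hu, hur, rfl⟩ ⟨c', hc', u', hu', hur', h⟩
    have hcc : G.perm.SameCycle b c := hc
    have hcc' : G.perm.SameCycle b' c' := hc'
    apply hxy
    refine hcc.trans (Equiv.Perm.SameCycle.trans ?_ hcc'.symm)
    rcases (hρ.germ_eq_iff (Or.inl hc) (Or.inr hc') hu hu' hur hur').1 h.symm with
      ⟨-, -, h⟩ | ⟨-, h⟩ | ⟨-, -, -, h⟩ | ⟨-, -, -, h⟩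
    · exact h
    · rw [h]
    · rw [h, Equiv.Perm.sameCycle_apply_right]
    · rw [h]; exact ⟨-1, by rw [zpow_neg_one]⟩
  · exact separated_by_continuous (f := F) hF hne

end T2

theorem IsGood.mono {A : Set G.Boundary} {ρ ρ' : ℝ} (h : IsGood A ρ) (h0 : 0 < ρ') (hle : ρ' ≤ ρ) :
    IsGood A ρ' where
  pos := h0
  two_mul_lt := by have := h.two_mul_lt; linarith
  perm_mem := h.perm_mem
  perm_shift b hb t ht ht' := h.perm_shift b hb t ht (ht'.trans_le hle)
  perm_shift_neg b hb t ht ht' := h.perm_shift_neg b hb t ht (ht'.trans_le hle)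
  shift_inj b hb b' hb' t t' ht ht' := h.shift_inj b hb b' hb' t t' (ht.trans_le hle)
    (ht'.trans_le hle)

variable (G) in
/-- The number of half discs that are glued at a boundary point. -/
noncomputable def valence (b : G.Boundary) : ℕ := Function.minimalPeriod G.perm b

variable (G) in
theorem valence_pos (b : G.Boundary) : 0 < G.valence b := by
  apply Function.minimalPeriod_pos_of_mem_periodicPts
  have hinj := (G.finite_cycle b)
  obtain ⟨m, n, hmn, h⟩ : ∃ m n : ℕ, m < n ∧ (G.perm ^ m) b = (G.perm ^ n) b := by
    by_contra hc
    push Not at hc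
    refine Set.infinite_of_injective_forall_mem (f := fun n : ℕ => (G.perm ^ n) b) ?_
      (fun n => (⟨(n : ℤ), by simp⟩ : G.perm.SameCycle b ((G.perm ^ n) b))) hinj
    intro m n hmn
    rcases lt_trichotomy m n with h | h | h
    · exact absurd hmn (hc _ _ h)
    · exact h
    · exact absurd hmn.symm (hc _ _ h)
  refine ⟨n - m, by omega, ?_⟩
  rw [Function.IsPeriodicPt, Function.IsFixedPt, Equiv.Perm.iterate_eq_pow]
  apply (G.perm ^ m).injective
  rw [← Equiv.Perm.mul_apply, ← pow_add, h]
  congr 2; omega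

theorem zpow_perm_eq_iff {b : G.Boundary} {j j' : ℤ} :
    (G.perm ^ j') b = (G.perm ^ j) b ↔ (G.valence b : ℤ) ∣ j' - j := by
  have := MulAction.zpow_smul_eq_iff_minimalPeriod_dvd (a := G.perm) (b := b) (n := j' - j)
  rw [show (G.valence b : ℤ) = (Function.minimalPeriod (fun x => G.perm • x) b : ℤ) from rfl, ← this]
  rw [sub_eq_neg_add, zpow_add, zpow_neg, mul_smul, inv_smul_eq_iff]
  rfl

/-- `c` is the power coordinate at the cycle of the boundary point `b`. -/
structure IsBoundaryChart (b : G.Boundary) (ρ : ℝ) (c : OpenPartialHomeomorph G.Surface ℂ) :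
    Prop where
  good : IsGood {b' | G.perm.SameCycle b b'} ρ
  mem_source : ∀ x, x ∈ c.source ↔ ∃ j : ℤ, ∃ u : ℂ, 0 ≤ u.im ∧ ‖u‖ < ρ ∧
    G.germ ((G.perm ^ j) b) u = x
  apply_germ : ∀ (j : ℤ) (u : ℂ), 0 ≤ u.im → ‖u‖ < ρ →
    c (G.germ ((G.perm ^ j) b) u) = sectorCoord (G.valence b) j u

/-- The two lists of alternatives match because `perm ^ j` and `perm ^ j'` agree at `b` exactly when
the valence divides `j' - j`. Consequently the power coordinate is well defined and injective on the
union of the half discs. -/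
theorem IsGood.sectorCoord_eq_iff {b : G.Boundary} {ρ : ℝ}
    (h : IsGood {b' | G.perm.SameCycle b b'} ρ) {j j' : ℤ} {u u' : ℂ} (hu : 0 ≤ u.im)
    (hu' : 0 ≤ u'.im) (huρ : ‖u‖ < ρ) (huρ' : ‖u'‖ < ρ) :
    sectorCoord (G.valence b) j u = sectorCoord (G.valence b) j' u' ↔
      G.germ ((G.perm ^ j) b) u = G.germ ((G.perm ^ j') b) u' := by
  have hc : ∀ i : ℤ, G.perm.SameCycle b ((G.perm ^ i) b) := fun i => ⟨i, rfl⟩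
  rw [_root_.sectorCoord_eq_iff (G.valence_pos b) hu hu',
    h.germ_eq_iff (hc j) (hc j') hu hu' huρ huρ', zpow_perm_eq_iff]
  have h1 : G.perm ((G.perm ^ j) b) = (G.perm ^ (j + 1)) b := by
    rw [add_comm, zpow_add, zpow_one, Equiv.Perm.mul_apply]
  have h2 : G.perm⁻¹ ((G.perm ^ j) b) = (G.perm ^ (j - 1)) b := by
    rw [sub_eq_neg_add, zpow_add, zpow_neg_one, Equiv.Perm.mul_apply]
  rw [h1, h2, zpow_perm_eq_iff, zpow_perm_eq_iff]
  have h3 : G.perm.SameCycle ((G.perm ^ j) b) ((G.perm ^ j') b) := (hc j).symm.trans (hc j')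
  simp only [h3, and_true]

-- The inverse `φ` of the chart is built first: every `w` lies in some sector, and its parameter is
-- sent into the corresponding half disc. Any two choices of sector give the same point by
-- `IsGood.sectorCoord_eq_iff`.
variable (G) in
theorem exists_isBoundaryChart (b : G.Boundary) : ∃ ρ c, IsBoundaryChart (G := G) b ρ c := by
  obtain ⟨ρ₀, h₀⟩ := exists_isGood (G.finite_cycle b)
    (fun c => Equiv.Perm.sameCycle_apply_right)
  set k := G.valence b with hk
  have hk0 : 0 < k := G.valence_pos b
  -- Halving the radius leaves room for the closed disc, whose compactness is needed to invert `φ`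
  -- continuously.
  set ρ := ρ₀ / 2 with hρ
  have hρ0 : 0 < ρ := half_pos h₀.pos
  have hρρ : ρ < ρ₀ := half_lt_self h₀.pos
  have h := h₀.mono hρ0 hρρ.le
  have hex : (0 : ℝ) < 2 / k := by positivity
  set R := ρ ^ (2 / k : ℝ) with hR
  choose jj hj0 hjk uu huu hs using fun w => exists_sectorCoord_eq hk0 w
  have hnorm : ∀ j u, ‖u‖ ≤ ρ ↔ ‖sectorCoord k j u‖ ≤ R := fun j u => by
    rw [norm_sectorCoord, hR, Real.rpow_le_rpow_iff (norm_nonneg _) hρ0.le hex]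
  have hnorm' : ∀ j u, ‖u‖ < ρ ↔ ‖sectorCoord k j u‖ < R := fun j u => by
    rw [norm_sectorCoord, hR, Real.rpow_lt_rpow_iff (norm_nonneg _) hρ0.le hex]
  have huR : ∀ w, ‖w‖ ≤ R → ‖uu w‖ ≤ ρ := fun w hw => by rwa [hnorm (jj w), hs]
  let φ : ℂ → G.Surface := fun w => G.germ ((G.perm ^ (jj w)) b) (uu w)
  have hφ : ∀ j u, 0 ≤ u.im → ‖u‖ ≤ ρ → φ (sectorCoord k j u) = G.germ ((G.perm ^ j) b) u := by
    intro j u hu huρ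
    refine (h₀.sectorCoord_eq_iff (huu _) hu ((huR _ ((hnorm j u).1 huρ)).trans_lt hρρ)
      (huρ.trans_lt hρρ)).1 ?_
    exact hs _
  have hinj : Set.InjOn φ (Metric.closedBall 0 R) := by
    intro w hw w' hw' hww
    rw [mem_closedBall_zero_iff] at hw hw'
    have := (h₀.sectorCoord_eq_iff (huu w) (huu w') ((huR _ hw).trans_lt hρρ)
      ((huR _ hw').trans_lt hρρ)).2 hww
    rwa [hs, hs] at this
  have hcont : ContinuousOn φ (Metric.closedBall 0 R) := by
    -- The disc is covered by `k` compact sectors, on each of which `φ` is a half disc read through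
    -- `sectorCoord`. A closed set therefore pulls back to a finite union of compact images.
    rw [continuousOn_iff_isClosed]
    intro t ht
    let D : Set ℂ := Metric.closedBall 0 ρ ∩ {u | 0 ≤ u.im}
    have hD : IsCompact D := (isCompact_closedBall 0 ρ).inter_right
      (isClosed_le continuous_const Complex.continuous_im)
    refine ⟨⋃ j ∈ Finset.range k,
      sectorCoord k j '' (D ∩ G.germ ((G.perm ^ (j : ℤ)) b) ⁻¹' t), ?_, ?_⟩
    · refine (Finset.isCompact_biUnion _ fun j _ => ?_).isClosed
      refine (hD.inter_right (ht.preimage (continuous_germ _))).image_of_continuousOn ?_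
      exact fun u hu => (continuousAt_sectorCoord hk0 hu.1.2).continuousWithinAt
    · ext w
      simp only [Set.mem_inter_iff, Set.mem_preimage, Set.mem_iUnion, Set.mem_image,
        Finset.mem_range, exists_prop]
      constructor
      · rintro ⟨hw, hwR⟩
        refine ⟨⟨(jj w).toNat, by have := hj0 w; have := hjk w; omega, uu w, ?_, ?_⟩, hwR⟩
        · rw [Int.toNat_of_nonneg (hj0 w)]
          rw [mem_closedBall_zero_iff] at hwR
          exact ⟨⟨mem_closedBall_zero_iff.2 (huR w hwR), huu w⟩, hw⟩
        · rw [Int.toNat_of_nonneg (hj0 w), hs]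
      · rintro ⟨⟨j, -, u, ⟨hu, hut⟩, rfl⟩, hwR⟩
        refine ⟨?_, hwR⟩
        rw [hφ _ _ hu.2 (mem_closedBall_zero_iff.1 hu.1)]
        exact hut
  have himage : φ '' Metric.ball 0 R = {x | ∃ b' ∈ {b' | G.perm.SameCycle b b'}, ∃ u : ℂ,
      0 ≤ u.im ∧ ‖u‖ < ρ ∧ G.germ b' u = x} := by
    ext x
    constructor
    · rintro ⟨w, hw, rfl⟩
      rw [mem_ball_zero_iff] at hw
      exact ⟨_, ⟨jj w, rfl⟩, uu w, huu w, by rwa [hnorm' (jj w), hs], rfl⟩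
    · rintro ⟨_, ⟨j, rfl⟩, u, hu, huρ, rfl⟩
      exact ⟨sectorCoord k j u, mem_ball_zero_iff.2 ((hnorm' j u).1 huρ), hφ j u hu huρ.le⟩
  obtain ⟨c, hc, hcφ⟩ := exists_openPartialHomeomorph_of_disc hcont hinj
    (himage ▸ h.isOpen_germs)
  refine ⟨ρ, c, h, fun x => ?_, fun j u hu huρ => ?_⟩
  · rw [hc, himage]
    constructor
    · rintro ⟨_, ⟨j, rfl⟩, hx⟩; exact ⟨j, hx⟩
    · rintro ⟨j, hx⟩; exact ⟨_, ⟨j, rfl⟩, hx⟩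
  · rw [← hφ j u hu huρ.le]
    exact hcφ _ (mem_ball_zero_iff.2 ((hnorm' j u).1 huρ))

/-- `c` is a translation of the coordinate of the strip near the interior point `z₀`. -/
structure IsInteriorChart (z₀ : ℂ) (r : ℝ) (c : OpenPartialHomeomorph G.Surface ℂ) : Prop where
  pos : 0 < r
  im_mem : ∀ z, ‖z - z₀‖ < r → 0 < z.im ∧ z.im < G.τ.im
  mem_source : ∀ x, x ∈ c.source ↔ ∃ z, ‖z - z₀‖ < r ∧ G.proj z = x
  apply_proj : ∀ z, ‖z - z₀‖ < r → c (G.proj z) = z - z₀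

variable (G) in
theorem exists_isInteriorChart {z₀ : ℂ} (h0 : 0 < z₀.im) (h1 : z₀.im < G.τ.im) :
    ∃ r c, IsInteriorChart (G := G) z₀ r c := by
  have hw := G.width_pos
  -- The closed disc has to stay strictly inside the strip and to be narrower than one period.
  obtain ⟨r, hr0, hr1, hr2, hr3⟩ : ∃ r > 0, r < z₀.im ∧ r < G.τ.im - z₀.im ∧ 2 * r < G.width := by
    refine ⟨min z₀.im (min (G.τ.im - z₀.im) (G.width / 2)) / 2, ?_, ?_, ?_, ?_⟩
    · have : 0 < G.τ.im - z₀.im := by linarith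
      positivity
    · have := min_le_left z₀.im (min (G.τ.im - z₀.im) (G.width / 2)); linarith
    · have := min_le_right z₀.im (min (G.τ.im - z₀.im) (G.width / 2))
      have := min_le_left (G.τ.im - z₀.im) (G.width / 2); linarith
    · have := min_le_right z₀.im (min (G.τ.im - z₀.im) (G.width / 2))
      have := min_le_right (G.τ.im - z₀.im) (G.width / 2); linarith
  have him : ∀ v : ℂ, ‖v‖ ≤ r → 0 < (z₀ + v).im ∧ (z₀ + v).im < G.τ.im := by
    intro v hv
    have := abs_le.1 ((Complex.abs_im_le_norm v).trans hv)
    rw [Complex.add_im]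
    constructor <;> linarith
  let φ : ℂ → G.Surface := fun v => G.proj (z₀ + v)
  have hcont : Continuous φ := G.continuous_proj.comp (by fun_prop)
  have hinj : Set.InjOn φ (Metric.closedBall 0 r) := by
    intro v hv v' hv' h
    rw [mem_closedBall_zero_iff] at hv hv'
    obtain ⟨hi, hre⟩ := (proj_eq_iff_of_interior (him v' hv').1 (him v' hv').2).1 h
    rw [← sub_eq_zero, ← AddCircle.coe_sub] at hre
    have hvr := (Complex.abs_re_le_norm v).trans hv
    have hvr' := (Complex.abs_re_le_norm v').trans hv'
    have := coe_eq_zero_of_abs_lt (by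
      simp only [Complex.add_re, add_sub_add_left_eq_sub]
      have := abs_sub v.re v'.re; linarith) hre
    apply Complex.ext
    · simpa [sub_eq_zero] using this
    · simpa using hi
  have hopen : IsOpen (φ '' Metric.ball 0 r) := by
    rw [← G.isQuotientMap_proj.isOpen_preimage]
    have : G.proj ⁻¹' (φ '' Metric.ball 0 r) =
        ⋃ n : ℤ, Metric.ball (z₀ + (n * G.width : ℝ)) r := by
      ext z
      simp only [Set.mem_preimage, Set.mem_image, Set.mem_iUnion, mem_ball_iff_norm, sub_zero]
      constructor
      · rintro ⟨v, hv, h⟩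
        obtain ⟨hi, hre⟩ := (proj_eq_iff_of_interior (him v hv.le).1 (him v hv.le).2).1 h.symm
        rw [← sub_eq_zero, ← AddCircle.coe_sub, AddCircle.coe_eq_zero_iff] at hre
        obtain ⟨n, hn⟩ := hre
        rw [zsmul_eq_mul] at hn
        refine ⟨n, ?_⟩
        convert hv using 2
        apply Complex.ext
        · simp only [Complex.sub_re, Complex.add_re, Complex.ofReal_re] at hn ⊢; linarith
        · simp only [Complex.sub_im, Complex.add_im, Complex.ofReal_im] at hi ⊢; linarith
      · rintro ⟨n, hn⟩
        refine ⟨_, hn, ?_⟩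
        apply proj_eq_of_re
        · simp
        · have : (z₀ + (z - (z₀ + (n * G.width : ℝ)))).re = z.re - n * G.width := by
            simp only [Complex.add_re, Complex.sub_re, Complex.ofReal_re]; ring
          rw [this, AddCircle.coe_sub, (AddCircle.coe_eq_zero_iff G.width (x := n * G.width)).2
            ⟨n, by simp⟩, sub_zero]
    rw [this]
    exact isOpen_iUnion fun _ => Metric.isOpen_ball
  obtain ⟨c, hc, hcφ⟩ := exists_openPartialHomeomorph_of_disc hcont.continuousOn hinj hopen
  refine ⟨r, c, hr0, fun z hz => ?_, fun x => ?_, fun z hz => ?_⟩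
  · have := him _ hz.le
    rwa [add_sub_cancel] at this
  · rw [hc]
    constructor
    · rintro ⟨v, hv, rfl⟩
      exact ⟨z₀ + v, by simpa using hv, rfl⟩
    · rintro ⟨z, hz, rfl⟩
      exact ⟨z - z₀, by simpa using hz, by simp [φ]⟩
  · have := hcφ (z - z₀) (by simpa using hz)
    simpa [φ] using this

end CylinderGluing

/-- A change of coordinates between two charts that are holomorphic in a common local parameter `ψ`,
and its effect on two local expressions of a quadratic differential that is the square of the
differential of the parameter. -/
theorem transition_of_parameter {S : Type*} [TopologicalSpace S]
    {c c' : OpenPartialHomeomorph S ℂ} {ψ : ℂ → S} {v₀ : ℂ} {F F' : ℂ → ℂ} (hψ : ContinuousAt ψ v₀)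
    (hc : ψ v₀ ∈ c.source) (hg : AnalyticAt ℂ (fun v => c (ψ v)) v₀)
    (hg' : AnalyticAt ℂ (fun v => c' (ψ v)) v₀)
    (hF : F (c (ψ v₀)) * deriv (fun v => c (ψ v)) v₀ ^ 2 = 1)
    (hF' : F' (c' (ψ v₀)) * deriv (fun v => c' (ψ v)) v₀ ^ 2 = 1) :
    DifferentiableAt ℂ (fun w => c' (c.symm w)) (c (ψ v₀)) ∧
      F (c (ψ v₀)) = F' (c' (ψ v₀)) * deriv (fun w => c' (c.symm w)) (c (ψ v₀)) ^ 2 := by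
  set g : ℂ → ℂ := fun v => c (ψ v) with hgdef
  set g' : ℂ → ℂ := fun v => c' (ψ v) with hgdef'
  have hD : deriv g v₀ ≠ 0 := by
    intro h
    rw [h] at hF
    simp at hF
  have hs : HasStrictDerivAt g (deriv g v₀) v₀ := hg.hasStrictDerivAt
  set i := hs.localInverse g _ _ hD with hi
  have hiD : HasStrictDerivAt i (deriv g v₀)⁻¹ (g v₀) := hs.to_localInverse hD
  have hi0 : i (g v₀) = v₀ :=
    HasStrictFDerivAt.localInverse_apply_image (hf := hs.hasStrictFDerivAt_equiv hD)
  have hright : ∀ᶠ w in 𝓝 (g v₀), g (i w) = w :=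
    HasStrictFDerivAt.eventually_right_inverse (hs.hasStrictFDerivAt_equiv hD)
  have hsrc : ∀ᶠ w in 𝓝 (g v₀), ψ (i w) ∈ c.source := by
    have h1 : Filter.Tendsto (fun w => ψ (i w)) (𝓝 (g v₀)) (𝓝 (ψ v₀)) := by
      have h2 : Filter.Tendsto i (𝓝 (g v₀)) (𝓝 v₀) := by
        have := hiD.hasDerivAt.continuousAt.tendsto
        rwa [hi0] at this
      exact hψ.tendsto.comp h2
    exact h1 (c.open_source.mem_nhds hc)
  have heq : (fun w => c' (c.symm w)) =ᶠ[𝓝 (g v₀)] fun w => g' (i w) := by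
    filter_upwards [hright, hsrc] with w h1 h2
    have : c.symm w = ψ (i w) := by
      rw [← c.left_inv h2]
      exact congrArg _ h1.symm
    rw [this]
  have hder : HasDerivAt (fun w => c' (c.symm w)) (deriv g' v₀ * (deriv g v₀)⁻¹) (g v₀) := by
    refine HasDerivAt.congr_of_eventuallyEq ?_ heq
    have h1 : HasDerivAt g' (deriv g' v₀) (i (g v₀)) := by
      rw [hi0]; exact hg'.differentiableAt.hasDerivAt
    exact h1.comp _ hiD.hasDerivAt
  refine ⟨hder.differentiableAt, ?_⟩
  rw [hder.deriv, mul_pow, ← mul_assoc, hF', one_mul, inv_pow, ← one_div, eq_div_iff (pow_ne_zero _ hD),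
    hF]

/-! ### The differential in the charts near a nonsingular point -/

namespace CylinderGluing

variable {G : CylinderGluing}

theorem germ_zero_ne_proj {b : G.Boundary} {z : ℂ} (hz : 0 < z.im) (hz' : z.im < G.τ.im) :
    G.germ b 0 ≠ G.proj z := by
  intro h
  have := ((proj_eq_iff_of_interior hz hz').1 h).1
  have hτ := G.im_pos
  obtain ⟨s, x⟩ := b
  cases s <;> simp [flip] at this <;> linarith

theorem valence_eq_of_sameCycle {b b' : G.Boundary} (h : G.perm.SameCycle b b') :
    G.valence b = G.valence b' := by
  have key : ∀ m : ℤ, (G.valence b : ℤ) ∣ m ↔ (G.valence b' : ℤ) ∣ m := by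
    intro m
    obtain ⟨n, rfl⟩ := h
    have h1 := zpow_perm_eq_iff (b := b) (j := 0) (j' := m)
    have h2 := zpow_perm_eq_iff (b := (G.perm ^ n) b) (j := 0) (j' := m)
    rw [sub_zero] at h1 h2
    rw [← h1, ← h2, zpow_zero, Equiv.Perm.one_apply, Equiv.Perm.one_apply, ← Equiv.Perm.mul_apply,
      ← zpow_add, add_comm, zpow_add, Equiv.Perm.mul_apply]
    exact ((G.perm ^ n).injective.eq_iff).symm
  exact Nat.dvd_antisymm (Int.natCast_dvd_natCast.1 ((key _).2 dvd_rfl))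
    (Int.natCast_dvd_natCast.1 ((key _).1 dvd_rfl))

theorem valence_eq_two {b : G.Boundary} (h : G.perm (G.perm b) = b) (hne : G.perm b ≠ b) :
    G.valence b = 2 := by
  have h1 := zpow_perm_eq_iff (b := b) (j := 0) (j' := 2)
  have h2 := zpow_perm_eq_iff (b := b) (j := 0) (j' := 1)
  have h3 : (G.valence b : ℤ) ∣ 2 := by
    rw [sub_zero] at h1
    refine h1.1 ?_
    rw [zpow_two, zpow_zero, Equiv.Perm.mul_apply, h, Equiv.Perm.one_apply]
  have h4 : ¬ (G.valence b : ℤ) ∣ 1 := by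
    rw [sub_zero] at h2
    rw [← h2, zpow_one, zpow_zero]
    exact hne
  have h5 : G.valence b ∣ 2 := by exact_mod_cast h3
  rcases (Nat.dvd_prime Nat.prime_two).1 h5 with h | h
  · rw [h] at h4; simp at h4
  · exact h

/-- `F dw²` is the quadratic differential of the surface in the chart `c`. -/
def IsLocalForm (c : OpenPartialHomeomorph G.Surface ℂ) (F : ℂ → ℂ) : Prop :=
  (∃ z r, IsInteriorChart (G := G) z r c ∧ F = fun _ => 1) ∨
  ∃ b ρ, IsBoundaryChart (G := G) b ρ c ∧
    F = fun w => -((G.valence b : ℂ) ^ 2 / 4) * w ^ ((G.valence b : ℤ) - 2)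

/-- The coordinate `z` of the strip is a local parameter near every interior point. An interior
chart is a translation in it; a boundary chart is the power coordinate of `±z` plus a constant, and
`sectorCoord_differential` applies. -/
theorem IsLocalForm.proj {c : OpenPartialHomeomorph G.Surface ℂ} {F : ℂ → ℂ} (h : IsLocalForm c F)
    {z₀ : ℂ} (h0 : 0 < z₀.im) (h1 : z₀.im < G.τ.im) (hz : G.proj z₀ ∈ c.source) :
    AnalyticAt ℂ (fun z => c (G.proj z)) z₀ ∧
      F (c (G.proj z₀)) * deriv (fun z => c (G.proj z)) z₀ ^ 2 = 1 := by
  rcases h with ⟨z₁, r, hc, rfl⟩ | ⟨b, ρ, hc, rfl⟩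
  · obtain ⟨z, hz, hzz⟩ := (hc.mem_source _).1 hz
    obtain ⟨him, hre⟩ := (proj_eq_iff_of_interior h0 h1).1 hzz
    have heq : (fun w => c (G.proj w)) =ᶠ[𝓝 z₀] fun w => w - z₀ + z - z₁ := by
      have : ∀ᶠ w in 𝓝 z₀, ‖w - z₀ + z - z₁‖ < r := by
        have hcont : ContinuousAt (fun w => ‖w - z₀ + z - z₁‖) z₀ := by fun_prop
        apply hcont.eventually_lt_const
        simpa using hz
      filter_upwards [this] with w hw
      rw [← hc.apply_proj _ hw]
      congr 1
      apply proj_eq_of_re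
      · simp [him]
      · simp [hre]
    have hder : HasDerivAt (fun w : ℂ => w - z₀ + z - z₁) 1 z₀ :=
      (((hasDerivAt_id z₀).sub_const z₀).add_const z).sub_const z₁
    refine ⟨AnalyticAt.congr (by fun_prop) heq.symm, ?_⟩
    rw [heq.deriv_eq, hder.deriv]; norm_num
  · obtain ⟨j, u, hu, huρ, hg⟩ := (hc.mem_source _).1 hz
    set b' := (G.perm ^ j) b with hb'
    have hk := G.valence_pos b
    obtain ⟨him, hre⟩ := (proj_eq_iff_of_interior h0 h1).1 hg
    have hu0 : 0 < u.im := by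
      refine lt_of_le_of_ne hu fun h => ?_
      cases hs : b'.1 <;> rw [hs] at him <;> simp [flip, ← h] at him <;> linarith
    have hslit : -Complex.I * u ∈ Complex.slitPlane := Or.inl (by simpa using hu0)
    -- At the top the half plane coordinate is `τ - z`, hence the sign `ε`, which disappears in the
    -- square of the derivative.
    obtain ⟨ε, hε2, hε⟩ : ∃ ε : ℂ, ε ^ 2 = 1 ∧ ∀ w v : ℂ, G.flip b'.1 (v + ε * w) =
        G.flip b'.1 v + w := by
      cases b'.1
      · exact ⟨1, by simp, fun w v => by simp [flip]⟩
      · exact ⟨-1, by simp, fun w v => by simp only [flip, if_true]; ring⟩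
    have hl : HasDerivAt (fun w : ℂ => u + ε * (w - z₀)) ε z₀ := by
      simpa using (((hasDerivAt_id z₀).sub_const z₀).const_mul ε).const_add u
    have hl0 : u + ε * (z₀ - z₀) = u := by simp
    have heq : (fun w => c (G.proj w)) =ᶠ[𝓝 z₀] fun w =>
        sectorCoord (G.valence b) j (u + ε * (w - z₀)) := by
      have hcont : ContinuousAt (fun w => u + ε * (w - z₀)) z₀ := by fun_prop
      have e1 : ∀ᶠ w in 𝓝 z₀, ‖u + ε * (w - z₀)‖ < ρ :=
        hcont.norm.eventually_lt_const (by simpa using huρ)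
      have e2 : ∀ᶠ w in 𝓝 z₀, 0 < (u + ε * (w - z₀)).im :=
        (Complex.continuous_im.continuousAt.comp hcont).eventually_const_lt
          (by simpa using hu0)
      filter_upwards [e1, e2] with w h1 h2
      rw [← hc.apply_germ _ _ h2.le h1]
      congr 1
      rw [germ, ← add_assoc, hε]
      apply proj_eq_of_re
      · rw [Complex.add_im, him]; simp
      · rw [Complex.add_re, AddCircle.coe_add, hre]; simp
    have hder : HasDerivAt (fun w => sectorCoord (G.valence b) j (u + ε * (w - z₀)))
        (2 / (G.valence b) * sectorCoord (G.valence b) j u / u * ε) z₀ :=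
      HasDerivAt.comp z₀ (h₂ := sectorCoord (G.valence b) j) (h := fun w => u + ε * (w - z₀))
        (by rw [hl0]; exact hasDerivAt_sectorCoord hslit) hl
    refine ⟨AnalyticAt.congr ?_ heq.symm, ?_⟩
    · refine AnalyticAt.fun_comp (f := fun w => u + ε * (w - z₀)) (g := sectorCoord (G.valence b) j)
        ?_ (by fun_prop)
      rw [hl0]; exact analyticAt_sectorCoord hslit
    · rw [heq.deriv_eq, hder.deriv, ← hg, hc.apply_germ _ _ hu huρ, mul_pow, hε2, mul_one]
      exact sectorCoord_differential hk (fun h => by simp [h] at hu0)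

variable (G) in
/-- The local parameter at a boundary point at which exactly two half discs are glued. -/
noncomputable def twoGerm (b : G.Boundary) (v : ℂ) : G.Surface :=
  if 0 ≤ v.im then G.germ b v else G.germ (G.perm b) (-v)

theorem twoGerm_zero (b : G.Boundary) : G.twoGerm b 0 = G.germ b 0 := by simp [twoGerm]

theorem continuousAt_twoGerm (b : G.Boundary) : ContinuousAt (G.twoGerm b) 0 := by
  have h0 : G.germ (G.perm b) (-0) = G.germ b 0 := by
    rw [neg_zero]
    exact G.germ_zero_eq_iff.2 ((Equiv.Perm.sameCycle_apply_left).2 (Equiv.Perm.SameCycle.refl _ _))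
  rw [ContinuousAt, twoGerm_zero]
  refine Filter.Tendsto.if' (p := fun v : ℂ => 0 ≤ v.im) ?_ ?_
  · exact (continuous_germ b).continuousAt
  · have := ((continuous_germ (G.perm b)).comp continuous_neg).tendsto (0 : ℂ)
    simp only [Function.comp_apply, h0] at this
    exact this

/-- Away from the centre, crossing a ray replaces the sector `j` by `j ± 1` and the parameter by its
negative. The sector coordinates then fit together into the single analytic branch around the point
`t` of that ray. -/
theorem IsBoundaryChart.twoGerm_of_ne {b b' : G.Boundary} {ρ : ℝ}
    {c : OpenPartialHomeomorph G.Surface ℂ} (hc : IsBoundaryChart b ρ c) {j : ℤ} {t : ℝ}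
    (ht : |t| < ρ) (ht0 : t ≠ 0) (hb' : b' = G.shift ((G.perm ^ j) b) t) :
    (fun v => c (G.twoGerm b' v)) =ᶠ[𝓝 0] fun v => sectorCoord (G.valence b) j (t + v) := by
  have hmem : ((G.perm ^ j) b) ∈ {b' | G.perm.SameCycle b b'} := ⟨j, rfl⟩
  have hcont : ContinuousAt (fun v : ℂ => (t : ℂ) + v) 0 := by fun_prop
  have e1 : ∀ᶠ v in 𝓝 (0 : ℂ), ‖(t : ℂ) + v‖ < ρ :=
    hcont.norm.eventually_lt_const (by simpa using ht)
  have hre : ContinuousAt (fun v : ℂ => ((t : ℂ) + v).re) 0 :=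
    Complex.continuous_re.continuousAt.comp hcont
  rcases lt_or_gt_of_ne ht0 with h0 | h0
  · have e2 : ∀ᶠ v in 𝓝 (0 : ℂ), ((t : ℂ) + v).re < 0 := hre.eventually_lt_const (by simpa using h0)
    filter_upwards [e1, e2] with v h1 h2
    by_cases hv : 0 ≤ v.im
    · rw [twoGerm, if_pos hv, hb', germ_shift, hc.apply_germ _ _ (by simpa using hv) h1]
    · rw [twoGerm, if_neg hv, hb', hc.good.perm_shift_of_neg hmem h0 (by rwa [abs_of_neg h0] at ht),
        germ_shift]
      have : G.perm⁻¹ ((G.perm ^ j) b) = (G.perm ^ (j - 1)) b := by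
        rw [sub_eq_neg_add, zpow_add, zpow_neg_one, Equiv.Perm.mul_apply]
      rw [this, ← sectorCoord_neg_of_neg h2, ← hc.apply_germ _ _ (by simp; linarith)
        (by rwa [norm_neg])]
      congr 2
      push_cast; ring
  · have e2 : ∀ᶠ v in 𝓝 (0 : ℂ), 0 < ((t : ℂ) + v).re := hre.eventually_const_lt (by simpa using h0)
    filter_upwards [e1, e2] with v h1 h2
    by_cases hv : 0 ≤ v.im
    · rw [twoGerm, if_pos hv, hb', germ_shift, hc.apply_germ _ _ (by simpa using hv) h1]
    · rw [twoGerm, if_neg hv, hb', hc.good.perm_shift _ hmem _ h0 (by rwa [abs_of_pos h0] at ht),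
        germ_shift]
      have : G.perm ((G.perm ^ j) b) = (G.perm ^ (j + 1)) b := by
        rw [add_comm, zpow_add, zpow_one, Equiv.Perm.mul_apply]
      rw [this, ← sectorCoord_neg_of_pos h2, ← hc.apply_germ _ _ (by simp; linarith)
        (by rwa [norm_neg])]
      congr 2
      push_cast; ring

/-- For valence two the exponent `2 / k` is `1`, so the power coordinate is linear, and the two half
planes differ by the sign `exp (-πi)`. -/
theorem IsBoundaryChart.twoGerm_of_eq {b b' : G.Boundary} {ρ : ℝ}
    {c : OpenPartialHomeomorph G.Surface ℂ} (hc : IsBoundaryChart b ρ c) {j : ℤ}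
    (hval : G.valence b = 2) (hb' : b' = (G.perm ^ j) b) :
    (fun v => c (G.twoGerm b' v)) =ᶠ[𝓝 0] fun v =>
      Complex.exp (-(2 * Real.pi * Complex.I * (j / 2))) * (-Complex.I * v) := by
  have hcont : ContinuousAt (fun v : ℂ => v) 0 := by fun_prop
  have e1 : ∀ᶠ v in 𝓝 (0 : ℂ), ‖v‖ < ρ :=
    hcont.norm.eventually_lt_const (by simpa using hc.good.pos)
  have hsec : ∀ (i : ℤ) (v : ℂ), sectorCoord 2 i v =
      Complex.exp (-(2 * Real.pi * Complex.I * (i / 2))) * (-Complex.I * v) := by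
    intro i v; simp [sectorCoord]
  filter_upwards [e1] with v h1
  by_cases hv : 0 ≤ v.im
  · rw [twoGerm, if_pos hv, hb', hc.apply_germ _ _ hv h1, hval, hsec]
  · have : G.perm ((G.perm ^ j) b) = (G.perm ^ (j + 1)) b := by
      rw [add_comm, zpow_add, zpow_one, Equiv.Perm.mul_apply]
    rw [twoGerm, if_neg hv, hb', this, hc.apply_germ _ _ (by simp; linarith) (by rwa [norm_neg]),
      hval, hsec]
    have : -(2 * Real.pi * Complex.I * (((j + 1 : ℤ) : ℂ) / 2)) =
        -(2 * Real.pi * Complex.I * (j / 2)) - Real.pi * Complex.I := by push_cast; ring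
    rw [this, Complex.exp_sub, Complex.exp_pi_mul_I]
    ring

/-- A boundary point where two half discs meet may lie on a ray of the chart off its centre, or may
be the centre of the chart; in the latter case the valence of the chart is two. Both situations are
regular. -/
theorem IsLocalForm.twoGerm {c : OpenPartialHomeomorph G.Surface ℂ} {F : ℂ → ℂ}
    (h : IsLocalForm c F) {b : G.Boundary} (hb : G.perm (G.perm b) = b) (hne : G.perm b ≠ b)
    (hs : G.germ b 0 ∈ c.source) :
    AnalyticAt ℂ (fun v => c (G.twoGerm b v)) 0 ∧
      F (c (G.twoGerm b 0)) * deriv (fun v => c (G.twoGerm b v)) 0 ^ 2 = 1 := by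
  rcases h with ⟨z₁, r, hc, rfl⟩ | ⟨b₁, ρ, hc, rfl⟩
  · obtain ⟨z, hz, hzz⟩ := (hc.mem_source _).1 hs
    exact absurd hzz.symm (germ_zero_ne_proj (hc.im_mem z hz).1 (hc.im_mem z hz).2)
  obtain ⟨j, u, hu, huρ, hg⟩ := (hc.mem_source _).1 hs
  have hk := G.valence_pos b₁
  have hcyc : ∀ i : ℤ, (G.perm ^ i) b₁ ∈ {b' | G.perm.SameCycle b₁ b'} := fun i => ⟨i, rfl⟩
  have hre := (Complex.abs_re_le_norm u).trans_lt huρ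
  have him := (Complex.abs_im_le_norm u).trans_lt huρ
  have hτ := hc.good.two_mul_lt
  have hρ := hc.good.pos
  obtain ⟨j', t, ht, hbt⟩ : ∃ (j' : ℤ) (t : ℝ), |t| < ρ ∧ b = G.shift ((G.perm ^ j') b₁) t := by
    rcases (CylinderGluing.germ_eq_iff (b' := b) (u' := 0) hu le_rfl
      (by rw [abs_of_nonneg hu] at him; simp; linarith)).1 hg with ⟨h1, h2, -⟩ | ⟨-, -, h3⟩
    · simp at h2; exact absurd h2 h1.ne'
    rw [Complex.zero_re, shift_zero] at h3
    rcases lt_trichotomy u.re 0 with h0 | h0 | h0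
    · rcases hc.good.sameCycle_shift_of_neg (hcyc j) h0 (by rwa [abs_of_neg h0] at hre) h3 with h | h
      · exact ⟨j, _, hre, h⟩
      · refine ⟨j - 1, -u.re, by rwa [abs_neg], ?_⟩
        rw [h, sub_eq_neg_add, zpow_add, zpow_neg_one, Equiv.Perm.mul_apply]
    · rw [h0, shift_zero] at h3
      obtain ⟨n, hn⟩ := h3
      exact ⟨n + j, 0, by simpa using hρ, by rw [shift_zero, zpow_add, Equiv.Perm.mul_apply, hn]⟩
    · rcases hc.good.sameCycle_shift_of_pos (hcyc j) h0 (by rwa [abs_of_pos h0] at hre) h3 with h | h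
      · exact ⟨j, _, hre, h⟩
      · refine ⟨j + 1, -u.re, by rwa [abs_neg], ?_⟩
        rw [h, add_comm, zpow_add, zpow_one, Equiv.Perm.mul_apply]
  by_cases ht0 : t = 0
  · subst ht0
    rw [shift_zero] at hbt
    have hval : G.valence b₁ = 2 := by
      rw [← valence_eq_two hb hne]
      exact valence_eq_of_sameCycle ⟨j', hbt.symm⟩
    have heq := hc.twoGerm_of_eq hval hbt
    refine ⟨AnalyticAt.congr (by fun_prop) heq.symm, ?_⟩
    have hder : HasDerivAt (fun v => Complex.exp (-(2 * Real.pi * Complex.I * (j' / 2))) *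
        (-Complex.I * v)) (Complex.exp (-(2 * Real.pi * Complex.I * (j' / 2))) * -Complex.I) 0 := by
      simpa using ((hasDerivAt_id (0 : ℂ)).const_mul (-Complex.I)).const_mul
        (Complex.exp (-(2 * Real.pi * Complex.I * (j' / 2))))
    have hexp := exp_pow_natCast_eq_one (k := 2) (j := j') two_pos
    rw [heq.deriv_eq, hder.deriv, hval, mul_pow]
    push_cast at hexp
    rw [hexp]
    norm_num
  · have heq := hc.twoGerm_of_ne ht ht0 hbt
    have hslit : -Complex.I * (t : ℂ) ∈ Complex.slitPlane := Or.inr (by simpa using ht0)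
    have hl : HasDerivAt (fun v : ℂ => (t : ℂ) + v) 1 0 := (hasDerivAt_id (0 : ℂ)).const_add _
    have hl0 : (t : ℂ) + 0 = t := add_zero _
    have hder : HasDerivAt (fun v => sectorCoord (G.valence b₁) j' (t + v))
        (2 / (G.valence b₁) * sectorCoord (G.valence b₁) j' t / t * 1) 0 :=
      HasDerivAt.comp (0 : ℂ) (h₂ := sectorCoord (G.valence b₁) j') (h := fun v => (t : ℂ) + v)
        (by rw [hl0]; exact hasDerivAt_sectorCoord hslit) hl
    refine ⟨AnalyticAt.congr ?_ heq.symm, ?_⟩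
    · refine AnalyticAt.fun_comp (f := fun v => (t : ℂ) + v) (g := sectorCoord (G.valence b₁) j')
        ?_ (by fun_prop)
      rw [hl0]; exact analyticAt_sectorCoord hslit
    · have h0 : c (G.twoGerm b 0) = sectorCoord (G.valence b₁) j' (t + 0) := heq.self_of_nhds
      rw [heq.deriv_eq, hder.deriv, h0, hl0, mul_one]
      exact sectorCoord_differential hk (by exact_mod_cast ht0)

/-- Every point of a chart is an interior point of the cylinder, a boundary point at which two half
discs are glued, or the centre of the chart. -/
theorem IsLocalForm.mem_source_cases {c : OpenPartialHomeomorph G.Surface ℂ} {F : ℂ → ℂ}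
    (h : IsLocalForm c F) {x : G.Surface} (hx : x ∈ c.source) :
    (∃ z, 0 < z.im ∧ z.im < G.τ.im ∧ G.proj z = x) ∨
    (∃ b, G.perm (G.perm b) = b ∧ G.perm b ≠ b ∧ G.germ b 0 = x) ∨
    c x = 0 := by
  rcases h with ⟨z₁, r, hc, rfl⟩ | ⟨b, ρ, hc, rfl⟩
  · obtain ⟨z, hz, hzz⟩ := (hc.mem_source _).1 hx
    exact Or.inl ⟨z, (hc.im_mem z hz).1, (hc.im_mem z hz).2, hzz⟩
  obtain ⟨j, u, hu, huρ, hg⟩ := (hc.mem_source _).1 hx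
  have hre := (Complex.abs_re_le_norm u).trans_lt huρ
  have him := (Complex.abs_im_le_norm u).trans_lt huρ
  have hτ := hc.good.two_mul_lt
  have hρ := hc.good.pos
  have hmem : ((G.perm ^ j) b) ∈ {b' | G.perm.SameCycle b b'} := ⟨j, rfl⟩
  have hmem' : G.perm ((G.perm ^ j) b) ∈ {b' | G.perm.SameCycle b b'} := (hc.good.perm_mem _).2 hmem
  have hmem'' := hc.good.inv_mem hmem
  rcases hu.eq_or_lt with h0 | h0
  · have hur : u = (u.re : ℂ) := Complex.ext rfl h0.symm
    have hgx : G.germ (G.shift ((G.perm ^ j) b) u.re) 0 = x := by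
      rw [germ_shift, add_zero, ← hur, hg]
    rcases lt_trichotomy u.re 0 with h1 | h1 | h1
    · have h2 : -u.re < ρ := by rwa [abs_of_neg h1] at hre
      have h3 := hc.good.perm_shift_of_neg hmem h1 h2
      refine Or.inr (Or.inl ⟨_, ?_, ?_, hgx⟩)
      · rw [h3, hc.good.perm_shift _ hmem'' _ (by linarith) h2, neg_neg]
        simp
      · rw [h3]
        intro h4
        have := (hc.good.shift_inj _ hmem'' _ hmem _ _ (by rwa [abs_neg]) hre h4).2
        linarith
    · refine Or.inr (Or.inr ?_)
      rw [← hg, hc.apply_germ _ _ hu huρ, hur, h1, Complex.ofReal_zero,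
        sectorCoord_zero (G.valence_pos b)]
    · have h2 : u.re < ρ := by rwa [abs_of_pos h1] at hre
      have h3 := hc.good.perm_shift _ hmem _ h1 h2
      refine Or.inr (Or.inl ⟨_, ?_, ?_, hgx⟩)
      · rw [h3, hc.good.perm_shift_neg _ hmem _ h1 h2]
      · rw [h3]
        intro h4
        have := (hc.good.shift_inj _ hmem' _ hmem _ _ (by rwa [abs_neg]) hre h4).2
        linarith
  · refine Or.inl ?_
    have h2 : u.im < ρ := by rwa [abs_of_pos h0] at him
    refine ⟨_, ?_, ?_, hg⟩ <;> rcases ((G.perm ^ j) b).1 <;> simp [flip] <;> linarith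

end CylinderGluing

/-! ### The Riemann surface and its quadratic differential -/

namespace CylinderGluing

variable (G : CylinderGluing)

theorem exists_isLocalForm (x : G.Surface) : ∃ c : OpenPartialHomeomorph G.Surface ℂ,
    x ∈ c.source ∧ c x = 0 ∧ ∃ F, IsLocalForm c F := by
  obtain ⟨z, rfl⟩ := G.surjective_proj x
  by_cases hz : 0 < (G.clamp z).im ∧ (G.clamp z).im < G.τ.im
  · obtain ⟨r, c, hc⟩ := G.exists_isInteriorChart hz.1 hz.2
    rw [← G.proj_clamp z]
    have h0 : ‖G.clamp z - G.clamp z‖ < r := by simpa using hc.pos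
    refine ⟨c, (hc.mem_source _).2 ⟨_, h0, rfl⟩, ?_, _, Or.inl ⟨_, _, hc, rfl⟩⟩
    rw [hc.apply_proj _ h0, sub_self]
  · obtain ⟨b, hb⟩ := G.proj_eq_germ_of_not_interior hz
    obtain ⟨ρ, c, hc⟩ := G.exists_isBoundaryChart b
    have h0 : ‖(0 : ℂ)‖ < ρ := by simpa using hc.good.pos
    have h1 : G.germ ((G.perm ^ (0 : ℤ)) b) 0 = G.proj z := by rw [hb, zpow_zero]; rfl
    refine ⟨c, (hc.mem_source _).2 ⟨0, 0, le_rfl, h0, h1⟩, ?_, _, Or.inr ⟨_, _, hc, rfl⟩⟩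
    rw [← h1, hc.apply_germ _ _ le_rfl h0, sectorCoord_zero (G.valence_pos b)]

/-- The chart centred at `x`. -/
noncomputable def chart (x : G.Surface) : OpenPartialHomeomorph G.Surface ℂ :=
  (G.exists_isLocalForm x).choose

theorem mem_chart_source (x : G.Surface) : x ∈ (G.chart x).source :=
  (G.exists_isLocalForm x).choose_spec.1

theorem chart_self (x : G.Surface) : G.chart x x = 0 := (G.exists_isLocalForm x).choose_spec.2.1

theorem exists_isLocalForm_chart (x : G.Surface) : ∃ F, IsLocalForm (G.chart x) F :=
  (G.exists_isLocalForm x).choose_spec.2.2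

noncomputable instance : ChartedSpace ℂ G.Surface where
  atlas := Set.range G.chart
  chartAt := G.chart
  mem_chart_source := G.mem_chart_source
  chart_mem_atlas := Set.mem_range_self

-- Away from the centres both charts are compared through a local parameter in which the
-- differential is `dz²`. At a singular centre there is no such parameter, but none is needed: every
-- chart vanishes only at the point at which it is centred, and each point has one chart, so two
-- charts that both vanish at a common point are the same chart.
variable {G} in
theorem transition {x x' : G.Surface} {F F' : ℂ → ℂ} (hF : IsLocalForm (G.chart x) F)
    (hF' : IsLocalForm (G.chart x') F') (hFF : x = x' → F = F') {w : ℂ}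
    (hw : w ∈ (G.chart x).target) (hw' : (G.chart x).symm w ∈ (G.chart x').source) :
    DifferentiableAt ℂ (fun v => G.chart x' ((G.chart x).symm v)) w ∧
      F w = F' (G.chart x' ((G.chart x).symm w)) *
        deriv (fun v => G.chart x' ((G.chart x).symm v)) w ^ 2 := by
  set s := (G.chart x).symm w with hs
  have hsc : s ∈ (G.chart x).source := (G.chart x).map_target hw
  have hcs : G.chart x s = w := (G.chart x).right_inv hw
  have hsame : x = x' → DifferentiableAt ℂ (fun v => G.chart x' ((G.chart x).symm v)) w ∧
      F w = F' (G.chart x' s) * deriv (fun v => G.chart x' ((G.chart x).symm v)) w ^ 2 := by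
    rintro rfl
    have heq : (fun v => G.chart x ((G.chart x).symm v)) =ᶠ[𝓝 w] fun v => v := by
      filter_upwards [(G.chart x).open_target.mem_nhds hw] with v hv
      exact (G.chart x).right_inv hv
    refine ⟨DifferentiableAt.congr_of_eventuallyEq differentiableAt_id heq, ?_⟩
    rw [heq.deriv_eq, hFF rfl, hcs]
    simp
  rcases hF.mem_source_cases hsc with ⟨z, h0, h1, hz⟩ | ⟨b, hb, hne, hz⟩ | h0
  · have h2 := hF.proj h0 h1 (hz ▸ hsc)
    have h3 := hF'.proj h0 h1 (hz ▸ hw')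
    have := transition_of_parameter (G.continuous_proj.continuousAt) (hz ▸ hsc) h2.1 h3.1 h2.2 h3.2
    rwa [hz, hcs] at this
  · have h2 := hF.twoGerm hb hne (hz ▸ hsc)
    have h3 := hF'.twoGerm hb hne (hz ▸ hw')
    have := transition_of_parameter (continuousAt_twoGerm b)
      (by rw [twoGerm_zero]; exact hz ▸ hsc) h2.1 h3.1 h2.2 h3.2
    rwa [twoGerm_zero, hz, hcs] at this
  · rcases hF'.mem_source_cases hw' with ⟨z, h0, h1, hz⟩ | ⟨b, hb, hne, hz⟩ | h0'
    · have h2 := hF.proj h0 h1 (hz ▸ hsc)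
      have h3 := hF'.proj h0 h1 (hz ▸ hw')
      have := transition_of_parameter (G.continuous_proj.continuousAt) (hz ▸ hsc) h2.1 h3.1 h2.2 h3.2
      rwa [hz, hcs] at this
    · have h2 := hF.twoGerm hb hne (hz ▸ hsc)
      have h3 := hF'.twoGerm hb hne (hz ▸ hw')
      have := transition_of_parameter (continuousAt_twoGerm b)
        (by rw [twoGerm_zero]; exact hz ▸ hsc) h2.1 h3.1 h2.2 h3.2
      rwa [twoGerm_zero, hz, hcs] at this
    · apply hsame
      have e1 : s = x := (G.chart x).injOn hsc (G.mem_chart_source x) (by rw [h0, chart_self])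
      have e2 : s = x' := (G.chart x').injOn hw' (G.mem_chart_source x') (by rw [h0', chart_self])
      rw [← e1, e2]

instance : IsManifold 𝓘(ℂ) ω G.Surface := by
  apply isManifold_of_contDiffOn
  rintro _ _ ⟨x, rfl⟩ ⟨x', rfl⟩
  obtain ⟨F, hF⟩ := G.exists_isLocalForm_chart x
  obtain ⟨F', hF'⟩ := G.exists_isLocalForm_chart x'
  have hd : DifferentiableOn ℂ (fun v => G.chart x' ((G.chart x).symm v))
      ((G.chart x).symm.trans (G.chart x')).source := by
    intro w hw
    rw [OpenPartialHomeomorph.trans_source] at hw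
    by_cases hxx : x = x'
    · subst hxx
      exact (transition hF hF (fun _ => rfl) hw.1 hw.2).1.differentiableWithinAt
    · exact (transition hF hF' (fun h => absurd h hxx) hw.1 hw.2).1.differentiableWithinAt
  have := hd.contDiffOn (n := ω) (((G.chart x).symm.trans (G.chart x')).open_source)
  rw [OpenPartialHomeomorph.trans_source] at this
  simp only [mfld_simps]
  exact this

instance : CompactSpace G.Surface := by
  have hK : IsCompact ((fun p : ℝ × ℝ => G.proj ⟨p.1, p.2⟩) ''
      (Set.Icc 0 G.width ×ˢ Set.Icc 0 G.τ.im)) := by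
    refine (isCompact_Icc.prod isCompact_Icc).image (G.continuous_proj.comp ?_)
    simp only [Complex.mk_eq_add_mul_I]
    fun_prop
  refine ⟨?_⟩
  convert hK
  refine (Set.eq_univ_of_forall fun x => ?_).symm
  obtain ⟨z, rfl⟩ := G.surjective_proj x
  have : Fact (0 < G.width) := ⟨G.width_pos⟩
  refine ⟨(AddCircle.equivIco G.width 0 (z.re : AddCircle G.width), (G.clamp z).im),
    ⟨?_, G.im_clamp_mem z⟩, ?_⟩
  · have := (AddCircle.equivIco G.width 0 (z.re : AddCircle G.width)).2
    exact ⟨this.1, by simpa using this.2.le⟩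
  · rw [← G.proj_clamp z]
    refine proj_eq_of_re (z := ⟨_, _⟩) rfl ?_
    exact (AddCircle.equivIco G.width 0).symm_apply_apply (z.re : AddCircle G.width)

instance : ConnectedSpace G.Surface := by
  have : ConnectedSpace (Quotient (Setoid.ker G.key)) := inferInstance
  exact this

open Classical in
/-- The local expressions of the quadratic differential of the surface. -/
noncomputable def localForm (c : OpenPartialHomeomorph G.Surface ℂ) : ℂ → ℂ :=
  if h : ∃ F, IsLocalForm c F then h.choose else 0

theorem isLocalForm_localForm {c : OpenPartialHomeomorph G.Surface ℂ}
    (hc : c ∈ atlas ℂ G.Surface) : IsLocalForm c (G.localForm c) := by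
  obtain ⟨x, rfl⟩ := hc
  have h := G.exists_isLocalForm_chart x
  rw [localForm, dif_pos h]
  exact h.choose_spec

theorem _root_.meromorphicNFAt_const_mul_zpow {a : ℂ} (ha : a ≠ 0) (n : ℤ) (w : ℂ) :
    MeromorphicNFAt (fun v : ℂ => a * v ^ n) w := by
  by_cases hw : w = 0
  · subst hw
    rw [meromorphicNFAt_iff_analyticAt_or]
    rcases le_or_gt 0 n with hn | hn
    · left
      lift n to ℕ using hn
      simp only [zpow_natCast]
      fun_prop
    · right
      refine ⟨by fun_prop, ?_, by simp [zero_zpow _ hn.ne]⟩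
      have : meromorphicOrderAt (fun v : ℂ => a * v ^ n) 0 = n := by
        rw [meromorphicOrderAt_eq_int_iff (by fun_prop)]
        exact ⟨fun _ => a, analyticAt_const, ha, Filter.Eventually.of_forall fun v => by
          simp [mul_comm]⟩
      rw [this]
      exact_mod_cast hn
  · apply AnalyticAt.meromorphicNFAt
    exact analyticAt_const.mul (analyticAt_id.zpow hw)

theorem _root_.meromorphicOrderAt_const_mul_zpow {a : ℂ} (ha : a ≠ 0) (n : ℤ) :
    meromorphicOrderAt (fun v : ℂ => a * v ^ n) 0 = n := by
  rw [meromorphicOrderAt_eq_int_iff (by fun_prop)]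
  exact ⟨fun _ => a, analyticAt_const, ha, Filter.Eventually.of_forall fun v => by simp [mul_comm]⟩

theorem neg_valence_sq_ne_zero (b : G.Boundary) : -((G.valence b : ℂ) ^ 2 / 4) ≠ 0 := by
  have : (G.valence b : ℂ) ≠ 0 := by exact_mod_cast (G.valence_pos b).ne'
  simpa using this

/-- The quadratic differential of the glued surface. -/
noncomputable def quadraticDifferential : QuadraticDifferential G.Surface where
  toFun := G.localForm
  meromorphic c hc w _ := by
    rcases G.isLocalForm_localForm hc with ⟨z, r, -, h⟩ | ⟨b, ρ, -, h⟩
    · rw [h]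
      exact analyticAt_const.meromorphicNFAt
    · rw [h]
      exact meromorphicNFAt_const_mul_zpow (G.neg_valence_sq_ne_zero b) _ _
  compat := by
    rintro _ ⟨x, rfl⟩ _ ⟨x', rfl⟩ w hw hw'
    exact (transition (G.isLocalForm_localForm ⟨x, rfl⟩) (G.isLocalForm_localForm ⟨x', rfl⟩)
      (fun h => by rw [h]) hw hw').2

/-- The glued surface as a Riemann surface with a quadratic differential. -/
noncomputable def quadraticSurface : QuadraticSurface where
  carrier := G.Surface
  q := G.quadraticDifferential

theorem orderAt_proj {z : ℂ} (h0 : 0 < z.im) (h1 : z.im < G.τ.im) :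
    G.quadraticDifferential.orderAt (G.proj z) = 0 := by
  have hc := G.chart_self (G.proj z)
  have hF := G.isLocalForm_localForm (c := G.chart (G.proj z)) ⟨_, rfl⟩
  change meromorphicOrderAt (G.localForm (G.chart (G.proj z))) (G.chart (G.proj z) (G.proj z)) = 0
  rw [hc]
  rcases hF with ⟨z', r, -, h⟩ | ⟨b, ρ, hb, h⟩
  · rw [h]
    rw [analyticAt_const.meromorphicOrderAt_eq]
    simp [(analyticAt_const (𝕜 := ℂ) (v := (1 : ℂ)) (x := (0 : ℂ))).analyticOrderAt_eq_zero.2]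
  -- A boundary chart vanishes at a boundary point, while this chart vanishes at an interior point.
  · exfalso
    have hρ : ‖(0 : ℂ)‖ < ρ := by simpa using hb.good.pos
    have e1 : G.germ ((G.perm ^ (0 : ℤ)) b) 0 ∈ (G.chart (G.proj z)).source :=
      (hb.mem_source _).2 ⟨0, 0, le_rfl, hρ, rfl⟩
    have e2 := hb.apply_germ 0 0 le_rfl hρ
    rw [sectorCoord_zero (G.valence_pos b)] at e2
    exact germ_zero_ne_proj h0 h1
      ((G.chart (G.proj z)).injOn e1 (G.mem_chart_source _) (e2.trans hc.symm))

/-- The chart centred at this point is a power chart, possibly set up from another boundary point of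
the same cycle; the valence is constant on the cycle. -/
theorem orderAt_germ (b : G.Boundary) :
    G.quadraticDifferential.orderAt (G.germ b 0) = (((G.valence b : ℤ) - 2 : ℤ) : WithTop ℤ) := by
  have hc := G.chart_self (G.germ b 0)
  have hF := G.isLocalForm_localForm (c := G.chart (G.germ b 0)) ⟨_, rfl⟩
  change meromorphicOrderAt (G.localForm (G.chart (G.germ b 0))) (G.chart (G.germ b 0) (G.germ b 0))
    = _
  rw [hc]
  rcases hF with ⟨z, r, hz, h⟩ | ⟨b', ρ, hb, h⟩
  · exfalso
    obtain ⟨v, hv, hvv⟩ := (hz.mem_source _).1 (G.mem_chart_source (G.germ b 0))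
    exact germ_zero_ne_proj (hz.im_mem v hv).1 (hz.im_mem v hv).2 hvv.symm
  · have hρ : ‖(0 : ℂ)‖ < ρ := by simpa using hb.good.pos
    have e1 : G.germ ((G.perm ^ (0 : ℤ)) b') 0 ∈ (G.chart (G.germ b 0)).source :=
      (hb.mem_source _).2 ⟨0, 0, le_rfl, hρ, rfl⟩
    have e2 := hb.apply_germ 0 0 le_rfl hρ
    rw [sectorCoord_zero (G.valence_pos b')] at e2
    have e3 := (G.chart (G.germ b 0)).injOn e1 (G.mem_chart_source _) (e2.trans hc.symm)
    rw [germ_zero_eq_iff, zpow_zero, Equiv.Perm.one_apply] at e3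
    rw [h, ← valence_eq_of_sameCycle e3]
    exact meromorphicOrderAt_const_mul_zpow (G.neg_valence_sq_ne_zero b') _

theorem differentiableAt_chart_proj {z : ℂ} (h0 : 0 < z.im) (h1 : z.im < G.τ.im)
    {c : OpenPartialHomeomorph G.Surface ℂ} (hc : c ∈ atlas ℂ G.Surface)
    (hz : G.proj z ∈ c.source) :
    DifferentiableAt ℂ (fun w => c (G.proj w)) z ∧
      G.quadraticDifferential.toFun c (c (G.proj z)) * deriv (fun w => c (G.proj w)) z ^ 2 = 1 := by
  have := (G.isLocalForm_localForm hc).proj h0 h1 hz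
  exact ⟨this.1.differentiableAt, this.2⟩

/-- Every point of the surface is an interior or a boundary point of the cylinder. -/
theorem exists_eq_proj_or_eq_germ (x : G.Surface) :
    (∃ z : ℂ, 0 < z.im ∧ z.im < G.τ.im ∧ G.proj z = x) ∨ ∃ b, G.germ b 0 = x := by
  obtain ⟨z, rfl⟩ := G.surjective_proj x
  by_cases hz : 0 < (G.clamp z).im ∧ (G.clamp z).im < G.τ.im
  · exact Or.inl ⟨_, hz.1, hz.2, G.proj_clamp z⟩
  · obtain ⟨b, hb⟩ := G.proj_eq_germ_of_not_interior hz
    exact Or.inr ⟨b, hb.symm⟩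

end CylinderGluing

/-- The square of an Abelian differential has no simple poles. -/
theorem QuadraticDifferential.not_isGlobalSquare_of_orderAt {X : Type} [TopologicalSpace X]
    [ChartedSpace ℂ X] {q : QuadraticDifferential X} {x : X}
    (hx : q.orderAt x = ((-1 : ℤ) : WithTop ℤ)) : ¬ q.IsGlobalSquare := by
  rintro ⟨η, hη⟩
  have hc := chart_mem_atlas ℂ x
  have hx' : chartAt ℂ x x ∈ (chartAt ℂ x).target := (chartAt ℂ x).map_source (mem_chart_source ℂ x)
  have han := (η.holomorphic _ hc _ hx').pow 2
  have heq : q.toFun (chartAt ℂ x) =ᶠ[𝓝 (chartAt ℂ x x)] η.toFun (chartAt ℂ x) ^ 2 := by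
    filter_upwards [(chartAt ℂ x).open_target.mem_nhds hx'] with z hz
    exact hη _ hc z hz
  have h0 := (han.congr heq.symm).meromorphicOrderAt_nonneg
  rw [QuadraticDifferential.orderAt] at hx
  rw [hx] at h0
  exact absurd h0 (by decide)

/-! ## Gluing patterns given by words -/

section StartIn

variable {α : Type} [DecidableEq α] (len : α → ℝ)

/-- The position at which the letter `x` starts, if the letters of a word occupy consecutive
intervals. -/
def startIn : List α → α → ℝ
  | [], _ => 0
  | a :: l, x => if a = x then 0 else len a + startIn l x

variable {len}

theorem startIn_nonneg {l : List α} (hl : ∀ x ∈ l, 0 < len x) (x : α) : 0 ≤ startIn len l x := by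
  induction l with
  | nil => exact le_rfl
  | cons a l ih =>
    rw [startIn]
    split_ifs
    · exact le_rfl
    · exact add_nonneg (hl a (by simp)).le (ih fun x hx => hl x (by simp [hx]))

theorem startIn_add_le {l : List α} (hl : ∀ x ∈ l, 0 < len x) {x : α} (hx : x ∈ l) :
    startIn len l x + len x ≤ (l.map len).sum := by
  induction l with
  | nil => simp at hx
  | cons a l ih =>
    have hl' : ∀ x ∈ l, 0 < len x := fun x hx => hl x (by simp [hx])
    rw [startIn, List.map_cons, List.sum_cons]
    split_ifs with h
    · subst h
      have : 0 ≤ (l.map len).sum := List.sum_nonneg fun y hy => by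
        obtain ⟨z, hz, rfl⟩ := List.mem_map.1 hy
        exact (hl' z hz).le
      linarith
    · have := ih hl' ((List.mem_cons.1 hx).resolve_left (Ne.symm h))
      linarith

theorem exists_startIn_le {l : List α} (hl : l.Nodup) {y : ℝ} (h0 : 0 ≤ y)
    (h1 : y < (l.map len).sum) : ∃ x ∈ l, startIn len l x ≤ y ∧ y < startIn len l x + len x := by
  induction l generalizing y with
  | nil => simp at h1; linarith
  | cons a l ih =>
    rw [List.nodup_cons] at hl
    rw [List.map_cons, List.sum_cons] at h1
    rcases lt_or_ge y (len a) with h | h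
    · exact ⟨a, by simp, by simp [startIn, h0], by simp [startIn, h]⟩
    · obtain ⟨x, hx, h2, h3⟩ := ih hl.2 (y := y - len a) (by linarith) (by linarith)
      have hax : a ≠ x := fun h => hl.1 (h ▸ hx)
      exact ⟨x, by simp [hx], by rw [startIn, if_neg hax]; linarith,
        by rw [startIn, if_neg hax]; linarith⟩

theorem startIn_inj {l : List α} (hl : ∀ x ∈ l, 0 < len x) {x x' : α} (hx : x ∈ l) (hx' : x' ∈ l)
    {y : ℝ} (h1 : startIn len l x ≤ y) (h2 : y < startIn len l x + len x)
    (h1' : startIn len l x' ≤ y) (h2' : y < startIn len l x' + len x') : x = x' := by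
  induction l generalizing y with
  | nil => simp at hx
  | cons a l ih =>
    have hl' : ∀ x ∈ l, 0 < len x := fun x hx => hl x (by simp [hx])
    have hp := startIn_nonneg hl' x
    have hp' := startIn_nonneg hl' x'
    rw [startIn] at h1 h2 h1' h2'
    by_cases hax : a = x <;> by_cases hax' : a = x'
    · rw [← hax, hax']
    · rw [if_pos hax] at h1 h2
      rw [if_neg hax'] at h1' h2'
      subst hax; linarith
    · rw [if_neg hax] at h1 h2
      rw [if_pos hax'] at h1' h2'
      subst hax'; linarith
    · rw [if_neg hax] at h1 h2
      rw [if_neg hax'] at h1' h2'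
      exact ih hl' ((List.mem_cons.1 hx).resolve_left (Ne.symm hax))
        ((List.mem_cons.1 hx').resolve_left (Ne.symm hax')) (y := y - len a)
        (by linarith) (by linarith) (by linarith) (by linarith)

theorem startIn_getElem {l : List α} (hl : l.Nodup) (i : ℕ) (hi : i < l.length) :
    startIn len l l[i] = ((l.take i).map len).sum := by
  induction l generalizing i with
  | nil => simp at hi
  | cons a l ih =>
    rw [List.nodup_cons] at hl
    cases i with
    | zero => simp [startIn]
    | succ i =>
      have hi' : i < l.length := by simpa using hi
      have hne : a ≠ l[i] := fun h => hl.1 (h ▸ List.getElem_mem _)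
      rw [List.getElem_cons_succ, startIn, if_neg hne, ih hl.2 i hi']
      simp

/-- The second alternative is the passage from the last letter back to the first, which is harmless
modulo the total length. -/
theorem startIn_formPerm {l : List α} (hl : l.Nodup) {x : α} (hx : x ∈ l) :
    startIn len l (l.formPerm x) = startIn len l x + len x ∨
    (startIn len l (l.formPerm x) = 0 ∧ startIn len l x + len x = (l.map len).sum) := by
  obtain ⟨i, hi, rfl⟩ := List.getElem_of_mem hx
  have hsucc : ((l.take (i + 1)).map len).sum = startIn len l l[i] + len l[i] := by
    rw [startIn_getElem hl i hi, List.take_succ_eq_append_getElem hi, List.map_append,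
      List.sum_append, List.map_singleton, List.sum_singleton]
  rw [List.formPerm_apply_getElem _ hl, startIn_getElem hl, ← hsucc]
  rcases Nat.lt_or_ge (i + 1) l.length with h | h
  · left; rw [Nat.mod_eq_of_lt h]
  · right
    have : i + 1 = l.length := by omega
    rw [this, Nat.mod_self, List.take_length]
    simp

end StartIn

/-- Two words whose letters are the sides of a cylinder, in the boundary orientation: the bottom
(`false`) from left to right, the top (`true`) from right to left. The sides `x` and `ι x` are
identified so that the boundary orientation is reversed. -/
structure WordGluing (α : Type) [DecidableEq α] where
  word : Bool → List α
  nodup : (word false ++ word true).Nodup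
  word_ne_nil : word false ≠ []
  ι : Equiv.Perm α
  ι_ι : ∀ x, ι (ι x) = x
  ι_ne : ∀ x, ι x ≠ x
  ι_mem : ∀ x ∈ word false ++ word true, ι x ∈ word false ++ word true
  len : α → ℝ
  len_pos : ∀ x ∈ word false ++ word true, 0 < len x
  len_ι : ∀ x, len (ι x) = len x
  sum_eq : ((word false).map len).sum = ((word true).map len).sum
  τ : ℂ
  im_pos : 0 < τ.im

namespace WordGluing

variable {α : Type} [DecidableEq α] (P : WordGluing α)

/-- The letters of the two words. -/
def letters : List α := P.word false ++ P.word true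

/-- The common length of the words. -/
def width : ℝ := ((P.word false).map P.len).sum

/-- The line of a letter. -/
def side (x : α) : Bool := decide (x ∈ P.word true)

/-- The position of a letter on the boundary. -/
def start (x : α) : ℝ := startIn P.len (P.word (P.side x)) x

/-- The boundary point at distance `t` from the starting point of the side `x`. -/
noncomputable def pos (x : α) (t : ℝ) : Bool × AddCircle P.width :=
  (P.side x, ((P.start x + t : ℝ) : AddCircle P.width))

/-- The letter that follows, in the cyclic order of the boundary. -/
def next : Equiv.Perm α := (P.word false).formPerm * (P.word true).formPerm

variable {P}

theorem mem_letters {x : α} : x ∈ P.letters ↔ x ∈ P.word false ∨ x ∈ P.word true := List.mem_append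

theorem mem_letters_of_mem {s : Bool} {x : α} (hx : x ∈ P.word s) : x ∈ P.letters := by
  cases s
  · exact mem_letters.2 (Or.inl hx)
  · exact mem_letters.2 (Or.inr hx)

theorem nodup_word (s : Bool) : (P.word s).Nodup := by
  have := List.nodup_append.1 P.nodup
  cases s
  · exact this.1
  · exact this.2.1

theorem side_eq {s : Bool} {x : α} (hx : x ∈ P.word s) : P.side x = s := by
  have := (List.nodup_append.1 P.nodup).2.2
  cases s
  · simp only [side, decide_eq_false_iff_not]
    exact fun h => this _ hx _ h rfl
  · simpa [side] using hx

theorem mem_word_side {x : α} (hx : x ∈ P.letters) : x ∈ P.word (P.side x) := by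
  rcases mem_letters.1 hx with h | h <;> rw [side_eq h] <;> exact h

theorem sum_word (s : Bool) : ((P.word s).map P.len).sum = P.width := by
  cases s
  · rfl
  · exact P.sum_eq.symm

theorem width_pos : 0 < P.width := by
  obtain ⟨x, hx⟩ := List.exists_mem_of_ne_nil _ P.word_ne_nil
  have h1 := P.len_pos x (List.mem_append_left _ hx)
  have hl : ∀ y ∈ P.word false, 0 < P.len y := fun y hy => P.len_pos y (List.mem_append_left _ hy)
  have h2 := startIn_add_le hl hx
  have h3 := startIn_nonneg hl x
  rw [sum_word] at h2
  linarith

theorem len_pos_of_mem_word {s : Bool} : ∀ x ∈ P.word s, 0 < P.len x :=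
  fun x hx => P.len_pos x (mem_letters_of_mem hx)

theorem start_nonneg (x : α) : 0 ≤ P.start x := startIn_nonneg len_pos_of_mem_word x

theorem start_add_le {x : α} (hx : x ∈ P.letters) : P.start x + P.len x ≤ P.width := by
  rw [← P.sum_word (P.side x)]
  exact startIn_add_le len_pos_of_mem_word (mem_word_side hx)

theorem next_mem_word {s : Bool} {x : α} (hx : x ∈ P.word s) :
    P.next x = (P.word s).formPerm x ∧ P.next x ∈ P.word s := by
  have hd := (List.nodup_append.1 P.nodup).2.2
  have hmem := List.formPerm_apply_mem_of_mem hx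
  cases s
  · have h1 : (P.word true).formPerm x = x :=
      List.formPerm_apply_of_notMem fun h => hd _ hx _ h rfl
    have : P.next x = (P.word false).formPerm x := by
      rw [next, Equiv.Perm.mul_apply, h1]
    exact ⟨this, this ▸ hmem⟩
  · have : P.next x = (P.word true).formPerm x := by
      rw [next, Equiv.Perm.mul_apply]
      exact List.formPerm_apply_of_notMem fun h => hd _ h _ hmem rfl
    exact ⟨this, this ▸ hmem⟩

theorem next_mem {x : α} (hx : x ∈ P.letters) : P.next x ∈ P.letters :=
  mem_letters_of_mem (next_mem_word (mem_word_side hx)).2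

theorem side_next {x : α} (hx : x ∈ P.letters) : P.side (P.next x) = P.side x :=
  side_eq (next_mem_word (mem_word_side hx)).2

theorem next_inv_mem {x : α} (hx : x ∈ P.letters) : P.next⁻¹ x ∈ P.letters := by
  by_contra h
  have hy : P.next (P.next⁻¹ x) = P.next⁻¹ x := by
    rw [mem_letters, not_or] at h
    rw [next, Equiv.Perm.mul_apply]
    rw [← next, List.formPerm_apply_of_notMem h.2, List.formPerm_apply_of_notMem h.1]
  rw [Equiv.Perm.eq_inv_iff_eq.1 rfl] at hy
  exact h (hy ▸ hx)

theorem pos_len {x : α} (hx : x ∈ P.letters) : P.pos x (P.len x) = P.pos (P.next x) 0 := by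
  refine Prod.ext (side_next hx).symm ?_
  have h := mem_word_side hx
  simp only [pos, add_zero]
  rw [start, start, side_next hx, (next_mem_word h).1]
  rcases startIn_formPerm (len := P.len) (nodup_word _) h with h1 | ⟨h1, h2⟩
  · rw [h1]
  · rw [h1, h2, sum_word, AddCircle.coe_period, AddCircle.coe_zero]

theorem pos_inj {x x' : α} {t t' : ℝ} (hx : x ∈ P.letters) (hx' : x' ∈ P.letters) (h0 : 0 ≤ t)
    (h1 : t < P.len x) (h0' : 0 ≤ t') (h1' : t' < P.len x') (h : P.pos x t = P.pos x' t') :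
    x = x' ∧ t = t' := by
  have hs : P.side x = P.side x' := congrArg Prod.fst h
  have hc : ((P.start x + t : ℝ) : AddCircle P.width) = ((P.start x' + t' : ℝ) : AddCircle P.width) :=
    congrArg Prod.snd h
  have : Fact (0 < P.width) := ⟨width_pos⟩
  have heq : P.start x + t = P.start x' + t' := by
    have e1 := start_add_le hx
    have e2 := start_add_le hx'
    have e3 := P.start_nonneg x
    have e4 := P.start_nonneg x'
    refine (AddCircle.coe_eq_coe_iff_of_mem_Ico (a := 0) (p := P.width) ?_ ?_).1 hc <;>
      constructor <;> linarith
  have hxx : x = x' := by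
    have e1 := mem_word_side hx
    have e2 := mem_word_side hx'
    refine startIn_inj (len := P.len) len_pos_of_mem_word e1 (hs ▸ e2) (y := P.start x + t) ?_ ?_ ?_ ?_
    · rw [start]; linarith
    · rw [start]; linarith
    · rw [heq, hs, start]; linarith
    · rw [heq, hs, start]; linarith
  subst hxx
  exact ⟨rfl, by linarith⟩

variable (P) in
theorem exists_pos (b : Bool × AddCircle P.width) :
    ∃ x ∈ P.letters, ∃ t, 0 ≤ t ∧ t < P.len x ∧ P.pos x t = b := by
  have : Fact (0 < P.width) := ⟨width_pos⟩
  obtain ⟨s, c⟩ := b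
  obtain ⟨y, hy0, hy1, hyc⟩ : ∃ y : ℝ, 0 ≤ y ∧ y < P.width ∧ (y : AddCircle P.width) = c :=
    ⟨AddCircle.equivIco P.width 0 c, (AddCircle.equivIco P.width 0 c).2.1,
      by simpa using (AddCircle.equivIco P.width 0 c).2.2,
      (AddCircle.equivIco P.width 0).symm_apply_apply c⟩
  rw [← P.sum_word s] at hy1
  obtain ⟨x, hx, h1, h2⟩ := exists_startIn_le (nodup_word s) hy0 hy1
  have hs := side_eq hx
  refine ⟨x, mem_letters_of_mem hx, y - P.start x, ?_, ?_, ?_⟩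
  · rw [start, hs]; linarith
  · rw [start, hs]; linarith
  · rw [pos, add_sub_cancel, hs, hyc]

variable (P)

/-- The gluing of boundary points in terms of sides. -/
noncomputable def step (e : α × ℝ) : α × ℝ :=
  -- The starting point of `x` is glued to the end of `ι x`. On half-open sides this end belongs to
  -- the following letter, as its starting point.
  if e.2 = 0 then (P.next (P.ι e.1), 0) else (P.ι e.1, P.len e.1 - e.2)

/-- The inverse of `step`. -/
noncomputable def stepInv (e : α × ℝ) : α × ℝ :=
  if e.2 = 0 then (P.ι (P.next⁻¹ e.1), 0) else (P.ι e.1, P.len e.1 - e.2)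

/-- The side of a boundary point and the position on the side. -/
noncomputable def edgeAt (b : Bool × AddCircle P.width) : α × ℝ :=
  ((P.exists_pos b).choose, (P.exists_pos b).choose_spec.2.choose)

/-- Positions on the half-open sides. -/
def IsPosition (e : α × ℝ) : Prop := e.1 ∈ P.letters ∧ 0 ≤ e.2 ∧ e.2 < P.len e.1

variable {P}

theorem isPosition_edgeAt (b : Bool × AddCircle P.width) : P.IsPosition (P.edgeAt b) :=
  ⟨(P.exists_pos b).choose_spec.1, (P.exists_pos b).choose_spec.2.choose_spec.1,
    (P.exists_pos b).choose_spec.2.choose_spec.2.1⟩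

theorem pos_edgeAt (b : Bool × AddCircle P.width) : P.pos (P.edgeAt b).1 (P.edgeAt b).2 = b :=
  (P.exists_pos b).choose_spec.2.choose_spec.2.2

theorem edgeAt_pos {e : α × ℝ} (he : P.IsPosition e) : P.edgeAt (P.pos e.1 e.2) = e := by
  have h := isPosition_edgeAt (P.pos e.1 e.2)
  obtain ⟨h1, h2⟩ := pos_inj h.1 he.1 h.2.1 h.2.2 he.2.1 he.2.2 (pos_edgeAt _)
  exact Prod.ext h1 h2

theorem ι_mem_letters {x : α} (hx : x ∈ P.letters) : P.ι x ∈ P.letters := P.ι_mem x hx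

theorem isPosition_zero {x : α} (hx : x ∈ P.letters) : P.IsPosition (x, 0) :=
  ⟨hx, le_rfl, P.len_pos x hx⟩

theorem IsPosition.reverse {e : α × ℝ} (he : P.IsPosition e) (h0 : e.2 ≠ 0) :
    P.IsPosition (P.ι e.1, P.len e.1 - e.2) := by
  have := lt_of_le_of_ne he.2.1 (Ne.symm h0)
  refine ⟨ι_mem_letters he.1, ?_, ?_⟩
  · have := he.2.2; simp only; linarith
  · simp only [P.len_ι]; linarith

theorem isPosition_step {e : α × ℝ} (he : P.IsPosition e) : P.IsPosition (P.step e) := by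
  rw [step]
  split_ifs with h
  · exact isPosition_zero (next_mem (ι_mem_letters he.1))
  · exact he.reverse h

theorem isPosition_stepInv {e : α × ℝ} (he : P.IsPosition e) : P.IsPosition (P.stepInv e) := by
  rw [stepInv]
  split_ifs with h
  · exact isPosition_zero (ι_mem_letters (next_inv_mem he.1))
  · exact he.reverse h

theorem stepInv_step {e : α × ℝ} (he : P.IsPosition e) : P.stepInv (P.step e) = e := by
  obtain ⟨x, t⟩ := e
  by_cases h : t = 0
  · subst h; simp [step, stepInv, P.ι_ι]
  · have h1 : P.len x - t ≠ 0 := (sub_pos.2 he.2.2).ne'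
    simp [step, stepInv, h, h1, P.ι_ι, P.len_ι]

theorem step_stepInv {e : α × ℝ} (he : P.IsPosition e) : P.step (P.stepInv e) = e := by
  obtain ⟨x, t⟩ := e
  by_cases h : t = 0
  · subst h; simp [step, stepInv, P.ι_ι]
  · have h1 : P.len x - t ≠ 0 := (sub_pos.2 he.2.2).ne'
    simp [step, stepInv, h, h1, P.ι_ι, P.len_ι]

variable (P) in
/-- The permutation of the boundary points. -/
noncomputable def perm : Equiv.Perm (Bool × AddCircle P.width) where
  toFun b := P.pos (P.step (P.edgeAt b)).1 (P.step (P.edgeAt b)).2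
  invFun b := P.pos (P.stepInv (P.edgeAt b)).1 (P.stepInv (P.edgeAt b)).2
  left_inv b := by
    have h := isPosition_edgeAt b
    beta_reduce
    rw [edgeAt_pos (isPosition_step h), stepInv_step h, pos_edgeAt]
  right_inv b := by
    have h := isPosition_edgeAt b
    beta_reduce
    rw [edgeAt_pos (isPosition_stepInv h), step_stepInv h, pos_edgeAt]

theorem perm_pos_of_pos {x : α} (hx : x ∈ P.letters) {t : ℝ} (h0 : 0 < t) (h1 : t < P.len x) :
    P.perm (P.pos x t) = P.pos (P.ι x) (P.len x - t) := by
  have he : P.IsPosition (x, t) := ⟨hx, h0.le, h1⟩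
  have : P.edgeAt (P.pos x t) = (x, t) := edgeAt_pos he
  simp only [perm, Equiv.coe_fn_mk, this, step, h0.ne', if_false]

theorem perm_pos_zero {x : α} (hx : x ∈ P.letters) :
    P.perm (P.pos x 0) = P.pos (P.next (P.ι x)) 0 := by
  have : P.edgeAt (P.pos x 0) = (x, 0) := edgeAt_pos (isPosition_zero hx)
  simp only [perm, Equiv.coe_fn_mk, this, step, if_true]

variable (P) in
/-- The permutation of the starting points of the sides. -/
def vertexPerm : Equiv.Perm α := P.next * P.ι

theorem vertexPerm_zpow_mem {x : α} (hx : x ∈ P.letters) (n : ℤ) :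
    (P.vertexPerm ^ n) x ∈ P.letters := by
  induction n using Int.induction_on with
  | zero => simpa
  | succ n ih =>
    rw [add_comm, zpow_add, zpow_one, Equiv.Perm.mul_apply]
    exact next_mem (ι_mem_letters ih)
  | pred n ih =>
    rw [sub_eq_neg_add, zpow_add, zpow_neg_one, Equiv.Perm.mul_apply, vertexPerm, mul_inv_rev,
      Equiv.Perm.mul_apply]
    have h : ∀ y, P.ι⁻¹ y = P.ι y := fun y => by rw [Equiv.Perm.inv_eq_iff_eq, P.ι_ι]
    rw [h]
    exact ι_mem_letters (next_inv_mem ih)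

theorem perm_zpow_pos_zero {x : α} (hx : x ∈ P.letters) (n : ℤ) :
    (P.perm ^ n) (P.pos x 0) = P.pos ((P.vertexPerm ^ n) x) 0 := by
  have step : ∀ y ∈ P.letters, P.perm (P.pos y 0) = P.pos (P.vertexPerm y) 0 :=
    fun y hy => perm_pos_zero hy
  induction n using Int.induction_on with
  | zero => simp
  | succ n ih =>
    rw [add_comm, zpow_add, zpow_one, Equiv.Perm.mul_apply, ih, step _ (vertexPerm_zpow_mem hx _),
      zpow_add, zpow_one, Equiv.Perm.mul_apply]
  | pred n ih =>
    rw [sub_eq_neg_add, zpow_add, zpow_neg_one, Equiv.Perm.mul_apply, ih, Equiv.Perm.inv_eq_iff_eq,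
      step _ (vertexPerm_zpow_mem hx _), ← Equiv.Perm.mul_apply, ← zpow_one_add]
    congr 3
    ring

theorem pos_zero_inj {x x' : α} (hx : x ∈ P.letters) (hx' : x' ∈ P.letters) :
    P.pos x 0 = P.pos x' 0 ↔ x = x' :=
  ⟨fun h => (pos_inj hx hx' le_rfl (P.len_pos x hx) le_rfl (P.len_pos x' hx') h).1, fun h => by rw [h]⟩

theorem sameCycle_pos_zero_iff {x x' : α} (hx : x ∈ P.letters) (hx' : x' ∈ P.letters) :
    P.perm.SameCycle (P.pos x 0) (P.pos x' 0) ↔ P.vertexPerm.SameCycle x x' := by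
  refine exists_congr fun n => ?_
  rw [perm_zpow_pos_zero hx, pos_zero_inj (vertexPerm_zpow_mem hx n) hx']

theorem perm_perm_pos {x : α} (hx : x ∈ P.letters) {t : ℝ} (h0 : 0 < t) (h1 : t < P.len x) :
    P.perm (P.perm (P.pos x t)) = P.pos x t := by
  rw [perm_pos_of_pos hx h0 h1, perm_pos_of_pos (ι_mem_letters hx) (by linarith)
    (by rw [P.len_ι]; linarith), P.ι_ι, P.len_ι, sub_sub_cancel]

theorem perm_pos_ne {x : α} (hx : x ∈ P.letters) {t : ℝ} (h0 : 0 < t) (h1 : t < P.len x) :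
    P.perm (P.pos x t) ≠ P.pos x t := by
  rw [perm_pos_of_pos hx h0 h1]
  intro h
  exact P.ι_ne x (pos_inj (ι_mem_letters hx) hx (by linarith) (by rw [P.len_ι]; linarith) h0.le h1 h).1

variable (P) in
/-- The gluing of the cylinder that is described by the words. -/
noncomputable def cylinderGluing : CylinderGluing where
  width := P.width
  τ := P.τ
  width_pos := width_pos
  im_pos := P.im_pos
  perm := P.perm
  local_gluing b := by
    obtain ⟨x, hx, t, h0, h1, rfl⟩ := P.exists_pos b
    -- This is the distance to the end of the side. By `pos_len` the reversal formula for the image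
    -- of the base point also holds for `t = 0`, so vertices and inner points are treated alike.
    refine ⟨P.len x - t, by linarith, fun s hs0 hs1 => ?_⟩
    have hadd : ∀ (y : α) (r r' : ℝ), ((P.pos y r).1, (P.pos y r).2 + (r' : AddCircle P.width)) =
        P.pos y (r + r') := fun y r r' => by
      simp [pos, add_assoc]
    have hsub : ((P.perm (P.pos x t)).1, (P.perm (P.pos x t)).2 - (s : AddCircle P.width)) =
        P.pos (P.ι x) (P.len x - (t + s)) := by
      have : P.perm (P.pos x t) = P.pos (P.ι x) (P.len x - t) := by
        rcases h0.eq_or_lt with h | h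
        · rw [← h, perm_pos_zero hx, sub_zero, ← P.len_ι x, pos_len (ι_mem_letters hx)]
        · exact perm_pos_of_pos hx h h1
      rw [this, sub_eq_add_neg (P.pos (P.ι x) (P.len x - t)).2, ← AddCircle.coe_neg, hadd]
      congr 1; ring
    rw [hadd, hsub]
    refine ⟨perm_pos_of_pos hx (by linarith) (by linarith), ?_⟩
    rw [perm_pos_of_pos (ι_mem_letters hx) (by linarith) (by rw [P.len_ι]; linarith), P.ι_ι,
      P.len_ι, sub_sub_cancel]
  finite_cycle b := by
    obtain ⟨x, hx, t, h0, h1, rfl⟩ := P.exists_pos b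
    rcases h0.eq_or_lt with h | h
    · subst h
      refine ((List.finite_toSet P.letters).image fun y => P.pos y 0).subset ?_
      rintro _ ⟨n, rfl⟩
      exact ⟨_, vertexPerm_zpow_mem hx n, (perm_zpow_pos_zero hx n).symm⟩
    · refine (Set.toFinite {P.pos x t, P.perm (P.pos x t)}).subset fun c hc => ?_
      exact CylinderGluing.eq_or_eq_of_sameCycle rfl (perm_perm_pos hx h h1) hc

/-- Reduces the cone angles at the vertices to the cycle lengths of a permutation of the letters;
the side lengths no longer matter. -/
theorem valence_pos_zero {x : α} (hx : x ∈ P.letters) :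
    P.cylinderGluing.valence (P.pos x 0) = Function.minimalPeriod P.vertexPerm x := by
  have key : ∀ m : ℕ, P.cylinderGluing.valence (P.pos x 0) ∣ m ↔
      Function.minimalPeriod P.vertexPerm x ∣ m := by
    intro m
    rw [show P.cylinderGluing.valence (P.pos x 0) = Function.minimalPeriod P.perm (P.pos x 0) from rfl,
      ← Function.isPeriodicPt_iff_minimalPeriod_dvd,
      ← Function.isPeriodicPt_iff_minimalPeriod_dvd, Function.IsPeriodicPt, Function.IsPeriodicPt,
      Function.IsFixedPt, Function.IsFixedPt, Equiv.Perm.iterate_eq_pow, Equiv.Perm.iterate_eq_pow]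
    have := perm_zpow_pos_zero hx m
    rw [zpow_natCast, zpow_natCast] at this
    have hm := vertexPerm_zpow_mem hx m
    rw [zpow_natCast] at hm
    rw [← pos_zero_inj hm hx, ← this]
  exact Nat.dvd_antisymm ((key _).2 dvd_rfl) ((key _).1 dvd_rfl)

theorem valence_pos_of_pos {x : α} (hx : x ∈ P.letters) {t : ℝ} (h0 : 0 < t) (h1 : t < P.len x) :
    P.cylinderGluing.valence (P.pos x t) = 2 :=
  CylinderGluing.valence_eq_two (G := P.cylinderGluing) (perm_perm_pos hx h0 h1)
    (perm_pos_ne hx h0 h1)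

/-- Corresponding points of the sides `x` and `ι x` are identified. -/
theorem sameCycle_pos_ι {x : α} (hx : x ∈ P.letters) {t : ℝ} (h0 : 0 ≤ t) (h1 : t ≤ P.len x) :
    P.perm.SameCycle (P.pos x t) (P.pos (P.ι x) (P.len x - t)) := by
  rcases h1.eq_or_lt with rfl | h1
  · rw [sub_self, pos_len hx]
    refine ⟨-1, ?_⟩
    rw [zpow_neg_one, Equiv.Perm.inv_eq_iff_eq, perm_pos_zero (ι_mem_letters hx), P.ι_ι]
  refine ⟨1, ?_⟩
  rw [zpow_one]
  rcases h0.eq_or_lt with h | h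
  · rw [← h, perm_pos_zero hx, sub_zero, ← P.len_ι x, pos_len (ι_mem_letters hx)]
  · exact perm_pos_of_pos hx h h1

end WordGluing

/-! ## Suspensions of labelled words -/

theorem TwoLines.vertex_zero (ζ : ℕ → ℂ) (l : List ℕ) : vertex ζ l 0 = 0 := by simp [vertex]

theorem Equiv.Perm.SameCycle.rel_of_rel_apply {β : Type*} {σ : Equiv.Perm β} {r : β → β → Prop}
    (hr : Equivalence r) (h : ∀ b, r b (σ b)) {b b' : β} (hb : σ.SameCycle b b') : r b b' := by
  obtain ⟨n, rfl⟩ := hb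
  induction n using Int.induction_on with
  | zero => exact hr.refl b
  | succ n ih =>
    rw [add_comm, zpow_add, zpow_one, Equiv.Perm.mul_apply]
    exact hr.trans ih (h _)
  | pred n ih =>
    rw [sub_eq_neg_add, zpow_add, zpow_neg_one, Equiv.Perm.mul_apply]
    refine hr.trans ih (hr.symm ?_)
    have := h (σ⁻¹ ((σ ^ (-(n : ℤ))) b))
    rwa [← Equiv.Perm.mul_apply σ, mul_inv_cancel, Equiv.Perm.one_apply] at this

/-- The lines `π` with the side vectors `ζ` spell out the words of `P`: the letter `x` has the
symbol `sym x`, and `a₀` is the symbol of the transverse side. -/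
structure IsSpelling {α : Type} [DecidableEq α] (π : TwoLines) (ζ : ℕ → ℂ) (P : WordGluing α)
    (sym : α → ℕ) (a₀ : ℕ) : Prop where
  top_eq : π.top = a₀ :: (P.word true).reverse.map sym
  bottom_eq : π.bottom = (P.word false).map sym ++ [a₀]
  sym_eq_iff : ∀ x ∈ P.letters, ∀ y ∈ P.letters, sym x = sym y ↔ y = x ∨ y = P.ι x
  sym_ne : ∀ x ∈ P.letters, sym x ≠ a₀
  vector_eq : ∀ x ∈ P.letters, ζ (sym x) = P.len x
  vector_transverse : ζ a₀ = P.τ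

namespace WordGluing

variable {α : Type} [DecidableEq α] (P : WordGluing α)

/-- The point of the boundary of the parallelogram at distance `t` from the starting point of the
side `x`. -/
noncomputable def sidePoint (x : α) (t : ℝ) : ℂ :=
  if P.side x then P.τ + P.width - ((P.start x + t : ℝ) : ℂ) else ((P.start x + t : ℝ) : ℂ)

variable {P}

theorem proj_sidePoint (x : α) (t : ℝ) :
    P.cylinderGluing.proj (P.sidePoint x t) = P.cylinderGluing.germ (P.pos x t) 0 := by
  rw [pos]
  refine Eq.trans ?_ (CylinderGluing.germ_coe (G := P.cylinderGluing) _ _ _).symm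
  rw [add_zero, sidePoint, CylinderGluing.flip]
  split_ifs
  · rw [add_sub_right_comm]
    exact CylinderGluing.proj_add_width (G := P.cylinderGluing) _
  · rfl

theorem proj_sidePoint_ι {x : α} (hx : x ∈ P.letters) {t : ℝ} (h0 : 0 ≤ t) (h1 : t ≤ P.len x) :
    P.cylinderGluing.proj (P.sidePoint x t) =
      P.cylinderGluing.proj (P.sidePoint (P.ι x) (P.len x - t)) := by
  rw [proj_sidePoint, proj_sidePoint]
  exact P.cylinderGluing.germ_zero_eq_iff.2 (sameCycle_pos_ι hx h0 h1)

end WordGluing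

namespace IsSpelling

variable {α : Type} [DecidableEq α] {π : TwoLines} {ζ : ℕ → ℂ} {P : WordGluing α} {sym : α → ℕ}
  {a₀ : ℕ} (h : IsSpelling π ζ P sym a₀)
include h

theorem sum_map_vector {l : List α} (hl : ∀ x ∈ l, x ∈ P.letters) :
    ((l.map sym).map ζ).sum = (((l.map P.len).sum : ℝ) : ℂ) := by
  induction l with
  | nil => simp
  | cons x l ih =>
    have := ih fun y hy => hl y (by simp [hy])
    simp only [List.map_cons, List.sum_cons, Complex.ofReal_add]
    rw [this, h.vector_eq x (hl x (by simp))]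

theorem vertex_top_succ (i : ℕ) : TwoLines.vertex ζ π.top (i + 1) =
    P.τ + (((((P.word true).reverse.take i).map P.len).sum : ℝ) : ℂ) := by
  rw [TwoLines.vertex, h.top_eq, List.take_succ_cons, List.map_cons, List.sum_cons,
    h.vector_transverse, ← List.map_take, h.sum_map_vector]
  intro x hx
  exact WordGluing.mem_letters_of_mem (List.mem_reverse.1 (List.mem_of_mem_take hx))

theorem vertex_bottom_of_le {i : ℕ} (hi : i ≤ (P.word false).length) :
    TwoLines.vertex ζ π.bottom i = (((((P.word false).take i).map P.len).sum : ℝ) : ℂ) := by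
  rw [TwoLines.vertex, h.bottom_eq, List.take_append_of_le_length (by simpa using hi),
    ← List.map_take, h.sum_map_vector]
  intro x hx
  exact WordGluing.mem_letters_of_mem (List.mem_of_mem_take hx)

theorem vertex_bottom_of_lt {i : ℕ} (hi : (P.word false).length < i) :
    TwoLines.vertex ζ π.bottom i = P.width + P.τ := by
  rw [TwoLines.vertex, h.bottom_eq, List.take_of_length_le (by simpa using hi), List.map_append,
    List.sum_append, h.sum_map_vector fun x hx => WordGluing.mem_letters_of_mem hx]
  simp [h.vector_transverse, WordGluing.width]

/-- The sides of the top line. -/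
theorem top_cases {i a : ℕ} (hi : π.top[i]? = some a) : (i = 0 ∧ a = a₀) ∨
    ∃ i', i = i' + 1 ∧ ∃ x, (P.word true).reverse[i']? = some x ∧ a = sym x := by
  rw [h.top_eq] at hi
  cases i with
  | zero => left; simpa [eq_comm] using hi
  | succ i =>
    right
    rw [List.getElem?_cons_succ, List.getElem?_map, Option.map_eq_some_iff] at hi
    obtain ⟨x, hx, rfl⟩ := hi
    exact ⟨i, rfl, x, hx, rfl⟩

/-- The sides of the bottom line. -/
theorem bottom_cases {i a : ℕ} (hi : π.bottom[i]? = some a) :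
    (i = (P.word false).length ∧ a = a₀) ∨ ∃ x, (P.word false)[i]? = some x ∧ a = sym x := by
  rw [h.bottom_eq] at hi
  rcases lt_or_ge i (P.word false).length with hl | hl
  · right
    rw [List.getElem?_append_left (by simpa using hl), List.getElem?_map,
      Option.map_eq_some_iff] at hi
    obtain ⟨x, hx, rfl⟩ := hi
    exact ⟨x, hx, rfl⟩
  · left
    rw [List.getElem?_append_right (by simpa using hl), List.length_map,
      List.getElem?_singleton] at hi
    split_ifs at hi with h0
    · exact ⟨by omega, by simpa [eq_comm] using hi⟩

/-- The top boundary circle is oriented from right to left, whereas the broken line is drawn from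
left to right; this turns `s` into `1 - s`. -/
theorem sidePoint_top {i : ℕ} {x : α} (hi : (P.word true).reverse[i]? = some x) (s : ℝ) :
    TwoLines.vertex ζ π.top (i + 1) + s * ζ (sym x) = P.sidePoint x ((1 - s) * P.len x) := by
  obtain ⟨hil, hx⟩ := List.getElem?_eq_some_iff.1 hi
  have hmem : x ∈ P.word true := by rw [← hx, ← List.mem_reverse]; exact List.getElem_mem _
  have hil' : i < (P.word true).length := by simpa using hil
  have hside := WordGluing.side_eq hmem
  have hstart : P.start x +
      (((P.word true).reverse.take i).map P.len).sum + P.len x = P.width := by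
    have e1 : x = (P.word true)[(P.word true).length - 1 - i] := by
      rw [← hx, List.getElem_reverse]
    have e2 : P.start x = (((P.word true).take ((P.word true).length - 1 - i)).map P.len).sum := by
      rw [WordGluing.start, hside]
      conv_lhs => rw [e1]
      exact startIn_getElem (WordGluing.nodup_word true) _ _
    have e3 : (((P.word true).reverse.take i).map P.len).sum =
        (((P.word true).drop ((P.word true).length - i)).map P.len).sum := by
      rw [List.take_reverse, List.map_reverse, List.sum_reverse]
    have e4 : (((P.word true).take ((P.word true).length - i)).map P.len).sum =
        (((P.word true).take ((P.word true).length - 1 - i)).map P.len).sum + P.len x := by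
      have : (P.word true).length - i = (P.word true).length - 1 - i + 1 := by omega
      rw [this, List.take_succ_eq_append_getElem (by omega), List.map_append, List.sum_append,
        List.map_singleton, List.sum_singleton, ← e1]
    have e5 := WordGluing.sum_word (P := P) true
    rw [← List.take_append_drop ((P.word true).length - i) (P.word true), List.map_append,
      List.sum_append, e4, ← e3] at e5
    rw [e2]
    linarith
  rw [h.vertex_top_succ, h.vector_eq x (WordGluing.mem_letters_of_mem hmem),
    WordGluing.sidePoint, hside, if_pos rfl, ← hstart]
  push_cast; ring

theorem sidePoint_bottom {i : ℕ} {x : α} (hi : (P.word false)[i]? = some x) (s : ℝ) :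
    TwoLines.vertex ζ π.bottom i + s * ζ (sym x) = P.sidePoint x (s * P.len x) := by
  obtain ⟨hil, hx⟩ := List.getElem?_eq_some_iff.1 hi
  have hmem : x ∈ P.word false := by rw [← hx]; exact List.getElem_mem _
  have hside := WordGluing.side_eq hmem
  have hstart : P.start x = (((P.word false).take i).map P.len).sum := by
    rw [WordGluing.start, hside]
    conv_lhs => rw [← hx]
    exact startIn_getElem (WordGluing.nodup_word false) _ _
  rw [h.vertex_bottom_of_le hil.le, h.vector_eq x (WordGluing.mem_letters_of_mem hmem),
    WordGluing.sidePoint, hside, if_neg (by simp), hstart]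
  push_cast; ring

/-- In the boundary orientation a translation between the lines and a central symmetry within a line
are the same thing: both pair two sides with reversed orientation. The translation of the transverse
sides is the period of the cylinder. -/
theorem proj_eq_of_glue {z w : ℂ} (hzw : π.Glue ζ z w) :
    P.cylinderGluing.proj z = P.cylinderGluing.proj w := by
  have key : ∀ x ∈ P.letters, ∀ y ∈ P.letters, y ≠ x → sym x = sym y → ∀ s ∈ Set.Icc (0 : ℝ) 1,
      P.cylinderGluing.proj (P.sidePoint x ((1 - s) * P.len x)) =
        P.cylinderGluing.proj (P.sidePoint y (s * P.len y)) := by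
    intro x hx y hy hne hxy s hs
    obtain rfl := ((h.sym_eq_iff x hx y hy).1 hxy).resolve_left hne
    have hp := P.len_pos x hx
    rw [WordGluing.proj_sidePoint_ι hx (mul_nonneg (by linarith [hs.2]) hp.le)
      (by nlinarith [hs.1]), P.len_ι]
    congr 2; ring
  have hd := (List.nodup_append.1 P.nodup).2.2
  have hmt : ∀ {i x}, (P.word true).reverse[i]? = some x → x ∈ P.word true := fun hi =>
    List.mem_reverse.1 (List.mem_of_getElem? hi)
  have hmb : ∀ {i x}, (P.word false)[i]? = some x → x ∈ P.word false := fun hi =>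
    List.mem_of_getElem? hi
  cases hzw with
  | translation i j a s hs hi hj =>
    rcases h.top_cases hi with ⟨rfl, rfl⟩ | ⟨i, rfl, x, hx, rfl⟩
    · rcases h.bottom_cases hj with ⟨rfl, -⟩ | ⟨y, hy, hay⟩
      · rw [TwoLines.vertex_zero, h.vertex_bottom_of_le le_rfl, List.take_length, zero_add]
        rw [add_comm]
        exact (CylinderGluing.proj_add_width (G := P.cylinderGluing) _).symm
      · exact absurd hay.symm (h.sym_ne y (WordGluing.mem_letters_of_mem (hmb hy)))
    · rcases h.bottom_cases hj with ⟨rfl, ha⟩ | ⟨y, hy, hay⟩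
      · exact absurd ha (h.sym_ne x (WordGluing.mem_letters_of_mem (hmt hx)))
      · rw [h.sidePoint_top hx, hay, h.sidePoint_bottom hy]
        exact key x (WordGluing.mem_letters_of_mem (hmt hx)) y
          (WordGluing.mem_letters_of_mem (hmb hy)) (hd _ (hmb hy) _ (hmt hx)) hay s hs
  | symmetryTop i j a s hs hij hi hj =>
    rcases h.top_cases hi with ⟨rfl, rfl⟩ | ⟨i, rfl, x, hx, rfl⟩
    · rcases h.top_cases hj with ⟨rfl, -⟩ | ⟨j, rfl, y, hy, hay⟩
      · exact absurd rfl hij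
      · exact absurd hay.symm (h.sym_ne y (WordGluing.mem_letters_of_mem (hmt hy)))
    · rcases h.top_cases hj with ⟨rfl, ha⟩ | ⟨j, rfl, y, hy, hay⟩
      · exact absurd ha (h.sym_ne x (WordGluing.mem_letters_of_mem (hmt hx)))
      · have hne : y ≠ x := by
          rintro rfl
          obtain ⟨hi', hx'⟩ := List.getElem?_eq_some_iff.1 hx
          obtain ⟨hj', hy'⟩ := List.getElem?_eq_some_iff.1 hy
          have := ((List.nodup_reverse.2 (WordGluing.nodup_word (P := P) true)).getElem_inj_iff).1
            (hx'.trans hy'.symm)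
          exact hij (by rw [this])
        have := h.sidePoint_top hy (1 - s)
        push_cast at this
        rw [h.sidePoint_top hx, hay, this, sub_sub_cancel]
        exact key x (WordGluing.mem_letters_of_mem (hmt hx)) y
          (WordGluing.mem_letters_of_mem (hmt hy)) hne hay s hs
  | symmetryBottom i j a s hs hij hi hj =>
    rcases h.bottom_cases hi with ⟨rfl, rfl⟩ | ⟨x, hx, rfl⟩
    · rcases h.bottom_cases hj with ⟨rfl, -⟩ | ⟨y, hy, hay⟩
      · exact absurd rfl hij
      · exact absurd hay.symm (h.sym_ne y (WordGluing.mem_letters_of_mem (hmb hy)))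
    · rcases h.bottom_cases hj with ⟨rfl, ha⟩ | ⟨y, hy, hay⟩
      · exact absurd ha (h.sym_ne x (WordGluing.mem_letters_of_mem (hmb hx)))
      · have hne : y ≠ x := by
          rintro rfl
          obtain ⟨hi', hx'⟩ := List.getElem?_eq_some_iff.1 hx
          obtain ⟨hj', hy'⟩ := List.getElem?_eq_some_iff.1 hy
          have := ((WordGluing.nodup_word (P := P) false).getElem_inj_iff).1
            (hx'.trans hy'.symm)
          exact hij this
        have := h.sidePoint_bottom hy (1 - s)
        push_cast at this
        rw [h.sidePoint_bottom hx, hay, this]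
        have := key x (WordGluing.mem_letters_of_mem (hmb hx)) y
          (WordGluing.mem_letters_of_mem (hmb hy)) hne hay (1 - s)
          ⟨by linarith [hs.2], by linarith [hs.1]⟩
        rwa [sub_sub_cancel] at this

/-- The transverse sides are identified. -/
theorem glue_transverse {s : ℝ} (hs : s ∈ Set.Icc (0 : ℝ) 1) :
    π.Glue ζ (s * P.τ) (P.width + s * P.τ) := by
  have := TwoLines.Glue.translation (π := π) (ζ := ζ) 0 (P.word false).length a₀ s hs
    (by simp [h.top_eq]) (by simp [h.bottom_eq])
  rw [TwoLines.vertex_zero, h.vertex_bottom_of_le le_rfl, List.take_length, zero_add,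
    h.vector_transverse] at this
  exact this

/-- The four cases for the lines of `x` and `ι x` correspond to the kinds of gluing: a translation
if the lines differ, a central symmetry if they agree. -/
theorem eqvGen_sidePoint_ι {x : α} (hx : x ∈ P.letters) {t : ℝ} (h0 : 0 ≤ t) (h1 : t ≤ P.len x) :
    Relation.EqvGen (π.Glue ζ) (P.sidePoint x t) (P.sidePoint (P.ι x) (P.len x - t)) := by
  have hp := P.len_pos x hx
  have hιx := WordGluing.ι_mem_letters hx
  have hsym : sym (P.ι x) = sym x := ((h.sym_eq_iff x hx _ hιx).2 (Or.inr rfl)).symm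
  have hs : t / P.len x ∈ Set.Icc (0 : ℝ) 1 := ⟨by positivity, (div_le_one hp).2 h1⟩
  have hs' : 1 - t / P.len x ∈ Set.Icc (0 : ℝ) 1 := ⟨by linarith [hs.2], by linarith [hs.1]⟩
  have ht : t / P.len x * P.len x = t := div_mul_cancel₀ _ hp.ne'
  have ht' : (1 - t / P.len x) * P.len x = P.len x - t := by rw [sub_mul, ht, one_mul]
  have htop : ∀ {i : ℕ} {y : α}, (P.word true).reverse[i]? = some y →
      π.top[i + 1]? = some (sym y) := fun hi => by simp only [h.top_eq,
        List.getElem?_cons_succ, List.getElem?_map, hi, Option.map_some]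
  have hbot : ∀ {i : ℕ} {y : α}, (P.word false)[i]? = some y →
      π.bottom[i]? = some (sym y) := fun {i y} hi => by
    have : i < (P.word false).length := (List.getElem?_eq_some_iff.1 hi).1
    rw [h.bottom_eq, List.getElem?_append_left (by simpa using this), List.getElem?_map, hi,
      Option.map_some]
  rcases WordGluing.mem_letters.1 hx with hxs | hxs <;>
    rcases WordGluing.mem_letters.1 hιx with hys | hys
  · obtain ⟨i, hi⟩ := List.mem_iff_getElem?.1 hxs
    obtain ⟨j, hj⟩ := List.mem_iff_getElem?.1 hys
    have hij : i ≠ j := fun hij => P.ι_ne x (by rw [hij, hj] at hi; exact Option.some.inj hi)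
    have := TwoLines.Glue.symmetryBottom (π := π) (ζ := ζ) i j (sym x) _ hs hij (hbot hi)
      (hsym ▸ hbot hj)
    have e2 := h.sidePoint_bottom hj (1 - t / P.len x)
    push_cast at this e2
    have e1 := h.sidePoint_bottom hi (t / P.len x)
    push_cast at e1
    rw [e1, ← hsym, e2, P.len_ι, ht, ht'] at this
    exact .rel _ _ this
  · obtain ⟨i, hi⟩ := List.mem_iff_getElem?.1 hxs
    obtain ⟨j, hj⟩ := List.mem_iff_getElem?.1 (List.mem_reverse.2 hys)
    have := TwoLines.Glue.translation (π := π) (ζ := ζ) (j + 1) i (sym x) _ hs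
      (hsym ▸ htop hj) (hbot hi)
    rw [h.sidePoint_bottom hi, ← hsym, h.sidePoint_top hj, P.len_ι, ht, ht'] at this
    exact .symm _ _ (.rel _ _ this)
  · obtain ⟨i, hi⟩ := List.mem_iff_getElem?.1 (List.mem_reverse.2 hxs)
    obtain ⟨j, hj⟩ := List.mem_iff_getElem?.1 hys
    have := TwoLines.Glue.translation (π := π) (ζ := ζ) (i + 1) j (sym x) _ hs'
      (htop hi) (hsym ▸ hbot hj)
    rw [h.sidePoint_top hi, ← hsym, h.sidePoint_bottom hj, P.len_ι, sub_sub_cancel, ht, ht'] at this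
    exact .rel _ _ this
  · obtain ⟨i, hi⟩ := List.mem_iff_getElem?.1 (List.mem_reverse.2 hxs)
    obtain ⟨j, hj⟩ := List.mem_iff_getElem?.1 (List.mem_reverse.2 hys)
    have hij : i ≠ j := fun hij => P.ι_ne x (by rw [hij, hj] at hi; exact Option.some.inj hi)
    have := TwoLines.Glue.symmetryTop (π := π) (ζ := ζ) (i + 1) (j + 1) (sym x) _ hs' (by simpa)
      (htop hi) (hsym ▸ htop hj)
    have e1 := h.sidePoint_top hi (1 - t / P.len x)
    have e2 := h.sidePoint_top hj (t / P.len x)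
    push_cast at this e1 e2
    simp only [sub_sub_cancel] at this e1
    rw [e1, ← hsym, e2, P.len_ι, ht, ht'] at this
    exact .rel _ _ this

theorem eqvGen_width {c : Bool} :
    Relation.EqvGen (π.Glue ζ) (if c then P.τ else 0) (P.width + if c then P.τ else 0) := by
  cases c
  · have := h.glue_transverse (s := 0) (by simp)
    simp only [Complex.ofReal_zero, zero_mul] at this
    exact .rel _ _ this
  · have := h.glue_transverse (s := 1) (by simp)
    simp only [Complex.ofReal_one, one_mul] at this
    exact .rel _ _ this

/-- Consecutive sides share their vertex in the plane; only at the seam do the two corners differ,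
and they are then identified by the transverse side. -/
theorem eqvGen_sidePoint_len {x : α} (hx : x ∈ P.letters) :
    Relation.EqvGen (π.Glue ζ) (P.sidePoint x (P.len x)) (P.sidePoint (P.next x) 0) := by
  have hm := WordGluing.mem_word_side hx
  have hs := WordGluing.side_next hx
  have hst : P.start (P.next x) = P.start x + P.len x ∨
      (P.start (P.next x) = 0 ∧ P.start x + P.len x = P.width) := by
    rw [WordGluing.start, hs, (WordGluing.next_mem_word hm).1, ← WordGluing.sum_word (P.side x)]
    exact startIn_formPerm (WordGluing.nodup_word _) hm
  rw [WordGluing.sidePoint, WordGluing.sidePoint, hs, add_zero]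
  rcases hst with h1 | ⟨h1, h2⟩
  · rw [h1]; exact .refl _
  · rw [h1, h2]
    have := h.eqvGen_width (c := P.side x)
    generalize P.side x = s at this ⊢
    cases s
    · simp only [Bool.false_eq_true, if_false, add_zero, Complex.ofReal_zero] at this ⊢
      exact .symm _ _ this
    · simp only [if_true, add_sub_cancel_right, Complex.ofReal_zero, sub_zero] at this ⊢
      rwa [add_comm P.τ]

/-- One step of `perm` is one pairing of sides, followed at a vertex by the passage to the next
side. -/
theorem eqvGen_of_sameCycle {b b' : Bool × AddCircle P.width} (hb : P.perm.SameCycle b b') :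
    Relation.EqvGen (π.Glue ζ) (P.sidePoint (P.edgeAt b).1 (P.edgeAt b).2)
      (P.sidePoint (P.edgeAt b').1 (P.edgeAt b').2) := by
  refine hb.rel_of_rel_apply (r := fun b b' => Relation.EqvGen (π.Glue ζ)
    (P.sidePoint (P.edgeAt b).1 (P.edgeAt b).2) (P.sidePoint (P.edgeAt b').1 (P.edgeAt b').2))
    ⟨fun _ => .refl _, fun h => .symm _ _ h, fun h h' => .trans _ _ _ h h'⟩ fun b => ?_
  have he := WordGluing.isPosition_edgeAt b
  have hp : P.edgeAt (P.perm b) = P.step (P.edgeAt b) :=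
    WordGluing.edgeAt_pos (WordGluing.isPosition_step he)
  rw [hp]
  generalize P.edgeAt b = e at he ⊢
  obtain ⟨x, t⟩ := e
  obtain ⟨hx, h0, h1⟩ := he
  by_cases ht : t = 0
  · subst ht
    simp only [WordGluing.step, if_true]
    have e1 := h.eqvGen_sidePoint_ι hx le_rfl h1.le
    have e2 := h.eqvGen_sidePoint_len (WordGluing.ι_mem_letters hx)
    rw [P.len_ι] at e2
    rw [sub_zero] at e1
    exact .trans _ _ _ e1 e2
  · simp only [WordGluing.step, ht, if_false]
    exact h.eqvGen_sidePoint_ι hx h0 h1.le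

/-- `edgeAt` represents a boundary point by a coordinate in `[0, width)`. Only the right end of the
bottom side and the left end of the top side are missed by it, and the transverse gluing moves them
to the opposite corner. -/
theorem eqvGen_boundary (c : Bool) {y : ℝ} (h0 : 0 ≤ y) (h1 : y ≤ P.width) :
    ∃ b : Bool × AddCircle P.width,
      P.cylinderGluing.proj (y + if c then P.τ else 0) = P.cylinderGluing.germ b 0 ∧
      Relation.EqvGen (π.Glue ζ) (y + if c then P.τ else 0)
        (P.sidePoint (P.edgeAt b).1 (P.edgeAt b).2) := by
  have hw := WordGluing.width_pos (P := P)
  have : Fact (0 < P.width) := ⟨hw⟩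
  have key : ∀ (c : Bool) (y' : ℝ), 0 ≤ y' → y' < P.width →
      P.sidePoint (P.edgeAt (c, (y' : AddCircle P.width))).1
        (P.edgeAt (c, (y' : AddCircle P.width))).2 = if c then P.τ + P.width - y' else y' := by
    intro c y' h0 h1
    have he := WordGluing.isPosition_edgeAt (P := P) (c, (y' : AddCircle P.width))
    have hpos := WordGluing.pos_edgeAt (P := P) (c, (y' : AddCircle P.width))
    generalize P.edgeAt (c, (y' : AddCircle P.width)) = e at he hpos ⊢
    obtain ⟨x, t⟩ := e
    obtain ⟨hx, ht0, ht1⟩ := he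
    have hs : P.side x = c := congrArg Prod.fst hpos
    have hc : ((P.start x + t : ℝ) : AddCircle P.width) = (y' : AddCircle P.width) :=
      congrArg Prod.snd hpos
    have heq : P.start x + t = y' := by
      have e1 := WordGluing.start_add_le hx
      have e3 := P.start_nonneg x
      refine (AddCircle.coe_eq_coe_iff_of_mem_Ico (a := 0) (p := P.width) ?_ ?_).1 hc <;>
        constructor <;> simp only at * <;> linarith
    rw [WordGluing.sidePoint, hs, heq]
  have hproj : ∀ (c : Bool) (y' : ℝ), P.cylinderGluing.proj (if c then P.τ + P.width - y' else y') =
      P.cylinderGluing.germ (c, (y' : AddCircle P.width)) 0 := by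
    intro c y'
    refine Eq.trans ?_ (CylinderGluing.germ_coe (G := P.cylinderGluing) _ _ _).symm
    rw [add_zero, CylinderGluing.flip]
    split_ifs
    · rw [add_sub_right_comm]
      exact CylinderGluing.proj_add_width (G := P.cylinderGluing) _
    · rfl
  cases c
  · rcases h1.eq_or_lt with rfl | h1
    · refine ⟨(false, ((0 : ℝ) : AddCircle P.width)), ?_, ?_⟩
      · refine Eq.trans ?_ (hproj _ _)
        have := CylinderGluing.proj_add_width (G := P.cylinderGluing) 0
        rw [zero_add] at this
        simp only [Bool.false_eq_true, if_false, add_zero, Complex.ofReal_zero]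
        exact this
      · rw [key _ _ le_rfl hw]
        have := h.eqvGen_width (c := false)
        simp only [Bool.false_eq_true, if_false, add_zero, Complex.ofReal_zero] at this ⊢
        exact .symm _ _ this
    · refine ⟨(false, (y : AddCircle P.width)), ?_, ?_⟩
      · refine Eq.trans ?_ (hproj _ _)
        simp
      · rw [key _ _ h0 h1]; simp only [Bool.false_eq_true, if_false, add_zero]; exact .refl _
  · rcases h0.eq_or_lt with rfl | h0
    · refine ⟨(true, ((0 : ℝ) : AddCircle P.width)), ?_, ?_⟩
      · refine Eq.trans ?_ (hproj _ _)
        simp only [if_true, Complex.ofReal_zero, zero_add, sub_zero]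
        exact (CylinderGluing.proj_add_width (G := P.cylinderGluing) P.τ).symm
      · rw [key _ _ le_rfl hw]
        have := h.eqvGen_width (c := true)
        simp only [if_true, Complex.ofReal_zero, zero_add, sub_zero] at this ⊢
        rwa [add_comm P.τ]
    · have e : P.τ + P.width - ((P.width - y : ℝ) : ℂ) = y + P.τ := by push_cast; ring
      refine ⟨(true, ((P.width - y : ℝ) : AddCircle P.width)), ?_, ?_⟩
      · refine Eq.trans ?_ (hproj _ _)
        simp only [if_true]; rw [e]
      · rw [key _ _ (by linarith) (by linarith)]; simp only [if_true]; rw [e]; exact .refl _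

/-- All vertices of the broken lines lie in the convex set on the right, and its four corners are
among these vertices. -/
theorem parallelogram_eq : π.parallelogram ζ =
    {z | ∃ c ∈ Set.Icc (0 : ℝ) 1, ∃ y ∈ Set.Icc (0 : ℝ) P.width, z = y + c * P.τ} := by
  have hw := WordGluing.width_pos (P := P)
  have hsum : ∀ (s : Bool) (l l' : List α), l ++ l' = P.word s ∨ l ++ l' = (P.word s).reverse →
      (l.map P.len).sum ∈ Set.Icc 0 P.width := by
    intro s l l' hl
    have hmem : ∀ x ∈ l ++ l', x ∈ P.word s := by
      rcases hl with hl | hl <;> rw [hl] <;> simp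
    have htot : ((l ++ l').map P.len).sum = P.width := by
      rcases hl with hl | hl <;> rw [hl]
      · exact WordGluing.sum_word s
      · rw [List.map_reverse, List.sum_reverse]; exact WordGluing.sum_word s
    have hnn : ∀ l'' : List α, (∀ x ∈ l'', x ∈ P.word s) → 0 ≤ (l''.map P.len).sum := by
      intro l'' hl''
      refine List.sum_nonneg fun y hy => ?_
      obtain ⟨x, hx, rfl⟩ := List.mem_map.1 hy
      exact (WordGluing.len_pos_of_mem_word x (hl'' x hx)).le
    rw [List.map_append, List.sum_append] at htot
    have e1 := hnn l fun x hx => hmem x (by simp [hx])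
    have e2 := hnn l' fun x hx => hmem x (by simp [hx])
    exact ⟨e1, by linarith⟩
  apply Set.Subset.antisymm
  · refine convexHull_min ?_ ?_
    · rintro _ (⟨i, rfl⟩ | ⟨i, rfl⟩)
      · cases i with
        | zero => exact ⟨0, by simp, 0, by simp [hw.le], by simp [TwoLines.vertex_zero]⟩
        | succ i =>
          refine ⟨1, by simp, _, hsum true _ _ (Or.inr (List.take_append_drop i _)), ?_⟩
          rw [h.vertex_top_succ]; simp [add_comm]
      · rcases le_or_gt i (P.word false).length with hi | hi
        · refine ⟨0, by simp, _, hsum false _ _ (Or.inl (List.take_append_drop i _)), ?_⟩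
          rw [h.vertex_bottom_of_le hi]; simp
        · exact ⟨1, by simp, P.width, by simp [hw.le], by simp [h.vertex_bottom_of_lt hi]⟩
    · rintro _ ⟨c, hc, y, hy, rfl⟩ _ ⟨c', hc', y', hy', rfl⟩ a b ha hb hab
      refine ⟨_, convex_Icc 0 1 hc hc' ha hb hab, _, convex_Icc 0 P.width hy hy' ha hb hab, ?_⟩
      simp only [Complex.real_smul, smul_eq_mul]
      push_cast; ring
  · have hv : ∀ c : Bool, ∀ e : Bool, ((if e then (P.width : ℂ) else 0) + if c then P.τ else 0) ∈
        π.parallelogram ζ := by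
      intro c e
      refine subset_convexHull ℝ _ ?_
      cases c <;> cases e
      · exact Or.inl ⟨0, by simp [TwoLines.vertex_zero]⟩
      · refine Or.inr ⟨(P.word false).length, ?_⟩
        rw [h.vertex_bottom_of_le le_rfl, List.take_length]; simp [WordGluing.width]
      · exact Or.inl ⟨1, by rw [h.vertex_top_succ]; simp⟩
      · refine Or.inr ⟨(P.word false).length + 1, ?_⟩
        rw [h.vertex_bottom_of_lt (by simp)]; simp
    have hconv : Convex ℝ (π.parallelogram ζ) := convex_convexHull ℝ _
    rintro _ ⟨c, hc, y, hy, rfl⟩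
    have hcv : ∀ e : Bool, ((if e then (P.width : ℂ) else 0) + c * P.τ) ∈ π.parallelogram ζ := by
      intro e
      have := hconv (hv false e) (hv true e) (a := 1 - c) (b := c) (by linarith [hc.2]) hc.1 (by ring)
      convert this using 1
      simp only [Complex.real_smul, Bool.false_eq_true, if_false, if_true]
      push_cast; ring
    have hd : 0 ≤ y / P.width := div_nonneg hy.1 hw.le
    have hd' : y / P.width ≤ 1 := (div_le_one hw).2 hy.2
    have := hconv (hcv false) (hcv true) (a := 1 - y / P.width) (b := y / P.width) (by linarith)
      hd (by ring)
    convert this using 1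
    simp only [Complex.real_smul, Bool.false_eq_true, if_false, if_true]
    have hw' : (P.width : ℂ) ≠ 0 := by exact_mod_cast hw.ne'
    push_cast
    field_simp
    ring

/-- At an inner height, equal projections force equal heights and real parts differing by a multiple
of the width, so the points coincide or are opposite points of the transverse sides. At the extreme
heights the points are compared through a cycle of `perm`. -/
theorem eqvGen_of_proj_eq {z w : ℂ} (hz : z ∈ π.parallelogram ζ) (hw : w ∈ π.parallelogram ζ)
    (hzw : P.cylinderGluing.proj z = P.cylinderGluing.proj w) :
    Relation.EqvGen (π.Glue ζ) z w := by
  rw [h.parallelogram_eq] at hz hw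
  obtain ⟨c, hc, y, hy, rfl⟩ := hz
  obtain ⟨c', hc', y', hy', rfl⟩ := hw
  have hτ := P.im_pos
  have hint : ∀ (c y : ℝ), 0 < c → c < 1 →
      0 < ((y : ℂ) + c * P.τ).im ∧ ((y : ℂ) + c * P.τ).im < P.cylinderGluing.τ.im := by
    intro c y h0 h1
    have : ((y : ℂ) + c * P.τ).im = c * P.τ.im := by simp
    rw [this]
    exact ⟨mul_pos h0 hτ, (mul_lt_iff_lt_one_left hτ).2 h1⟩
  have hb : ∀ c : ℝ, c ∈ Set.Icc (0 : ℝ) 1 → ¬ (0 < c ∧ c < 1) → ∃ e : Bool,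
      (c : ℂ) * P.τ = if e then P.τ else 0 := by
    intro c hc hn
    rcases hc.1.eq_or_lt with h0 | h0
    · exact ⟨false, by simp [← h0]⟩
    · have : c = 1 := le_antisymm hc.2 (not_lt.1 fun h1 => hn ⟨h0, h1⟩)
      exact ⟨true, by simp [this]⟩
  have key : ∀ (c y c' y' : ℝ), c ∈ Set.Icc (0 : ℝ) 1 → y ∈ Set.Icc (0 : ℝ) P.width →
      y' ∈ Set.Icc (0 : ℝ) P.width → 0 < c → c < 1 →
      P.cylinderGluing.proj (y' + c' * P.τ) = P.cylinderGluing.proj (y + c * P.τ) →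
      Relation.EqvGen (π.Glue ζ) (y' + c' * P.τ) (y + c * P.τ) := by
    intro c y c' y' hc hy hy' h0 h1 hp
    obtain ⟨h2, h3⟩ := (CylinderGluing.proj_eq_iff_of_interior (hint c y h0 h1).1
      (hint c y h0 h1).2).1 hp
    have hcc : c' = c := by
      have : c' * P.τ.im = c * P.τ.im := by simpa using h2
      exact mul_right_cancel₀ hτ.ne' this
    subst hcc
    have h4 : ((y' - y : ℝ) : AddCircle P.cylinderGluing.width) = 0 := by
      have e : ∀ r : ℝ, ((r : ℂ) + c' * P.τ).re = r + c' * P.τ.re := fun r => by simp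
      rw [e, e, ← sub_eq_zero, ← AddCircle.coe_sub, add_sub_add_right_eq_sub] at h3
      exact h3
    by_cases h5 : |y' - y| < P.width
    · have := CylinderGluing.coe_eq_zero_of_abs_lt (G := P.cylinderGluing) h5 h4
      rw [sub_eq_zero.1 this]
      exact .refl _
    · have hgl := h.glue_transverse hc
      rw [not_lt, le_abs] at h5
      rcases h5 with h5 | h5
      · have e1 : y' = P.width := by linarith [hy'.2, hy.1]
        have e2 : y = 0 := by linarith [hy'.2, hy.1]
        rw [e1, e2, Complex.ofReal_zero, zero_add]
        exact .symm _ _ (.rel _ _ hgl)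
      · have e1 : y = P.width := by linarith [hy.2, hy'.1]
        have e2 : y' = 0 := by linarith [hy.2, hy'.1]
        rw [e1, e2, Complex.ofReal_zero, zero_add]
        exact .rel _ _ hgl
  by_cases h1 : 0 < c ∧ c < 1
  · exact .symm _ _ (key c y c' y' hc hy hy' h1.1 h1.2 hzw.symm)
  by_cases h2 : 0 < c' ∧ c' < 1
  · exact key c' y' c y hc' hy' hy h2.1 h2.2 hzw
  obtain ⟨e, he⟩ := hb c hc h1
  obtain ⟨e', he'⟩ := hb c' hc' h2
  rw [he, he'] at hzw ⊢
  obtain ⟨b, hb1, hb2⟩ := h.eqvGen_boundary e hy.1 hy.2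
  obtain ⟨b', hb1', hb2'⟩ := h.eqvGen_boundary e' hy'.1 hy'.2
  rw [hb1, hb1'] at hzw
  exact .trans _ _ _ hb2 (.trans _ _ _
    (h.eqvGen_of_sameCycle (P.cylinderGluing.germ_zero_eq_iff.1 hzw)) (.symm _ _ hb2'))

/-- The surface glued from the cylinder is the suspension. -/
theorem isSuspension :
    π.IsSuspension ζ P.cylinderGluing.quadraticSurface P.cylinderGluing.proj := by
  have hτ := P.im_pos
  have hw := WordGluing.width_pos (P := P)
  refine ⟨P.cylinderGluing.continuous_proj.continuousOn, ?_, fun z hz w hw => ⟨fun hzw =>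
    h.eqvGen_of_proj_eq hz hw hzw, fun hzw => ?_⟩, fun z hz c hc hzc => ?_⟩
  · refine Set.eq_univ_of_forall fun x => ?_
    obtain ⟨z, rfl⟩ := P.cylinderGluing.surjective_proj x
    obtain ⟨h0, h1⟩ := P.cylinderGluing.im_clamp_mem z
    have h1 : (P.cylinderGluing.clamp z).im ≤ P.τ.im := h1
    have : Fact (0 < P.width) := ⟨hw⟩
    set v := P.cylinderGluing.clamp z with hv
    -- The height determines the multiple of `τ`; the remaining horizontal part may be reduced
    -- modulo the width.
    set c := v.im / P.τ.im with hc
    obtain ⟨y, hy0, hy1, hyc⟩ : ∃ y : ℝ, 0 ≤ y ∧ y < P.width ∧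
        (y : AddCircle P.width) = ((v.re - c * P.τ.re : ℝ) : AddCircle P.width) :=
      ⟨AddCircle.equivIco P.width 0 _, (AddCircle.equivIco P.width 0 _).2.1,
        by simpa using (AddCircle.equivIco P.width 0 _).2.2,
        (AddCircle.equivIco P.width 0).symm_apply_apply _⟩
    refine ⟨y + c * P.τ, ?_, ?_⟩
    · rw [h.parallelogram_eq]
      exact ⟨c, ⟨div_nonneg h0 hτ.le, (div_le_one hτ).2 h1⟩, y, ⟨hy0, hy1.le⟩, rfl⟩
    · rw [← P.cylinderGluing.proj_clamp z, ← hv]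
      apply CylinderGluing.proj_eq_of_re
      · simp [hc, hτ.ne']
      · have : ((y : ℂ) + c * P.τ).re = y + c * P.τ.re := by simp
        rw [this]
        have hre : ((y + c * P.τ.re : ℝ) : AddCircle P.width) = (v.re : AddCircle P.width) := by
          rw [AddCircle.coe_add, hyc, ← AddCircle.coe_add, sub_add_cancel]
        exact hre
  · clear hz hw
    induction hzw with
    | rel _ _ h1 => exact h.proj_eq_of_glue h1
    | refl => rfl
    | symm _ _ _ ih => exact ih.symm
    | trans _ _ _ _ _ ih ih' => exact ih.trans ih'
  · have hsub0 : π.parallelogram ζ ⊆ {v | 0 ≤ v.im} := by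
      rw [h.parallelogram_eq]
      rintro _ ⟨c, hc, y, -, rfl⟩
      have : ((y : ℂ) + c * P.τ).im = c * P.τ.im := by simp
      exact (mul_nonneg hc.1 hτ.le).trans_eq this.symm
    have hsub1 : π.parallelogram ζ ⊆ {v | v.im ≤ P.τ.im} := by
      rw [h.parallelogram_eq]
      rintro _ ⟨c, hc, y, -, rfl⟩
      have : ((y : ℂ) + c * P.τ).im = c * P.τ.im := by simp
      exact this.trans_le (mul_le_of_le_one_left hτ.le hc.2)
    have h0 := interior_mono hsub0 hz
    have h1 := interior_mono hsub1 hz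
    rw [Complex.interior_setOfPred_le_im] at h0
    rw [Complex.interior_setOfPred_im_le] at h1
    exact P.cylinderGluing.differentiableAt_chart_proj h0 h1 hc hzc

end IsSpelling

/-! ## The combinatorics of the genus one words -/

/-- The sides in the words of genus one. The Boolean distinguishes the two occurrences of a
symbol. -/
inductive GenusOneSide where
  | one (o : Bool)
  | even (k : ℕ) (o : Bool)
  | spike (k : ℕ) (o : Bool)
  | cap (o : Bool)
  deriving DecidableEq

namespace GenusOneSide

/-- The other occurrence of the same symbol. -/
def flip : GenusOneSide → GenusOneSide
  | one o => one !o
  | even k o => even k !o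
  | spike k o => spike k !o
  | cap o => cap !o

theorem flip_flip (x : GenusOneSide) : x.flip.flip = x := by cases x <;> simp [flip]

theorem flip_ne (x : GenusOneSide) : x.flip ≠ x := by cases x <;> simp [flip]

/-- `flip` as a permutation. -/
def flipPerm : Equiv.Perm GenusOneSide := ⟨flip, flip, flip_flip, flip_flip⟩

/-- The symbol of a side. -/
def symbol (m : ℕ) : GenusOneSide → ℕ
  | one _ => 1
  | even k _ => 2 * k + 2
  | spike k _ => 2 * k + 3
  | cap _ => 2 * (m + 1)

variable (e : ℕ → Bool)

/-- The part of the top line belonging to the index `k`. -/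
def topSegment (k : ℕ) : List GenusOneSide :=
  (if e k then [] else [even k false]) ++ [spike k false, spike k true]

/-- The top line, from left to right and without the transverse side; `e` tells which even sides are
erased. -/
def topWord (m : ℕ) : List GenusOneSide := one false :: (List.range m).flatMap (topSegment e)

/-- The even sides of the bottom line. -/
def evenWord (m : ℕ) : List GenusOneSide :=
  (List.range m).flatMap fun k => if e k then [] else [even k true]

/-- The bottom line, from left to right and without the transverse side. -/
def bottomWord (m : ℕ) : List GenusOneSide := evenWord e m ++ [one true, cap false, cap true]

/-- The number of even sides with index less than `k`. -/
def group : ℕ → ℕ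
  | 0 => 0
  | k + 1 => group k + if e k then 0 else 1

/-- The vertex at the left end of a side: a vertex of the graph obtained by gluing the boundary of
the cylinder, either on its circle (`inl`) or the end of one of its hairs (`inr`). -/
def left (m : ℕ) : GenusOneSide → ℕ ⊕ ℕ
  | one _ => .inl (group e m)
  | even k _ => .inl (group e k)
  | spike k o => if o then .inr k else .inl (group e (k + 1))
  | cap o => if o then .inr m else .inl 0

/-- The vertex at the right end of a side. -/
def right (m : ℕ) : GenusOneSide → ℕ ⊕ ℕ
  | one _ => .inl 0
  | even k _ => .inl (group e (k + 1))
  | spike k o => if o then .inl (group e (k + 1)) else .inr k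
  | cap o => if o then .inl 0 else .inr m

/-- Whether a side belongs to the top line. -/
def isTop : GenusOneSide → Bool
  | one o => !o
  | even _ o => !o
  | spike _ _ => true
  | cap _ => false

/-- The vertex from which a side starts in the boundary orientation. -/
def source (m : ℕ) (x : GenusOneSide) : ℕ ⊕ ℕ := if x.isTop then right e m x else left e m x

/-- The vertex at which a side ends in the boundary orientation. -/
def target (m : ℕ) (x : GenusOneSide) : ℕ ⊕ ℕ := if x.isTop then left e m x else right e m x

variable {e} {m : ℕ}

/-- The two occurrences of a symbol are glued with reversed boundary orientation. Together with
`source_next` this makes `source` invariant under `vertexPerm`. -/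
theorem target_flip (x : GenusOneSide) : target e m x.flip = source e m x := by
  rcases x with o | ⟨k, o⟩ | ⟨k, o⟩ | o <;> cases o <;> rfl

theorem topWord_succ : topWord e (m + 1) = topWord e m ++ topSegment e m := by
  simp [topWord, List.range_succ, List.flatMap_append]

theorem evenWord_succ :
    evenWord e (m + 1) = evenWord e m ++ if e m then [] else [even m true] := by
  simp [evenWord, List.range_succ, List.flatMap_append]

theorem mem_topWord {x : GenusOneSide} : x ∈ topWord e m ↔ x = one false ∨
    ∃ k < m, (e k = false ∧ x = even k false) ∨ x = spike k false ∨ x = spike k true := by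
  simp only [topWord, topSegment, List.mem_cons, List.mem_flatMap, List.mem_range, List.mem_append]
  refine or_congr Iff.rfl (exists_congr fun k => and_congr Iff.rfl ?_)
  cases e k <;> simp

theorem mem_evenWord {x : GenusOneSide} :
    x ∈ evenWord e m ↔ ∃ k < m, e k = false ∧ x = even k true := by
  simp only [evenWord, List.mem_flatMap, List.mem_range]
  refine exists_congr fun k => and_congr Iff.rfl ?_
  cases e k <;> simp

theorem mem_bottomWord {x : GenusOneSide} : x ∈ bottomWord e m ↔
    (∃ k < m, e k = false ∧ x = even k true) ∨ x = one true ∨ x = cap false ∨ x = cap true := by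
  simp [bottomWord, mem_evenWord]

theorem isTop_of_mem_topWord {x : GenusOneSide} (hx : x ∈ topWord e m) : x.isTop = true := by
  rcases mem_topWord.1 hx with rfl | ⟨k, -, ⟨-, rfl⟩ | rfl | rfl⟩ <;> rfl

theorem isTop_of_mem_bottomWord {x : GenusOneSide} (hx : x ∈ bottomWord e m) : x.isTop = false := by
  rcases mem_bottomWord.1 hx with ⟨k, -, -, rfl⟩ | rfl | rfl | rfl <;> rfl

theorem nodup_topWord : (topWord e m).Nodup := by
  induction m with
  | zero => simp [topWord]
  | succ m ih =>
    rw [topWord_succ, List.nodup_append]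
    refine ⟨ih, ?_, ?_⟩
    · rw [topSegment]; cases e m <;> simp
    · rintro x hx y hy rfl
      have hy' : x = even m false ∨ x = spike m false ∨ x = spike m true := by
        rw [topSegment] at hy; cases h : e m <;> simp [h] at hy <;> tauto
      rcases mem_topWord.1 hx with rfl | ⟨k, hk, ⟨-, rfl⟩ | rfl | rfl⟩ <;> simp at hy' <;> omega

theorem nodup_bottomWord : (bottomWord e m).Nodup := by
  have h : (evenWord e m).Nodup := by
    induction m with
    | zero => simp [evenWord]
    | succ m ih =>
      rw [evenWord_succ, List.nodup_append]
      refine ⟨ih, by cases e m <;> simp, ?_⟩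
      rintro x hx y hy rfl
      obtain ⟨k, hk, -, rfl⟩ := mem_evenWord.1 hx
      cases h : e m <;> simp [h] at hy
      omega
  rw [bottomWord, List.nodup_append]
  refine ⟨h, by simp, ?_⟩
  rintro x hx y hy rfl
  obtain ⟨k, hk, -, rfl⟩ := mem_evenWord.1 hx
  simp at hy

theorem nodup_words : (bottomWord e m ++ (topWord e m).reverse).Nodup := by
  rw [List.nodup_append]
  refine ⟨nodup_bottomWord, List.nodup_reverse.2 nodup_topWord, ?_⟩
  rintro x hx y hy rfl
  have h1 := isTop_of_mem_bottomWord hx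
  have h2 := isTop_of_mem_topWord (List.mem_reverse.1 hy)
  rw [h1] at h2
  exact absurd h2 (by simp)

theorem mem_words {x : GenusOneSide} : x ∈ bottomWord e m ++ (topWord e m).reverse ↔
    (∃ o, x = one o) ∨ (∃ k o, k < m ∧ e k = false ∧ x = even k o) ∨
      (∃ k o, k < m ∧ x = spike k o) ∨ ∃ o, x = cap o := by
  rw [List.mem_append, List.mem_reverse, mem_bottomWord, mem_topWord]
  constructor
  · rintro ((⟨k, h, h', rfl⟩ | rfl | rfl | rfl) | (rfl | ⟨k, h, ⟨h', rfl⟩ | rfl | rfl⟩)) <;>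
      simp [*]
  · rintro (⟨o, rfl⟩ | ⟨k, o, h, h', rfl⟩ | ⟨k, o, h, rfl⟩ | ⟨o, rfl⟩) <;> cases o <;>
      simp [*]

theorem flip_mem_words {x : GenusOneSide} (hx : x ∈ bottomWord e m ++ (topWord e m).reverse) :
    x.flip ∈ bottomWord e m ++ (topWord e m).reverse := by
  rw [mem_words] at hx ⊢
  rcases hx with ⟨o, rfl⟩ | ⟨k, o, h, h', rfl⟩ | ⟨k, o, h, rfl⟩ | ⟨o, rfl⟩ <;> simp [flip, *]

theorem symbol_eq_iff {x y : GenusOneSide} (hx : x ∈ bottomWord e m ++ (topWord e m).reverse)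
    (hy : y ∈ bottomWord e m ++ (topWord e m).reverse) :
    symbol m x = symbol m y ↔ y = x ∨ y = x.flip := by
  rw [mem_words] at hx hy
  rcases hx with ⟨o, rfl⟩ | ⟨k, o, h, -, rfl⟩ | ⟨k, o, h, rfl⟩ | ⟨o, rfl⟩ <;>
  rcases hy with ⟨o', rfl⟩ | ⟨k', o', h', -, rfl⟩ | ⟨k', o', h', rfl⟩ | ⟨o', rfl⟩ <;>
  simp only [symbol, flip, one.injEq, even.injEq, spike.injEq, cap.injEq, reduceCtorEq, or_self,
    iff_false, true_iff] <;> cases o <;> cases o' <;>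
  (try simp only [Bool.not_false, Bool.not_true, reduceCtorEq, and_true, and_false, or_false,
    false_or, or_true]) <;> omega

/-- The side that precedes the first half of the `k`-th spike in the top line. -/
def beforeSpike (e : ℕ → Bool) : ℕ → GenusOneSide
  | 0 => if e 0 then one false else even 0 false
  | k + 1 => if e (k + 1) then spike k true else even (k + 1) false

/-- The last letter of the top line. -/
def topLast : ℕ → GenusOneSide
  | 0 => one false
  | k + 1 => spike k true

theorem getLast?_topWord : (topWord e m).getLast? = some (topLast m) := by
  cases m with
  | zero => rfl
  | succ m => rw [topWord_succ, topSegment]; simp [topLast]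

theorem right_topLast (k : ℕ) : right e m (topLast k) = .inl (group e k) := by
  cases k <;> rfl

/-- Consecutive sides share a vertex of the graph. The predecessor of each spike is recorded as
well, because the cycle through a spike has to be followed explicitly. -/
theorem isChain_topWord (n : ℕ) : (topWord e n).IsChain fun x y =>
    left e m y = right e m x ∧ ∀ k, y = spike k false → x = beforeSpike e k := by
  induction n with
  | zero => simp [topWord]
  | succ n ih =>
    rw [topWord_succ, List.isChain_append]
    refine ⟨ih, ?_, ?_⟩
    · rw [topSegment]
      cases h : e n
      · simp [left, right]
        cases n <;> simp [beforeSpike, h]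
      · simp [left, right]
    · rw [getLast?_topWord]
      intro x hx y hy
      obtain rfl : topLast n = x := by simpa using hx
      rw [right_topLast]
      rw [topSegment] at hy
      cases h : e n
      · obtain rfl : even n false = y := by simpa [h] using hy
        simp [left]
      · obtain rfl : spike n false = y := by simpa [h] using hy
        refine ⟨by simp [left, group, h], fun k hk => ?_⟩
        obtain rfl : n = k := by simpa using hk
        cases n <;> simp [beforeSpike, topLast, h]

/-- The surviving even sides form a path from the circle vertex `0` to the vertex `group e n`. If
all are erased, these are the same vertex, which is why the empty word is listed separately. -/
theorem evenWord_path (n : ℕ) :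
    ((evenWord e n).IsChain fun x y => left e m y = right e m x) ∧
    (∀ x ∈ (evenWord e n).getLast?, right e m x = .inl (group e n)) ∧
    (∀ x ∈ (evenWord e n).head?, left e m x = .inl 0) ∧
    (evenWord e n = [] → group e n = 0) := by
  induction n with
  | zero => simp [evenWord, group]
  | succ n ih =>
    obtain ⟨h1, h2, h3, h4⟩ := ih
    rw [evenWord_succ]
    cases h : e n
    · simp only [Bool.false_eq_true, if_false]
      refine ⟨?_, ?_, ?_, by simp⟩
      · rw [List.isChain_append]
        refine ⟨h1, by simp, fun x hx y hy => ?_⟩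
        obtain rfl : even n true = y := by simpa using hy
        rw [h2 x hx]; rfl
      · intro x hx
        obtain rfl : even n true = x := by simpa using hx
        rfl
      · intro x hx
        rcases hl : evenWord e n with - | ⟨a, l⟩
        · rw [hl] at hx
          obtain rfl : even n true = x := by simpa using hx
          rw [left, h4 hl]
        · rw [hl] at hx h3
          exact h3 x (by simpa using hx)
    · simp only [if_true, List.append_nil, group, h, add_zero]
      exact ⟨h1, h2, h3, h4⟩

theorem isChain_bottomWord : (bottomWord e m).IsChain fun x y =>
    left e m y = right e m x ∧ (x = one true → y = cap false) := by
  obtain ⟨h1, h2, -, -⟩ := evenWord_path (e := e) (m := m) m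
  have h3 : ∀ y ∈ evenWord e m, y ≠ one true := by
    intro y hy h
    obtain ⟨k, -, -, rfl⟩ := mem_evenWord.1 hy
    simp at h
  rw [bottomWord, List.isChain_append]
  refine ⟨?_, by simp [left, right], fun x hx y hy => ⟨?_, fun h => ?_⟩⟩
  · rw [List.isChain_iff_getElem] at h1 ⊢
    exact fun i hi => ⟨h1 i hi, fun h => absurd h (h3 _ (List.getElem_mem _))⟩
  · obtain rfl : one true = y := by simpa using hy
    rw [h2 x hx]
    simp [left]
  · exact absurd h (h3 x (List.mem_of_mem_getLast? hx))

theorem left_head_bottomWord : ∀ x ∈ (bottomWord e m).head?, left e m x = .inl 0 := by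
  obtain ⟨-, -, h3, h4⟩ := evenWord_path (e := e) (m := m) m
  intro x hx
  rw [bottomWord] at hx
  rcases hl : evenWord e m with - | ⟨a, l⟩
  · rw [hl] at hx
    obtain rfl : one true = x := by simpa using hx
    rw [left, h4 hl]
  · rw [hl] at hx h3
    exact h3 x (by simpa using hx)

/-- Transfers a relation between neighbours in a word to its cyclic permutation; the step from the
last letter to the first remains as the exception. -/
theorem rel_formPerm {l : List GenusOneSide} (hl : l.Nodup) {r : GenusOneSide → GenusOneSide → Prop}
    (hc : l.IsChain r) {x : GenusOneSide} (hx : x ∈ l) :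
    r x (l.formPerm x) ∨ (l.getLast? = some x ∧ l.head? = some (l.formPerm x)) := by
  obtain ⟨i, hi, rfl⟩ := List.getElem_of_mem hx
  rw [List.formPerm_apply_getElem _ hl]
  rcases Nat.lt_or_ge (i + 1) l.length with h | h
  · left
    simp only [Nat.mod_eq_of_lt h]
    exact (List.isChain_iff_getElem.1 hc) i h
  · right
    have hi' : i + 1 = l.length := by omega
    have hi'' : i = l.length - 1 := by omega
    simp only [hi', Nat.mod_self]
    refine ⟨?_, by rw [List.head?_eq_getElem?, List.getElem?_eq_getElem]⟩
    rw [List.getLast?_eq_getElem?, ← hi'', List.getElem?_eq_getElem hi]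

end GenusOneSide

/-- The gluing pattern `P` consists of the words of genus one. -/
structure IsGenusOne (P : WordGluing GenusOneSide) (e : ℕ → Bool) (m : ℕ) : Prop where
  word_false : P.word false = GenusOneSide.bottomWord e m
  word_true : P.word true = (GenusOneSide.topWord e m).reverse
  ι_eq : P.ι = GenusOneSide.flipPerm

/-! ### Cycles of the vertex permutation and their lengths -/

namespace IsGenusOne

open GenusOneSide

variable {P : WordGluing GenusOneSide} {e : ℕ → Bool} {m : ℕ} (h : IsGenusOne P e m)

include h

theorem letters_eq : P.letters = bottomWord e m ++ (topWord e m).reverse := by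
  rw [WordGluing.letters, h.word_false, h.word_true]

theorem mem_letters_iff {x : GenusOneSide} : x ∈ P.letters ↔
    (∃ o, x = one o) ∨ (∃ k o, k < m ∧ e k = false ∧ x = even k o) ∨
      (∃ k o, k < m ∧ x = spike k o) ∨ ∃ o, x = cap o := by
  rw [h.letters_eq, mem_words]

theorem mem_letters_iff_isTop {x : GenusOneSide} : x ∈ P.letters ↔
    (x.isTop = false ∧ x ∈ bottomWord e m) ∨ (x.isTop = true ∧ x ∈ topWord e m) := by
  rw [h.letters_eq, List.mem_append, List.mem_reverse]
  exact or_congr ⟨fun hx => ⟨isTop_of_mem_bottomWord hx, hx⟩, And.right⟩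
    ⟨fun hx => ⟨isTop_of_mem_topWord hx, hx⟩, And.right⟩

theorem next_bottom {x : GenusOneSide} (hx : x ∈ bottomWord e m) :
    P.next x ∈ bottomWord e m ∧ left e m (P.next x) = right e m x ∧
      (x = one true → P.next x = cap false) := by
  have hx' : x ∈ P.word false := by rwa [h.word_false]
  obtain ⟨h1, h2⟩ := P.next_mem_word hx'
  rw [h.word_false] at h1 h2
  refine ⟨h2, ?_⟩
  rw [h1]
  rcases rel_formPerm nodup_bottomWord isChain_bottomWord hx with h3 | ⟨h3, h4⟩
  · exact h3
  · obtain rfl : cap true = x := by simpa [bottomWord] using h3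
    exact ⟨left_head_bottomWord _ h4, by simp⟩

/-- The top word is stored in reverse, so the following letter is the one to the left in the line.
From the first letter `one false` one returns to the last one, where the vertices match because `1`
begins at the vertex `group e m`. -/
theorem next_top {x : GenusOneSide} (hx : x ∈ topWord e m) :
    P.next x ∈ topWord e m ∧ right e m (P.next x) = left e m x ∧
      ∀ k, x = spike k false → P.next x = beforeSpike e k := by
  have hx' : x ∈ P.word true := by rwa [h.word_true, List.mem_reverse]
  obtain ⟨h1, h2⟩ := P.next_mem_word hx'
  rw [h.word_true] at h1 h2
  rw [List.mem_reverse] at h2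
  rw [List.formPerm_reverse, Equiv.Perm.eq_inv_iff_eq] at h1
  refine ⟨h2, ?_⟩
  rcases rel_formPerm nodup_topWord (isChain_topWord m) h2 with h3 | ⟨h3, h4⟩
  · rw [h1] at h3
    exact ⟨h3.1.symm, h3.2⟩
  · rw [h1] at h4
    obtain rfl : one false = x := by simpa [topWord] using h4
    rw [getLast?_topWord, Option.some.injEq] at h3
    refine ⟨?_, by simp⟩
    rw [← h3, right_topLast, left]

theorem source_next {x : GenusOneSide} (hx : x ∈ P.letters) :
    source e m (P.next x) = target e m x := by
  rcases h.mem_letters_iff_isTop.1 hx with ⟨h0, h1⟩ | ⟨h0, h1⟩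
  · obtain ⟨h2, h3, -⟩ := h.next_bottom h1
    rw [source, target, h0, isTop_of_mem_bottomWord h2]
    exact h3
  · obtain ⟨h2, h3, -⟩ := h.next_top h1
    rw [source, target, h0, isTop_of_mem_topWord h2]
    exact h3

theorem vertexPerm_apply (x : GenusOneSide) : P.vertexPerm x = P.next x.flip := by
  rw [WordGluing.vertexPerm, h.ι_eq]; rfl

theorem flip_mem_letters {x : GenusOneSide} (hx : x ∈ P.letters) : x.flip ∈ P.letters := by
  rw [h.letters_eq] at hx ⊢
  exact flip_mem_words hx

theorem source_vertexPerm {x : GenusOneSide} (hx : x ∈ P.letters) :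
    source e m (P.vertexPerm x) = source e m x := by
  rw [h.vertexPerm_apply, h.source_next (h.flip_mem_letters hx), target_flip]

theorem source_eq_of_sameCycle {x y : GenusOneSide} (hx : x ∈ P.letters)
    (hxy : P.vertexPerm.SameCycle x y) : source e m y = source e m x := by
  obtain ⟨n, rfl⟩ := hxy
  induction n with
  | zero => rfl
  | succ n ih =>
    rw [add_comm, zpow_add, zpow_one, Equiv.Perm.mul_apply,
      h.source_vertexPerm (P.vertexPerm_zpow_mem hx _), ih]
  | pred n ih =>
    rw [← ih, ← h.source_vertexPerm (P.vertexPerm_zpow_mem hx _), ← Equiv.Perm.mul_apply,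
      ← zpow_one_add]
    congr 3
    ring

omit h in
theorem _root_.GenusOneSide.group_mono : Monotone (group e) :=
  monotone_nat_of_le_succ fun k => by rw [group]; exact Nat.le_add_right _ _

omit h in
theorem _root_.GenusOneSide.group_lt {k k' : ℕ} (hk : e k = false) (hkk' : k < k') :
    group e k < group e k' := by
  have : group e (k + 1) ≤ group e k' := group_mono hkk'
  simp only [group, hk, Bool.false_eq_true, if_false] at this
  omega

/-- A lower side other than those of the cap. -/
def _root_.GenusOneSide.IsLower (e : ℕ → Bool) (m : ℕ) (x : GenusOneSide) : Prop :=
  x = one true ∨ ∃ k < m, e k = false ∧ x = even k true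

-- The lower sides form the closed circle once, so each circle vertex is the start of at most one of
-- them. They serve as normal forms for the cycles of `vertexPerm`.
omit h in
theorem _root_.GenusOneSide.IsLower.eq_of_source_eq {x y : GenusOneSide} (hx : x.IsLower e m)
    (hy : y.IsLower e m) (hxy : source e m x = source e m y) : x = y := by
  rcases hx with rfl | ⟨k, hk, hk', rfl⟩ <;> rcases hy with rfl | ⟨l, hl, hl', rfl⟩
  · rfl
  · exact absurd (Sum.inl_injective hxy) (group_lt hl' hl).ne'
  · exact absurd (Sum.inl_injective hxy) (group_lt hk' hk).ne
  · rcases lt_trichotomy k l with hkl | rfl | hkl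
    · exact absurd (Sum.inl_injective hxy) (group_lt hk' hkl).ne
    · rfl
    · exact absurd (Sum.inl_injective hxy) (group_lt hl' hkl).ne'

/-- A single application of `vertexPerm` lands in the bottom line at the vertex `group e (k + 1)`,
which is positive since `k` survives. The sides of the cap start at the vertex `0` and at a free
end, so they are excluded. -/
theorem exists_isLower_even {k : ℕ} (hk : k < m) (hk' : e k = false) :
    ∃ y, y.IsLower e m ∧ P.vertexPerm.SameCycle (even k false) y := by
  have hx : even k false ∈ P.letters := h.mem_letters_iff.2 (by simp [hk, hk'])
  have h1 := h.source_vertexPerm hx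
  have hy : P.vertexPerm (even k false) ∈ bottomWord e m := by
    rw [h.vertexPerm_apply]
    exact (h.next_bottom (mem_bottomWord.2 (.inl ⟨k, hk, hk', rfl⟩))).1
  refine ⟨P.vertexPerm (even k false), ?_, (Equiv.Perm.SameCycle.refl _ _).apply_right⟩
  rcases mem_bottomWord.1 hy with h2 | h2 | h2 | h2
  · exact .inr h2
  · exact .inl h2
  · rw [h2] at h1
    have : 0 = group e (k + 1) := Sum.inl_injective h1
    simp [group, hk'] at this
  · rw [h2] at h1
    simp [source, right, left, isTop] at h1

theorem vertexPerm_one : P.vertexPerm (one false) = cap false := by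
  rw [h.vertexPerm_apply]
  exact (h.next_bottom (x := one true) (mem_bottomWord.2 (by simp))).2.2 rfl

theorem exists_isLower_cap : ∃ y, y.IsLower e m ∧ P.vertexPerm.SameCycle (cap false) y := by
  have hx : cap false ∈ P.letters := h.mem_letters_iff.2 (by simp)
  have h1 := h.source_vertexPerm hx
  have hy : P.vertexPerm (cap false) ∈ bottomWord e m := by
    rw [h.vertexPerm_apply]
    exact (h.next_bottom (x := cap true) (mem_bottomWord.2 (by simp))).1
  refine ⟨P.vertexPerm (cap false), ?_, (Equiv.Perm.SameCycle.refl _ _).apply_right⟩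
  rcases mem_bottomWord.1 hy with h2 | h2 | h2 | h2
  · exact .inr h2
  · exact .inl h2
  -- `cap false` is already the image of `one false`.
  · have := P.vertexPerm.injective (h2.trans h.vertexPerm_one.symm)
    simp at this
  · rw [h2] at h1
    simp [source, left, isTop] at h1

theorem exists_isLower_one : ∃ y, y.IsLower e m ∧ P.vertexPerm.SameCycle (one false) y := by
  obtain ⟨y, hy, hc⟩ := h.exists_isLower_cap
  rw [← h.vertexPerm_one, Equiv.Perm.sameCycle_apply_left] at hc
  exact ⟨y, hy, hc⟩

/-- `vertexPerm` sends the second half of a spike to the side on the left of the spike. Across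
erased even sides this descends through the spikes of one group until it reaches a surviving even
side or `one false`. -/
theorem exists_isLower_spike {k : ℕ} (hk : k < m) :
    ∃ y, y.IsLower e m ∧ P.vertexPerm.SameCycle (spike k true) y := by
  have h1 : P.vertexPerm (spike k true) = beforeSpike e k := by
    rw [h.vertexPerm_apply]
    exact (h.next_top (x := spike k false) (mem_topWord.2 (.inr ⟨k, hk, by simp⟩))).2.2 k rfl
  suffices ∃ y, y.IsLower e m ∧ P.vertexPerm.SameCycle (beforeSpike e k) y by
    rwa [← h1, funext fun y => propext (and_congr_right fun _ =>
      Equiv.Perm.sameCycle_apply_left)] at this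
  induction k with
  | zero =>
    rw [beforeSpike]
    cases h0 : e 0
    · exact h.exists_isLower_even hk h0
    · exact h.exists_isLower_one
  | succ k ih =>
    rw [beforeSpike]
    cases h0 : e (k + 1)
    · exact h.exists_isLower_even hk h0
    · have h2 : P.vertexPerm (spike k true) = beforeSpike e k := by
        rw [h.vertexPerm_apply]
        exact (h.next_top (x := spike k false)
          (mem_topWord.2 (.inr ⟨k, by omega, by simp⟩))).2.2 k rfl
      obtain ⟨y, hy, hc⟩ := ih (by omega) h2
      rw [← h2, Equiv.Perm.sameCycle_apply_left] at hc
      exact ⟨y, hy, hc⟩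

theorem exists_isLower {x : GenusOneSide} (hx : x ∈ P.letters) {i : ℕ}
    (hi : source e m x = .inl i) : ∃ y, y.IsLower e m ∧ P.vertexPerm.SameCycle x y := by
  rcases h.mem_letters_iff.1 hx with ⟨o, rfl⟩ | ⟨k, o, hk, hk', rfl⟩ | ⟨k, o, hk, rfl⟩ | ⟨o, rfl⟩ <;>
    cases o
  · exact h.exists_isLower_one
  · exact ⟨_, .inl rfl, .refl _ _⟩
  · exact h.exists_isLower_even hk hk'
  · exact ⟨_, .inr ⟨k, hk, hk', rfl⟩, .refl _ _⟩
  · simp [source, right, isTop] at hi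
  · exact h.exists_isLower_spike hk
  · exact h.exists_isLower_cap
  · simp [source, left, isTop] at hi

/-- The vertices of the glued surface are the vertices of the graph. -/
theorem sameCycle_iff {x y : GenusOneSide} (hx : x ∈ P.letters) (hy : y ∈ P.letters) :
    P.vertexPerm.SameCycle x y ↔ source e m x = source e m y := by
  refine ⟨fun hxy => (h.source_eq_of_sameCycle hx hxy).symm, fun hxy => ?_⟩
  rcases hi : source e m x with i | j
  · obtain ⟨x', hx', hxx'⟩ := h.exists_isLower hx hi
    obtain ⟨y', hy', hyy'⟩ := h.exists_isLower hy (hxy.symm.trans hi)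
    obtain rfl : x' = y' := hx'.eq_of_source_eq hy' (by
      rw [h.source_eq_of_sameCycle hx hxx', h.source_eq_of_sameCycle hy hyy', hxy])
    exact hxx'.trans hyy'.symm
  -- Only one side starts at the free end of a hair.
  · suffices x = y by rw [this]
    have hj := hxy.symm.trans hi
    rcases h.mem_letters_iff.1 hx with ⟨o, rfl⟩ | ⟨k, o, hk, hk', rfl⟩ | ⟨k, o, hk, rfl⟩ | ⟨o, rfl⟩ <;>
      cases o <;> simp [source, left, right, isTop] at hi <;>
    rcases h.mem_letters_iff.1 hy with ⟨o, rfl⟩ | ⟨l, o, hl, hl', rfl⟩ | ⟨l, o, hl, rfl⟩ | ⟨o, rfl⟩ <;>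
      cases o <;> simp [source, left, right, isTop] at hj <;> simp <;> omega

/-- By `sameCycle_iff` the orbit of `x` consists of the letters with the same source, and the period
is the size of the orbit. -/
theorem minimalPeriod_vertexPerm {x : GenusOneSide} (hx : x ∈ P.letters) :
    Function.minimalPeriod P.vertexPerm x =
      P.letters.countP fun y => source e m y = source e m x := by
  have h1 : MulAction.orbit (Subgroup.zpowers P.vertexPerm) x =
      ((P.letters.filter fun y => source e m y = source e m x).toFinset : Set GenusOneSide) := by
    ext y
    rw [MulAction.mem_orbit_iff]
    simp only [List.coe_toFinset, List.mem_filter, Set.mem_ofPred_eq, decide_eq_true_eq]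
    constructor
    · rintro ⟨⟨_, n, rfl⟩, rfl⟩
      exact ⟨P.vertexPerm_zpow_mem hx n, h.source_eq_of_sameCycle hx ⟨n, rfl⟩⟩
    · rintro ⟨hy, hxy⟩
      obtain ⟨n, rfl⟩ := (h.sameCycle_iff hx hy).2 hxy.symm
      exact ⟨⟨_, n, rfl⟩, rfl⟩
  have h2 : Nat.card (MulAction.orbit (Subgroup.zpowers P.vertexPerm) x) =
      P.letters.countP fun y => source e m y = source e m x := by
    rw [h1, Nat.card_coe_set_eq, Set.ncard_coe_finset, List.toFinset_card_of_nodup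
      (List.Nodup.filter _ (show P.letters.Nodup from P.nodup)), List.countP_eq_length_filter]
  rw [← h2]
  have : Finite (MulAction.orbit (Subgroup.zpowers P.vertexPerm) x) := by
    rw [h1]; exact Finset.finite_toSet _
  have := Fintype.ofFinite (MulAction.orbit (Subgroup.zpowers P.vertexPerm) x)
  rw [Nat.card_eq_fintype_card]
  exact MulAction.minimalPeriod_eq_card (a := P.vertexPerm) (b := x)

-- In the boundary orientation top sides start at their right ends. `one false` and the surviving
-- even sides start once at each circle vertex up to `group e n`; the other contributions come from
-- the second halves of the spikes.
omit h in
theorem _root_.GenusOneSide.countP_topWord (i n : ℕ) :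
    (topWord e n).countP (fun y => source e m y = .inl i) =
      (if i ≤ group e n then 1 else 0) + ((Finset.range n).filter fun k => group e (k + 1) = i).card := by
  induction n with
  | zero =>
    rw [Finset.range_zero, Finset.filter_empty]
    rcases i with - | i <;> simp [topWord, source, right, isTop, group]
  | succ n ih =>
    rw [topWord_succ, List.countP_append, ih, topSegment, Finset.range_add_one, Finset.filter_insert]
    have h1 : (if group e (n + 1) = i then insert n ((Finset.range n).filter fun k => group e (k + 1) = i)
        else (Finset.range n).filter fun k => group e (k + 1) = i).card =
        ((Finset.range n).filter fun k => group e (k + 1) = i).card +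
          if group e (n + 1) = i then 1 else 0 := by
      split_ifs <;> simp
    rw [h1]
    cases h0 : e n <;> simp [List.countP_cons, source, right, isTop, group, h0] <;>
      split_ifs <;> omega

-- The surviving even sides start once at each of the vertices `0, …, group e n - 1`. The indicator
-- of the last vertex is added to avoid a subtraction; for `n = m` it is the contribution of `one
-- true`.
omit h in
theorem _root_.GenusOneSide.countP_evenWord (i n : ℕ) :
    (evenWord e n).countP (fun y => source e m y = .inl i) + (if group e n = i then 1 else 0) =
      if i ≤ group e n then 1 else 0 := by
  induction n with
  | zero => rcases i with - | i <;> simp [evenWord, group]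
  | succ n ih =>
    rw [evenWord_succ, List.countP_append]
    generalize (evenWord e n).countP (fun y => source e m y = .inl i) = c at ih ⊢
    cases h0 : e n <;> simp [List.countP_cons, source, left, isTop, group, h0] <;>
      split_ifs at ih ⊢ <;> omega

/-- The number of sides starting from a vertex of the circle. -/
theorem countP_source_inl {i : ℕ} (hi : i ≤ group e m) :
    P.letters.countP (fun y => source e m y = .inl i) =
      ((Finset.range (m + 1)).filter fun k => group e k = i).card + 2 := by
  have h1 := countP_topWord (e := e) (m := m) i m
  have h2 := countP_evenWord (e := e) (m := m) i m
  -- The index `k + 1` stands for the `k`-th spike, and the index `0` for the cap, whose hair is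
  -- attached at the vertex `0`.
  have h3 : ((Finset.range (m + 1)).filter fun k => group e k = i).card =
      ((Finset.range m).filter fun k => group e (k + 1) = i).card + if 0 = i then 1 else 0 := by
    simp only [Finset.card_filter]
    rw [Finset.sum_range_succ']
    rfl
  rw [if_pos hi] at h1 h2
  rw [h.letters_eq, List.countP_append, List.countP_reverse, bottomWord, List.countP_append, h1, h3]
  generalize (evenWord e m).countP (fun y => source e m y = .inl i) = c at h2 ⊢
  simp only [List.countP_cons, List.countP_nil, source, left, isTop]
  simp
  split_ifs at h2 ⊢ <;> omega

/-- The free end of a hair has one side. -/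
theorem minimalPeriod_of_source_inr {x : GenusOneSide} (hx : x ∈ P.letters) {j : ℕ}
    (hj : source e m x = .inr j) : Function.minimalPeriod P.vertexPerm x = 1 := by
  rw [Function.minimalPeriod_eq_one_iff_isFixedPt]
  have h1 := P.vertexPerm_zpow_mem hx 1
  rw [zpow_one] at h1
  have h2 := (h.source_vertexPerm hx).trans hj
  rcases h.mem_letters_iff.1 hx with ⟨o, rfl⟩ | ⟨k, o, hk, hk', rfl⟩ | ⟨k, o, hk, rfl⟩ | ⟨o, rfl⟩ <;>
      cases o <;> simp [source, left, right, isTop] at hj <;>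
    rcases h.mem_letters_iff.1 h1 with ⟨o, hy⟩ | ⟨l, o, hl, hl', hy⟩ | ⟨l, o, hl, hy⟩ | ⟨o, hy⟩ <;>
      rw [hy] at h2 <;>
      cases o <;> simp [source, left, right, isTop] at h2 <;> rw [Function.IsFixedPt, hy] <;> simp <;> omega

end IsGenusOne

/-! ## The pattern of erased symbols -/

section Blocks

variable {n : ℕ} (d : Fin n → ℕ)

/-- Whether the symbol `2k + 2` is erased. -/
def isErased (k : ℕ) : Bool := decide (2 * k + 2 ∈ erasedSymbols d)

/-- The first index of the `i`-th block. -/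
def blockStart (i : Fin n) : ℕ := ∑ j ∈ Finset.Iio i, d j

variable {d}

theorem mem_erasedSymbols {a : ℕ} : a ∈ erasedSymbols d ↔
    ∃ i, ∃ j, 1 ≤ j ∧ j < d i ∧ a = 2 * (blockStart d i + j) := by
  simp [erasedSymbols, blockStart, eq_comm, and_assoc]

theorem blockStart_add (i : Fin n) : blockStart d i + d i = ∑ j ∈ Finset.Iic i, d j := by
  rw [blockStart, ← Finset.Iio_insert, Finset.sum_insert (by simp), add_comm]

theorem blockStart_add_le_sum (i : Fin n) : blockStart d i + d i ≤ ∑ j, d j := by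
  rw [blockStart_add]
  exact Finset.sum_le_sum_of_subset (Finset.subset_univ _)

theorem blockStart_add_le {i i' : Fin n} (h : i < i') : blockStart d i + d i ≤ blockStart d i' := by
  rw [blockStart_add]
  exact Finset.sum_le_sum_of_subset fun j hj =>
    Finset.mem_Iio.2 ((Finset.mem_Iic.1 hj).trans_lt h)

theorem block_unique {i i' : Fin n} {k : ℕ} (h1 : blockStart d i ≤ k) (h2 : k < blockStart d i + d i)
    (h1' : blockStart d i' ≤ k) (h2' : k < blockStart d i' + d i') : i = i' := by
  rcases lt_trichotomy i i' with h | h | h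
  · have := blockStart_add_le (d := d) h; omega
  · exact h
  · have := blockStart_add_le (d := d) h; omega

/-- The symbol `2k + 2` is erased exactly when `k` and `k + 1` lie in the same block. Hence `group`
increases precisely when a block ends, and it counts the completed blocks. -/
theorem exists_block (hd : ∀ i, 0 < d i) {k : ℕ} (hk : k < ∑ i, d i) :
    ∃ i : Fin n, blockStart d i ≤ k ∧ k < blockStart d i + d i ∧
      GenusOneSide.group (isErased d) k = i := by
  induction k with
  | zero =>
    have hn : 0 < n := by
      rcases n with - | n
      · simp at hk
      · omega
    have h0 : blockStart d ⟨0, hn⟩ = 0 := by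
      rw [blockStart, Finset.sum_eq_zero]
      intro j hj
      exact absurd (Finset.mem_Iio.1 hj) (by simp [Fin.lt_def])
    exact ⟨⟨0, hn⟩, h0.le, by rw [h0, zero_add]; exact hd _, rfl⟩
  | succ k ih =>
    obtain ⟨i, h1, h2, h3⟩ := ih (by omega)
    rw [GenusOneSide.group, h3]
    rcases Nat.lt_or_ge (k + 1) (blockStart d i + d i) with h | h
    · refine ⟨i, by omega, h, ?_⟩
      have : isErased d k = true := decide_eq_true
        (mem_erasedSymbols.2 ⟨i, k + 1 - blockStart d i, by omega, by omega, by omega⟩)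
      simp [this]
    · have hk' : k + 1 = blockStart d i + d i := by omega
      have hi : (i : ℕ) + 1 < n := by
        by_contra hi
        have : Finset.Iic i = Finset.univ := by
          ext j
          simp only [Finset.mem_Iic, Finset.mem_univ, iff_true, Fin.le_def]
          omega
        rw [hk', blockStart_add, this] at hk
        exact hk.false
      have h4 : blockStart d ⟨i + 1, hi⟩ = k + 1 := by
        rw [hk', blockStart_add, blockStart]
        congr 1
        ext j
        simp only [Finset.mem_Iic, Finset.mem_Iio, Fin.le_def, Fin.lt_def]
        omega
      have h5 := hd ⟨i + 1, hi⟩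
      refine ⟨⟨i + 1, hi⟩, h4.le, by omega, ?_⟩
      have : isErased d k = false := by
        refine decide_eq_false fun hE => ?_
        obtain ⟨i', j, hj, hj', h6⟩ := mem_erasedSymbols.1 hE
        obtain rfl := block_unique (d := d) (i := i') (i' := ⟨i + 1, hi⟩) (k := k + 1)
          (by omega) (by omega) h4.le (by omega)
        omega
      simp [this]

/-- This is the number of hairs at the `i`-th vertex of the circle, hence the degree of the zero
there. -/
theorem card_group_eq (hd : ∀ i, 0 < d i) (i : Fin n) :
    ((Finset.range (∑ j, d j)).filter fun k =>
      GenusOneSide.group (isErased d) k = i).card = d i := by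
  have : ((Finset.range (∑ j, d j)).filter fun k => GenusOneSide.group (isErased d) k = i) =
      Finset.Ico (blockStart d i) (blockStart d i + d i) := by
    ext k
    simp only [Finset.mem_filter, Finset.mem_range, Finset.mem_Ico]
    constructor
    · rintro ⟨hk, hki⟩
      obtain ⟨i', h1, h2, h3⟩ := exists_block hd hk
      obtain rfl : i' = i := Fin.ext (by omega)
      exact ⟨h1, h2⟩
    · rintro ⟨h1, h2⟩
      have hk := h2.trans_le (blockStart_add_le_sum i)
      obtain ⟨i', h1', h2', h3⟩ := exists_block hd hk
      obtain rfl := block_unique h1 h2 h1' h2'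
      exact ⟨hk, h3⟩
  rw [this, Nat.card_Ico]
  omega

theorem exists_group_eq (hd : ∀ i, 0 < d i) (i : Fin n) :
    ∃ k < ∑ j, d j, GenusOneSide.group (isErased d) k = i := by
  have h := card_group_eq hd i
  obtain ⟨k, hk⟩ := Finset.card_pos.1 (h.symm ▸ hd i)
  rw [Finset.mem_filter, Finset.mem_range] at hk
  exact ⟨k, hk⟩

theorem even_of_mem_erasedSymbols {a : ℕ} (ha : a ∈ erasedSymbols d) :
    a % 2 = 0 ∧ 0 < a ∧ a < 2 * ∑ j, d j := by
  obtain ⟨i, j, hj, hj', rfl⟩ := mem_erasedSymbols.1 ha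
  have := blockStart_add_le_sum (d := d) i
  omega

open GenusOneSide

theorem symbol_ne_zero (m : ℕ) (x : GenusOneSide) : symbol m x ≠ 0 := by
  cases x <;> simp [symbol]

theorem erase_top (m : ℕ) :
    ((genusOnePermutation (m + 1)).erase (erasedSymbols d)).top =
      0 :: (topWord (isErased d) m).map (symbol m) := by
  have h0 : 0 ∉ erasedSymbols d := fun h => by have := even_of_mem_erasedSymbols h; omega
  have h1 : 1 ∉ erasedSymbols d := fun h => by have := even_of_mem_erasedSymbols h; omega
  simp only [TwoLines.erase, genusOnePermutation, List.filter_append, topWord, List.map_cons,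
    List.filter_flatMap, List.map_flatMap, Nat.add_sub_cancel]
  have h2 : (List.flatMap (fun k => List.filter (fun x => decide (x ∉ erasedSymbols d))
      [2 * k + 2, 2 * k + 3, 2 * k + 3]) (List.range m)) =
      List.flatMap (fun k => (topSegment (isErased d) k).map (symbol m)) (List.range m) := by
    congr 1
    funext k
    have h3 : 2 * k + 3 ∉ erasedSymbols d := fun h => by have := even_of_mem_erasedSymbols h; omega
    by_cases h : 2 * k + 2 ∈ erasedSymbols d <;> simp [topSegment, isErased, h, h3, symbol]
  rw [h2]
  simp [h0, h1, symbol]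

theorem erase_bottom {m : ℕ} (hm : ∑ j, d j = m + 1) :
    ((genusOnePermutation (m + 1)).erase (erasedSymbols d)).bottom =
      (bottomWord (isErased d) m).map (symbol m) ++ [0] := by
  have h0 : 0 ∉ erasedSymbols d := fun h => by have := even_of_mem_erasedSymbols h; omega
  have h1 : 1 ∉ erasedSymbols d := fun h => by have := even_of_mem_erasedSymbols h; omega
  have h2 : 2 * (m + 1) ∉ erasedSymbols d := fun h => by
    have := even_of_mem_erasedSymbols h; omega
  simp only [TwoLines.erase, genusOnePermutation, List.filter_append, bottomWord, evenWord,
    List.map_append, List.map_flatMap, Nat.add_sub_cancel, List.map_eq_flatMap (l := List.range m),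
    List.filter_flatMap]
  have h4 : (List.flatMap (fun k => List.filter (fun x => decide (x ∉ erasedSymbols d))
      [2 * k + 2]) (List.range m)) =
      List.flatMap (fun k => (if isErased d k then [] else [even k true]).map (symbol m))
        (List.range m) := by
    congr 1
    funext k
    by_cases h : 2 * k + 2 ∈ erasedSymbols d <;> simp [isErased, h, symbol]
  rw [h4]
  simp [h0, h1, h2, symbol]

end Blocks

/-! ## The stratum of the suspensions -/

theorem CylinderGluing.orderAt_germ_of_valence {G : CylinderGluing} {b : G.Boundary} {k : ℕ} {j : ℤ}
    (hk : G.valence b = k) (hj : (k : ℤ) - 2 = j) :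
    G.quadraticDifferential.orderAt (G.germ b 0) = (j : WithTop ℤ) := by
  rw [G.orderAt_germ, hk, hj]

namespace IsGenusOne

open GenusOneSide

variable {P : WordGluing GenusOneSide} {m n : ℕ} {d : Fin n → ℕ}
  (h : IsGenusOne P (isErased d) m) (hd : ∀ i, 0 < d i) (hm : ∑ i, d i = m + 1)

include h in
theorem source_cases {x : GenusOneSide} (hx : x ∈ P.letters) :
    (∃ k ≤ m, source (isErased d) m x = .inl (group (isErased d) k)) ∨
      ∃ j ≤ m, source (isErased d) m x = .inr j := by
  rcases h.mem_letters_iff.1 hx with ⟨o, rfl⟩ | ⟨k, o, hk, -, rfl⟩ | ⟨k, o, hk, rfl⟩ | ⟨o, rfl⟩ <;>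
    cases o
  · exact .inl ⟨0, by omega, rfl⟩
  · exact .inl ⟨m, le_rfl, rfl⟩
  · exact .inl ⟨k + 1, hk, rfl⟩
  · exact .inl ⟨k, hk.le, rfl⟩
  · exact .inr ⟨k, hk.le, rfl⟩
  · exact .inl ⟨k + 1, hk, rfl⟩
  · exact .inl ⟨0, by omega, rfl⟩
  · exact .inr ⟨m, le_rfl, rfl⟩

include h hd hm in
theorem exists_source_eq (i : Fin n ⊕ Fin (m + 1)) : ∃ x ∈ P.letters,
    source (isErased d) m x = i.map Fin.val Fin.val := by
  rcases i with i | ⟨j, hj⟩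
  · obtain ⟨k, hk, hki⟩ := exists_group_eq hd i
    have h1 := h.countP_source_inl (i := i) (hki ▸ group_mono (by omega : k ≤ m))
    have h2 : 0 < P.letters.countP fun y => source (isErased d) m y = .inl (i : ℕ) := by omega
    obtain ⟨x, hx, hx'⟩ := List.countP_pos_iff.1 h2
    exact ⟨x, hx, by simpa using hx'⟩
  · rcases Nat.lt_or_ge j m with hjm | hjm
    · exact ⟨spike j false, h.mem_letters_iff.2 (by simp [hjm]), rfl⟩
    · obtain rfl : j = m := by omega
      exact ⟨cap true, h.mem_letters_iff.2 (by simp), rfl⟩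

include h hd hm in
theorem orderAt_of_source_inl {x : GenusOneSide} (hx : x ∈ P.letters) {i : Fin n}
    (hi : source (isErased d) m x = .inl (i : ℕ)) :
    P.cylinderGluing.quadraticDifferential.orderAt (P.cylinderGluing.germ (P.pos x 0) 0) =
      ((d i : ℤ) : WithTop ℤ) := by
  obtain ⟨k, hk, hki⟩ := exists_group_eq hd i
  refine CylinderGluing.orderAt_germ_of_valence (WordGluing.valence_pos_zero hx) ?_
  rw [h.minimalPeriod_vertexPerm hx, hi, h.countP_source_inl (hki ▸ group_mono (by omega : k ≤ m)), ← hm, card_group_eq hd i]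
  simp

include h in
theorem orderAt_of_source_inr {x : GenusOneSide} (hx : x ∈ P.letters) {j : ℕ}
    (hj : source (isErased d) m x = .inr j) :
    P.cylinderGluing.quadraticDifferential.orderAt (P.cylinderGluing.germ (P.pos x 0) 0) =
      ((-1 : ℤ) : WithTop ℤ) := by
  refine CylinderGluing.orderAt_germ_of_valence (WordGluing.valence_pos_zero hx) ?_
  rw [h.minimalPeriod_of_source_inr hx hj]
  simp

theorem _root_.WordGluing.orderAt_of_pos {α : Type} [DecidableEq α] {P : WordGluing α} {x : α}
    (hx : x ∈ P.letters) {t : ℝ} (h0 : 0 < t) (h1 : t < P.len x) :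
    P.cylinderGluing.quadraticDifferential.orderAt (P.cylinderGluing.germ (P.pos x t) 0) = 0 :=
  CylinderGluing.orderAt_germ_of_valence (WordGluing.valence_pos_of_pos hx h0 h1) (by simp)

-- One side is chosen at every vertex of the graph to name the zeroes and the poles. They are
-- distinct by `sameCycle_iff`, and all other points are interior points of the cylinder or inner
-- points of sides, where the order is zero.
include h hd hm in
theorem inStratum : P.cylinderGluing.quadraticSurface.InStratum d (m + 1) := by
  choose v hv hv' using h.exists_source_eq hd hm
  let pt : Fin n ⊕ Fin (m + 1) → P.cylinderGluing.quadraticSurface.carrier :=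
    fun i => P.cylinderGluing.germ (P.pos (v i) 0) 0
  have hpt : Sum.elim (pt ∘ Sum.inl) (pt ∘ Sum.inr) = pt := Sum.elim_comp_inl_inr pt
  have hsame : ∀ {x y}, x ∈ P.letters → y ∈ P.letters →
      (P.cylinderGluing.germ (P.pos x 0) 0 = P.cylinderGluing.germ (P.pos y 0) 0 ↔
        source (isErased d) m x = source (isErased d) m y) := fun {x y} hx hy =>
    (CylinderGluing.germ_zero_eq_iff (G := P.cylinderGluing)).trans
      ((WordGluing.sameCycle_pos_zero_iff hx hy).trans (h.sameCycle_iff hx hy))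
  have hpole : ∀ j, P.cylinderGluing.quadraticDifferential.orderAt (pt (.inr j)) =
      ((-1 : ℤ) : WithTop ℤ) := fun j => h.orderAt_of_source_inr (hv _) (hv' _)
  refine ⟨QuadraticDifferential.not_isGlobalSquare_of_orderAt (hpole 0), pt ∘ Sum.inl, pt ∘ Sum.inr,
    ?_, fun i => h.orderAt_of_source_inl hd hm (hv _) (hv' _), hpole, ?_⟩
  · rw [hpt]
    intro i j hij
    have h1 := (hsame (hv i) (hv j)).1 hij
    rw [hv', hv'] at h1
    exact Sum.map_injective.2 ⟨Fin.val_injective, Fin.val_injective⟩ h1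
  · rw [hpt]
    intro x hx
    rcases P.cylinderGluing.exists_eq_proj_or_eq_germ x with ⟨z, h0, h1, rfl⟩ | ⟨b, rfl⟩
    · exact P.cylinderGluing.orderAt_proj h0 h1
    · obtain ⟨y, hy, t, h0, h1, rfl⟩ := WordGluing.exists_pos (P := P) b
      rcases h0.eq_or_lt with rfl | h0
      · refine absurd ?_ hx
        suffices ∃ i, source (isErased d) m (v i) = source (isErased d) m y by
          obtain ⟨i, hi⟩ := this
          exact ⟨i, (hsame (hv i) hy).2 hi⟩
        rcases h.source_cases hy with ⟨k, hk, hky⟩ | ⟨j, hj, hjy⟩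
        · obtain ⟨i, -, -, hi⟩ := exists_block hd (by omega : k < ∑ i, d i)
          exact ⟨.inl i, by rw [hv', hky, hi]; rfl⟩
        · exact ⟨.inr ⟨j, by omega⟩, by rw [hv', hjy]; rfl⟩
      · exact WordGluing.orderAt_of_pos hy h0 h1

-- The origin is the starting point of the first bottom side, which lies at the vertex `0` of the
-- circle even if all even sides are erased.
include h hd hm in
theorem orderAt_proj_zero (hn : 0 < n) :
    P.cylinderGluing.quadraticDifferential.orderAt (P.cylinderGluing.proj 0) =
      ((d ⟨0, hn⟩ : ℤ) : WithTop ℤ) := by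
  obtain ⟨x, l, hxl⟩ := List.exists_cons_of_ne_nil P.word_ne_nil
  have hx : x ∈ P.word false := by simp [hxl]
  have h0 : P.sidePoint x 0 = 0 := by
    simp [WordGluing.sidePoint, WordGluing.start, P.side_eq hx, hxl, startIn]
  rw [← h0, WordGluing.proj_sidePoint]
  refine h.orderAt_of_source_inl hd hm (WordGluing.mem_letters_of_mem hx) ?_
  rw [h.word_false] at hx hxl
  rw [source, isTop_of_mem_bottomWord hx]
  exact left_head_bottomWord x (by rw [hxl]; simp)

end IsGenusOne

/-! ### The lines with erased symbols as gluing data -/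

namespace GenusOneSide

variable {e : ℕ → Bool} {m : ℕ}

/-- The gluing pattern of the words of genus one. -/
def wordGluing (e : ℕ → Bool) (m : ℕ) (ℓ : ℕ → ℝ) (τ : ℂ)
    (hpos : ∀ x ∈ bottomWord e m ++ (topWord e m).reverse, 0 < ℓ (symbol m x))
    (hsum : ((bottomWord e m).map fun x => ℓ (symbol m x)).sum =
      ((topWord e m).map fun x => ℓ (symbol m x)).sum) (hτ : 0 < τ.im) :
    WordGluing GenusOneSide where
  word s := if s then (topWord e m).reverse else bottomWord e m
  nodup := nodup_words
  word_ne_nil := by simp [bottomWord]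
  ι := flipPerm
  ι_ι := flip_flip
  ι_ne := flip_ne
  ι_mem _ := flip_mem_words
  len x := ℓ (symbol m x)
  len_pos := hpos
  len_ι x := by cases x <;> rfl
  sum_eq := by simpa [List.sum_reverse] using hsum
  τ := τ
  im_pos := hτ

theorem count_symbol {x : GenusOneSide} (hx : x ∈ bottomWord e m ++ (topWord e m).reverse) :
    ((bottomWord e m ++ (topWord e m).reverse).map (symbol m)).count (symbol m x) = 2 := by
  have h1 : ((bottomWord e m ++ (topWord e m).reverse).filter fun y =>
      symbol m y = symbol m x).toFinset = {x, x.flip} := by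
    ext y
    simp only [List.mem_toFinset, List.mem_filter, decide_eq_true_eq, Finset.mem_insert,
      Finset.mem_singleton]
    constructor
    · rintro ⟨hy, hyx⟩
      exact (symbol_eq_iff hx hy).1 hyx.symm
    · rintro (rfl | rfl)
      · exact ⟨hx, rfl⟩
      · exact ⟨flip_mem_words hx, by cases x <;> rfl⟩
  rw [List.count_eq_countP, List.countP_map, List.countP_eq_length_filter]
  have h2 : ((fun y => y == symbol m x) ∘ symbol m) = fun y => decide (symbol m y = symbol m x) := by
    funext y
    simp [Bool.beq_eq_decide_eq]
  rw [h2, ← List.toFinset_card_of_nodup (nodup_words.filter _), h1, Finset.card_pair (flip_ne x).symm]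

end GenusOneSide

section Erased

open GenusOneSide

variable {n : ℕ} {d : Fin n → ℕ} {m : ℕ} (hm : ∑ i, d i = m + 1)

include hm

/-- Neither set of symbols contains the other: `3` occurs only in the top line, where `0 < m` is
needed, and `2 * (m + 1)` only in the bottom line. Each symbol occurs twice because its occurrences
are a side and its flip. -/
theorem isCylindrical_erase (hm0 : 0 < m) :
    ((genusOnePermutation (m + 1)).erase (erasedSymbols d)).IsCylindrical := by
  rw [TwoLines.IsCylindrical, TwoLines.IsGeneralizedPermutation, erase_top, erase_bottom hm]
  refine ⟨⟨by simp, by simp, ?_⟩, .inl (by simp), fun hs => ?_, fun hs => ?_⟩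
  · have h0 : (0 :: (topWord (isErased d) m).map (symbol m) ++
        ((bottomWord (isErased d) m).map (symbol m) ++ [0])).Perm
        (0 :: 0 :: (bottomWord (isErased d) m ++ (topWord (isErased d) m).reverse).map (symbol m)) := by
      rw [List.perm_iff_count]
      intro a
      simp only [List.cons_append, List.count_cons, List.count_append, List.map_append,
        List.map_reverse, List.count_reverse, List.count_nil]
      omega
    intro a ha
    rw [h0.mem_iff, List.mem_cons, List.mem_cons, ← or_assoc, or_self] at ha
    rw [h0.count_eq]
    rcases ha with rfl | ha
    · rw [List.count_cons_self, List.count_cons_self, List.count_eq_zero.2]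
      intro h
      obtain ⟨x, -, hx⟩ := List.mem_map.1 h
      exact symbol_ne_zero m x hx
    · obtain ⟨x, hx, rfl⟩ := List.mem_map.1 ha
      rw [List.count_cons_of_ne (symbol_ne_zero m x).symm,
        List.count_cons_of_ne (symbol_ne_zero m x).symm, count_symbol hx]
  · have : 3 ∈ (0 :: (topWord (isErased d) m).map (symbol m)).toFinset := by
      rw [List.mem_toFinset]
      exact .tail _ (List.mem_map.2 ⟨spike 0 false, mem_topWord.2 (.inr ⟨0, hm0, by simp⟩), rfl⟩)
    have := hs.1 this
    rw [List.mem_toFinset, List.mem_append, List.mem_map] at this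
    rcases this with ⟨x, hx, hx'⟩ | h
    · rcases mem_bottomWord.1 hx with ⟨k, -, -, rfl⟩ | rfl | rfl | rfl <;> simp [symbol] at hx' <;>
        omega
    · simp at h
  · have : 2 * (m + 1) ∈ ((bottomWord (isErased d) m).map (symbol m) ++ [0]).toFinset := by
      rw [List.mem_toFinset]
      exact List.mem_append_left _
        (List.mem_map.2 ⟨cap false, mem_bottomWord.2 (by simp), rfl⟩)
    have := hs.1 this
    rw [List.mem_toFinset, List.mem_cons, List.mem_map] at this
    rcases this with h | ⟨x, hx, hx'⟩
    · simp at h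
    · rcases mem_topWord.1 hx with rfl | ⟨k, hk, ⟨-, rfl⟩ | rfl | rfl⟩ <;> simp [symbol] at hx' <;>
        omega


theorem sum_topWord_eq {ℓ : ℕ → ℝ} {ζ : ℕ → ℂ} (hζ : ∀ a, (ζ a).re = ℓ a)
    (hsum : (((genusOnePermutation (m + 1)).erase (erasedSymbols d)).top.map ζ).sum =
      (((genusOnePermutation (m + 1)).erase (erasedSymbols d)).bottom.map ζ).sum) :
    ((bottomWord (isErased d) m).map fun x => ℓ (symbol m x)).sum =
      ((topWord (isErased d) m).map fun x => ℓ (symbol m x)).sum := by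
  have hre : ∀ l : List GenusOneSide, ((l.map fun x => ζ (symbol m x)).sum).re =
      (l.map fun x => ℓ (symbol m x)).sum := by
    intro l
    induction l with
    | nil => rfl
    | cons x l ih => simp [ih, hζ]
  rw [erase_top, erase_bottom hm, List.map_cons, List.sum_cons, List.map_append, List.sum_append,
    List.map_map, List.map_map] at hsum
  have h1 := congrArg Complex.re hsum
  simp only [Function.comp_def, Complex.add_re, hre, List.map_cons, List.map_nil, List.sum_cons,
    List.sum_nil, add_zero] at h1
  linarith

/-- The transverse symbol is forced to be `0`. Otherwise the last symbol of the top line would begin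
the bottom line, but it is some `2k + 3`, which does not occur there. For `m = 0` the last top
symbol is `1`, which does begin the bottom line. -/
theorem first_of_isSuspensionDatum (hm0 : 0 < m) {ζ : ℕ → ℂ}
    (hζ : ((genusOnePermutation (m + 1)).erase (erasedSymbols d)).IsSuspensionDatum ζ) :
    0 < (ζ 0).im ∧ ∀ x ∈ bottomWord (isErased d) m ++ (topWord (isErased d) m).reverse,
      0 < (ζ (symbol m x)).re ∧ (ζ (symbol m x)).im = 0 := by
  obtain ⟨⟨a₀, h1, h2⟩, -⟩ := hζ
  rw [erase_top, erase_bottom hm] at h1 h2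
  have h3 : a₀ = 0 ∧ 0 < (ζ a₀).im := by
    rcases h1 with ⟨h1, -, h3⟩ | ⟨h1, h3, -⟩
    · exact ⟨by simpa using h1.symm, h3⟩
    · exfalso
      have h4 := List.mem_of_mem_head? h1
      obtain ⟨k, rfl⟩ := Nat.exists_eq_succ_of_ne_zero hm0.ne'
      rw [List.getLast?_cons, List.getLast?_map, getLast?_topWord] at h3
      have h5 : 2 * k + 3 = a₀ := by simpa [topLast, symbol] using h3
      rw [List.mem_append, List.mem_map] at h4
      rcases h4 with ⟨x, hx, hx'⟩ | h4
      · rcases mem_bottomWord.1 hx with ⟨k, -, -, rfl⟩ | rfl | rfl | rfl <;>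
          simp only [symbol] at hx' <;> omega
      · simp at h4
        omega
  obtain ⟨rfl, h4⟩ := h3
  refine ⟨h4, fun x hx => h2 _ ?_ (symbol_ne_zero m x)⟩
  rw [List.mem_append, List.mem_reverse] at hx
  rw [List.mem_append, List.mem_cons, List.mem_append]
  rcases hx with hx | hx
  · exact .inr (.inl (List.mem_map_of_mem hx))
  · exact .inl (.inr (List.mem_map_of_mem hx))

theorem exists_isSuspension (hd : ∀ i, 0 < d i) (hm0 : 0 < m) {ζ : ℕ → ℂ}
    (hζ : ((genusOnePermutation (m + 1)).erase (erasedSymbols d)).IsSuspensionDatum ζ) :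
    ∃ (S : QuadraticSurface) (f : ℂ → S.carrier),
      ((genusOnePermutation (m + 1)).erase (erasedSymbols d)).IsSuspension ζ S f ∧
      S.InStratum d (m + 1) ∧ ∀ h : 0 < n, S.q.orderAt (f 0) = ((d ⟨0, h⟩ : ℤ) : WithTop ℤ) := by
  obtain ⟨h1, h2⟩ := first_of_isSuspensionDatum hm hm0 hζ
  let P := wordGluing (isErased d) m (fun a => (ζ a).re) (ζ 0) (fun x hx => (h2 x hx).1)
    (sum_topWord_eq hm (fun _ => rfl) hζ.2) h1
  have hP : IsGenusOne P (isErased d) m := ⟨rfl, rfl, rfl⟩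
  have hmem : ∀ x ∈ P.letters, x ∈ bottomWord (isErased d) m ++ (topWord (isErased d) m).reverse :=
    fun x hx => hx
  have hS : IsSpelling ((genusOnePermutation (m + 1)).erase (erasedSymbols d)) ζ P (symbol m) 0 :=
    { top_eq := by rw [erase_top, hP.word_true, List.reverse_reverse]
      bottom_eq := by rw [erase_bottom hm, hP.word_false]
      sym_eq_iff := fun x hx y hy => symbol_eq_iff (hmem x hx) (hmem y hy)
      sym_ne := fun x _ => symbol_ne_zero m x
      vector_eq := fun x hx => Complex.ext rfl (h2 x (hmem x hx)).2
      vector_transverse := rfl }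
  exact ⟨_, _, hS.isSuspension, hP.inStratum hd hm, fun hn => hP.orderAt_proj_zero hd hm hn⟩

end Erased

/-! ### Existence of side vectors -/

section Existence

open GenusOneSide

theorem sum_topWord {e : ℕ → Bool} {m : ℕ} {ζ : ℕ → ℂ} (h1 : ∀ a, a ≠ 0 → a < 2 * (m + 1) → ζ a = 1)
    {n : ℕ} (hn : n ≤ m) : ((topWord e n).map fun x => ζ (symbol m x)).sum =
      1 + ((evenWord e n).map fun x => ζ (symbol m x)).sum + 2 * n := by
  induction n with
  | zero => simpa [topWord, evenWord, symbol] using h1 1 one_ne_zero (by omega)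
  | succ n ih =>
    rw [topWord_succ, evenWord_succ, List.map_append, List.sum_append, List.map_append,
      List.sum_append, ih (by omega), topSegment]
    have h3 : ζ (2 * n + 3) = 1 := h1 _ (by omega) (by omega)
    cases e n <;> simp [symbol, h3] <;> ring

theorem exists_isSuspensionDatum {n : ℕ} {d : Fin n → ℕ} {m : ℕ} (hm : ∑ i, d i = m + 1)
    (hm0 : 0 < m) :
    ∃ ζ, ((genusOnePermutation (m + 1)).erase (erasedSymbols d)).IsSuspensionDatum ζ := by
  -- With unit lengths elsewhere, the top line exceeds the common sides by the `2m` spike halves and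
  -- the bottom line by the two sides of the cap, so these get length `m`.
  let ζ : ℕ → ℂ := fun a => if a = 0 then Complex.I else if a = 2 * (m + 1) then m else 1
  have h1 : ∀ a, a ≠ 0 → a < 2 * (m + 1) → ζ a = 1 := fun a ha ha' => by
    simp only [ζ]
    rw [if_neg ha, if_neg ha'.ne]
  have h2 : ∀ a, a ≠ 0 → 0 < (ζ a).re ∧ (ζ a).im = 0 := fun a ha => by
    simp only [ζ]
    rw [if_neg ha]
    split_ifs <;> simp [hm0]
  refine ⟨ζ, ⟨0, .inl ⟨?_, ?_, ?_⟩, fun a _ ha => h2 a ha⟩, ?_⟩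
  · rw [erase_top]; rfl
  · rw [erase_bottom hm]; simp
  · simp [ζ]
  · have h3 : ζ (2 * (m + 1)) = m := by simp [ζ]
    rw [erase_top, erase_bottom hm, List.map_cons, List.sum_cons, List.map_append, List.sum_append,
      List.map_map, List.map_map]
    have h5 : symbol m (one true) = 1 := rfl
    have h6 : ∀ o, symbol m (cap o) = 2 * (m + 1) := fun _ => rfl
    have h4 := sum_topWord (e := isErased d) h1 le_rfl
    simp only [Function.comp_def, h4, bottomWord, List.map_append, List.sum_append, List.map_cons,
      List.map_nil, List.sum_cons, List.sum_nil, h5, h6, h3, h1 1 one_ne_zero (by omega)]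
    ring

end Existence

theorem proposition3p2 (n p : ℕ) (d : Fin n → ℕ) (hd : ∀ k, 0 < d k) (hsum : ∑ k, d k = p)
    (hp : 2 ≤ p) :
    ((genusOnePermutation p).erase (erasedSymbols d)).Represents d p := by
  obtain ⟨m, rfl⟩ : ∃ m, p = m + 1 := ⟨p - 1, by omega⟩
  exact ⟨isCylindrical_erase hsum (by omega), exists_isSuspensionDatum hsum (by omega),
    fun ζ hζ => exists_isSuspension hsum hd (by omega) hζ⟩
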